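/- **Setting.** Let $\mathbb S^1=\mathbb R/2\pi\mathbb Z$, let $|\theta-\theta'|$ denote the distance in $\mathbb S^1$, and let $0<\gamma<1$. For $k\in\{0,1\}$, $C^{k,\gamma}=C^{k,\gamma}(\mathbb S^1;\mathbb R^2)$ is the Hölder space with norm $$\|u\|_{C^{k,\gamma}}=\sum_{l\le k}\sup_\theta|\partial_\theta^l u(\theta)|+\sup_{0<|\theta-\theta'|<1}\frac{|\partial_\theta^ku(\theta)-\partial_\theta^ku(\theta')|}{|\theta-\theta'|^\gamma},$$ and the little Hölder space $h^{1,\gamma}$ is the closure of $C^\infty(\mathbb S^1;\mathbb R^2)$ in $C^{1,\gamma}$. For $X\in C^1(\mathbb S^1;\mathbb R^2)$ put $$|X|_*=\inf_{\theta\ne\theta'}\frac{|X(\theta)-X(\theta')|}{|\theta-\theta'|}.$$ Write $X=X(\theta)$, $X'=X(\theta')$, $\Delta X=X-X'$, and let $G(x)=\frac1{4\pi}\left(-\log|x|\,I+\frac{x\otimes x}{|x|^2}\right)$ be the Stokeslet. The boundary integral form of the Peskin problem is $$\partial_tX(\theta,t)=-\,\mathrm{p.v.}\!\int_{\mathbb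 S^1}\partial_{\theta'}G(X-X')\,\partial_{\theta'}X'\,d\theta'.\tag{1}$$ With $\mathcal H$ the Hilbert transform on $\mathbb S^1$ and $\Lambda=-\frac14\mathcal H\partial_\theta$, it is rewritten as $\partial_tX=\Lambda X+\mathcal R(X)$, where $$\mathcal R(X)(\theta)=-\frac1{4\pi}\int_{\mathbb S^1}\left(\left(\frac{\Delta X\cdot\partial_{\theta'}X'}{|\Delta X|^2}-\frac12\cot\frac{\theta-\theta'}2\right)I+\partial_{\theta'}\!\left(\frac{\Delta X\otimes\Delta X}{|\Delta X|^2}\right)\right)\partial_{\theta'}X'\,d\theta'.$$ The semigroup generated by $\Lambda$ is given by $e^{0\Lambda}u=u$ and, for $t>0$, $$e^{t\Lambda}u(\theta)=\frac1{2\pi}\int_{\mathbb S^1}P(e^{-t/4},\theta-\theta')u(\theta')\,d\theta',\qquad P(r,\theta)=\frac{1-r^2}{1-2r\cos\theta+r^2}.$$ Let $T>0$. * A *mild solution* on $[0,T]$ with initial value $X_0$ is an $X\in C([0,T];C^{1,\gamma})$ with $|X(t)|_*>0$ for $0\le t\le T$, with $X(0)=X_0$, $X(t)\to X_0$ in $C^{1,\gamma}$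 as $t\to0$, and $$X(t)=e^{t\Lambda}X_0+\int_0^te^{(t-s)\Lambda}\mathcal R(X(s))\,ds\qquad(0<t\le T).$$ * A *strong solution* on $[0,T]$ with initial value $X_0$ is an $X\in C([0,T];C^{1,\gamma})\cap C^1([0,T];C^{0,\gamma})$ with $|X(t)|_*>0$ for $0\le t\le T$, with $X(0)=X_0$, $X(t)\to X_0$ in $C^{1,\gamma}$ as $t\to0$, which satisfies (1) for $0<t\le T$. **Theorem.** Let $0<\gamma<1$ and $X_0\in h^{1,\gamma}$ with $|X_0|_*>0$. 1. For some $T>0$ depending on $X_0$ there is a mild solution $X\in C([0,T];C^{1,\gamma})$ with initial value $X_0$. 2. For every $T>0$, any two mild solutions in $C([0,T];C^{1,\gamma})$ with initial value $X_0$ coincide on $[0,T]$. 3. Let $T>0$ and let $X\in C([0,T];C^{1,\gamma})$ be a mild solution with initial value $X_0$. Then there is $\varepsilon>0$ such that for every $Y_0\in h^{1,\gamma}$ with $\|X_0-Y_0\|_{C^{1,\gamma}}\le\varepsilon$ there is a mild solution $X(\cdot\,;Y_0)\in C([0,T];C^{1,\gamma})$ with initial value $Y_0$ (on the same interval $[0,T]$).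 Moreover, on the set of these $Y_0$, with the $C^{1,\gamma}$ norm, the map $Y_0\mapsto X(\cdot\,;Y_0)\in C([0,T];C^{1,\gamma})$ is continuous. 4. For every $T>0$, a function $X$ is a mild solution on $[0,T]$ with initial value $X_0$ if and only if it is a strong solution on $[0,T]$ with initial value $X_0$. -/

import Mathlib

open Set Filter Topology MeasureTheory
open scoped ContDiff ENNReal

noncomputable section

namespace Peskin

/-- The Euclidean plane. Functions on the circle `ℝ / 2πℤ` are represented throughout by
`2π`-periodic functions on `ℝ`. -/
abbrev Plane : Type := EuclideanSpace ℝ (Fin 2)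

/-! ### Hölder spaces on the circle -/

/-- The supremum of `|f|`, with values in `[0, ∞]`. -/
def eSup (f : ℝ → Plane) : ℝ≥0∞ := ⨆ θ : ℝ, ‖f θ‖ₑ

/-- The Hölder seminorm: the supremum of `|f θ - f θ'| / |θ - θ'| ^ γ` over `0 < |θ - θ'| < 1`,
with values in `[0, ∞]`. -/
def eHolder (γ : ℝ) (f : ℝ → Plane) : ℝ≥0∞ :=
  ⨆ p : {p : ℝ × ℝ // p.1 ≠ p.2 ∧ |p.1 - p.2| < 1},
    ‖(|p.1.1 - p.1.2| ^ γ)⁻¹ • (f p.1.1 - f p.1.2)‖ₑ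

/-- The `C^{k,γ}` norm, with values in `[0, ∞]`. -/
def eHolderNorm (k : ℕ) (γ : ℝ) (f : ℝ → Plane) : ℝ≥0∞ :=
  (∑ l ∈ Finset.range (k + 1), eSup (iteratedDeriv l f)) + eHolder γ (iteratedDeriv k f)

theorem eSup_add_le (f g : ℝ → Plane) : eSup (f + g) ≤ eSup f + eSup g :=
  iSup_le fun θ => (enorm_add_le _ _).trans
    (add_le_add (le_iSup (fun θ => ‖f θ‖ₑ) θ) (le_iSup (fun θ => ‖g θ‖ₑ) θ))

theorem eSup_smul (c : ℝ) (f : ℝ → Plane) : eSup (c • f) = ‖c‖ₑ * eSup f := by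
  simp only [eSup, Pi.smul_apply, enorm_smul, ENNReal.mul_iSup]

theorem eHolder_add_le (γ : ℝ) (f g : ℝ → Plane) :
    eHolder γ (f + g) ≤ eHolder γ f + eHolder γ g := by
  refine iSup_le fun p => ?_
  have h : (|p.1.1 - p.1.2| ^ γ)⁻¹ • ((f + g) p.1.1 - (f + g) p.1.2)
      = (|p.1.1 - p.1.2| ^ γ)⁻¹ • (f p.1.1 - f p.1.2)
        + (|p.1.1 - p.1.2| ^ γ)⁻¹ • (g p.1.1 - g p.1.2) := by
    rw [← smul_add, Pi.add_apply, Pi.add_apply, add_sub_add_comm]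
  rw [h]
  exact (enorm_add_le _ _).trans (add_le_add
    (le_iSup (fun p : {p : ℝ × ℝ // p.1 ≠ p.2 ∧ |p.1 - p.2| < 1} =>
      ‖(|p.1.1 - p.1.2| ^ γ)⁻¹ • (f p.1.1 - f p.1.2)‖ₑ) p)
    (le_iSup (fun p : {p : ℝ × ℝ // p.1 ≠ p.2 ∧ |p.1 - p.2| < 1} =>
      ‖(|p.1.1 - p.1.2| ^ γ)⁻¹ • (g p.1.1 - g p.1.2)‖ₑ) p))

theorem eHolder_smul (γ c : ℝ) (f : ℝ → Plane) :
    eHolder γ (c • f) = ‖c‖ₑ * eHolder γ f := by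
  simp only [eHolder, Pi.smul_apply, ← smul_sub, smul_comm _ c, enorm_smul c, ENNReal.mul_iSup]

theorem iteratedDeriv_add_fun {k l : ℕ} (hl : l ≤ k) {f g : ℝ → Plane}
    (hf : ContDiff ℝ k f) (hg : ContDiff ℝ k g) :
    iteratedDeriv l (f + g) = iteratedDeriv l f + iteratedDeriv l g := by
  funext x
  exact iteratedDeriv_add ((hf.of_le (by exact_mod_cast hl)).contDiffAt)
    ((hg.of_le (by exact_mod_cast hl)).contDiffAt)

theorem iteratedDeriv_smul_fun (l : ℕ) (c : ℝ) (f : ℝ → Plane) :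
    iteratedDeriv l (c • f) = c • iteratedDeriv l f :=
  funext fun _ => iteratedDeriv_const_smul_field c f

theorem eHolderNorm_add_le {k : ℕ} (γ : ℝ) {f g : ℝ → Plane}
    (hf : ContDiff ℝ k f) (hg : ContDiff ℝ k g) :
    eHolderNorm k γ (f + g) ≤ eHolderNorm k γ f + eHolderNorm k γ g := by
  unfold eHolderNorm
  rw [iteratedDeriv_add_fun le_rfl hf hg, add_add_add_comm, ← Finset.sum_add_distrib]
  refine add_le_add (Finset.sum_le_sum fun l hl => ?_) (eHolder_add_le _ _ _)
  rw [iteratedDeriv_add_fun (Nat.lt_succ_iff.1 (Finset.mem_range.1 hl)) hf hg]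
  exact eSup_add_le _ _

theorem eHolderNorm_smul (k : ℕ) (γ c : ℝ) (f : ℝ → Plane) :
    eHolderNorm k γ (c • f) = ‖c‖ₑ * eHolderNorm k γ f := by
  simp only [eHolderNorm, iteratedDeriv_smul_fun, eSup_smul, eHolder_smul, mul_add,
    Finset.mul_sum]

/-- The vector space underlying `C^{k,γ}(S¹; ℝ²)`: the `2π`-periodic `C^k` functions with finite
`C^{k,γ}` norm. -/
def holderSubmodule (k : ℕ) (γ : ℝ) : Submodule ℝ (ℝ → Plane) where
  carrier := {f | Function.Periodic f (2 * Real.pi) ∧ ContDiff ℝ k f ∧ eHolderNorm k γ f < ⊤}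
  add_mem' := by
    rintro f g ⟨hf, hf', hf''⟩ ⟨hg, hg', hg''⟩
    exact ⟨hf.add hg, hf'.add hg',
      (eHolderNorm_add_le γ hf' hg').trans_lt (ENNReal.add_lt_top.2 ⟨hf'', hg''⟩)⟩
  zero_mem' := by
    refine ⟨fun _ => rfl, contDiff_const, ?_⟩
    have h := eHolderNorm_smul k γ 0 (0 : ℝ → Plane)
    rw [zero_smul, enorm_zero, zero_mul] at h
    rw [h]
    exact ENNReal.zero_lt_top
  smul_mem' := by
    rintro c f ⟨hf, hf', hf''⟩
    refine ⟨hf.smul c, contDiff_const.smul hf', ?_⟩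
    rw [eHolderNorm_smul]
    exact ENNReal.mul_lt_top enorm_lt_top hf''

/-- The Hölder space `C^{k,γ}(S¹; ℝ²)`. -/
def HolderSpace (k : ℕ) (γ : ℝ) : Type := holderSubmodule k γ

instance (k : ℕ) (γ : ℝ) : AddCommGroup (HolderSpace k γ) :=
  inferInstanceAs (AddCommGroup (holderSubmodule k γ))

instance (k : ℕ) (γ : ℝ) : Module ℝ (HolderSpace k γ) :=
  inferInstanceAs (Module ℝ (holderSubmodule k γ))

instance (k : ℕ) (γ : ℝ) : CoeFun (HolderSpace k γ) (fun _ => ℝ → Plane) :=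
  ⟨fun u => u.1⟩

instance (k : ℕ) (γ : ℝ) : Norm (HolderSpace k γ) :=
  ⟨fun u => (eHolderNorm k γ u).toReal⟩

theorem holderSpace_core (k : ℕ) (γ : ℝ) : NormedSpace.Core ℝ (HolderSpace k γ) where
  norm_nonneg u := ENNReal.toReal_nonneg
  norm_smul c u := by
    change (eHolderNorm k γ (c • u.1)).toReal = ‖c‖ * (eHolderNorm k γ u.1).toReal
    rw [eHolderNorm_smul, ENNReal.toReal_mul, toReal_enorm]
  norm_triangle u v := by
    change (eHolderNorm k γ (u.1 + v.1)).toReal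
      ≤ (eHolderNorm k γ u.1).toReal + (eHolderNorm k γ v.1).toReal
    rw [← ENNReal.toReal_add u.2.2.2.ne v.2.2.2.ne]
    exact ENNReal.toReal_mono (ENNReal.add_lt_top.2 ⟨u.2.2.2, v.2.2.2⟩).ne
      (eHolderNorm_add_le γ u.2.2.1 v.2.2.1)
  norm_eq_zero_iff u := by
    change (eHolderNorm k γ u.1).toReal = 0 ↔ u = 0
    have hne : eHolderNorm k γ u.1 ≠ ⊤ := u.2.2.2.ne
    rw [ENNReal.toReal_eq_zero_iff, or_iff_left hne]
    constructor
    · intro h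
      apply Subtype.ext
      funext θ
      have h1 : (∑ l ∈ Finset.range (k + 1), eSup (iteratedDeriv l u.1)) = 0 :=
        (add_eq_zero.1 h).1
      have h2 : eSup (iteratedDeriv 0 u.1) = 0 :=
        Finset.sum_eq_zero_iff.1 h1 0 (Finset.mem_range.2 (Nat.succ_pos k))
      rw [iteratedDeriv_zero] at h2
      exact enorm_eq_zero.1 (ENNReal.iSup_eq_zero.1 h2 θ)
    · rintro rfl
      have h := eHolderNorm_smul k γ 0 (0 : ℝ → Plane)
      rw [zero_smul, enorm_zero, zero_mul] at h
      exact h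

instance (k : ℕ) (γ : ℝ) : NormedAddCommGroup (HolderSpace k γ) :=
  NormedAddCommGroup.ofCore (holderSpace_core k γ)

instance (k : ℕ) (γ : ℝ) : NormedSpace ℝ (HolderSpace k γ) :=
  NormedSpace.ofCore (holderSpace_core k γ)

/-- The little Hölder space `h^{1,γ}`: the closure in `C^{1,γ}` of the smooth functions. -/
def littleHolder (γ : ℝ) : Set (HolderSpace 1 γ) :=
  closure {u | ContDiff ℝ ∞ (u : ℝ → Plane)}

/-- The arc-chord quantity `|X|_*`: the infimum of `|X θ - X θ'| / |θ - θ'|` over pairs of distinct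
points of the circle, where `|θ - θ'|` is the distance in the circle `ℝ / 2πℤ`. -/
def arcChord (X : ℝ → Plane) : ℝ :=
  ⨅ p : {p : ℝ × ℝ // (p.1 : AddCircle (2 * Real.pi)) ≠ (p.2 : AddCircle (2 * Real.pi))},
    ‖X p.1.1 - X p.1.2‖ /
      dist (p.1.1 : AddCircle (2 * Real.pi)) (p.1.2 : AddCircle (2 * Real.pi))

/-! ### The boundary integral equation -/

/-- The tensor `x ⊗ x / |x|²`, as a linear map `v ↦ (x · v) x / |x|²`. -/
def tensor (x : Plane) : Plane →L[ℝ] Plane :=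
  (‖x‖ ^ 2)⁻¹ • InnerProductSpace.rankOne ℝ x x

/-- The Stokeslet `G(x) = (1 / 4π) (- log |x| I + x ⊗ x / |x|²)`. -/
def stokeslet (x : Plane) : Plane →L[ℝ] Plane :=
  (1 / (4 * Real.pi)) • (-Real.log ‖x‖ • ContinuousLinearMap.id ℝ Plane + tensor x)

/-- The integrand `- ∂_{θ'} G(X(θ) - X(θ')) ∂_{θ'} X(θ')`. -/
def biIntegrand (X : ℝ → Plane) (θ θ' : ℝ) : Plane :=
  -(deriv (fun s => stokeslet (X θ - X s)) θ' (deriv X θ'))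

/-- `v` is the principal value integral `- p.v. ∫ ∂_{θ'} G(X(θ) - X(θ')) ∂_{θ'} X(θ') dθ'` over the
circle. -/
def IsBoundaryIntegral (X : ℝ → Plane) (θ : ℝ) (v : Plane) : Prop :=
  Tendsto (fun ε : ℝ => (∫ θ' in (θ - Real.pi)..(θ - ε), biIntegrand X θ θ')
      + ∫ θ' in (θ + ε)..(θ + Real.pi), biIntegrand X θ θ') (𝓝[>] 0) (𝓝 v)

/-- The nonlinear remainder `R(X)`, i.e. what is left of the right-hand side of the boundary
integral equation after `Λ X = - (1/4) H(∂_θ X)` has been taken out, `H` the Hilbert transform. -/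
def remainder (X : ℝ → Plane) (θ : ℝ) : Plane :=
  -(1 / (4 * Real.pi)) • ∫ θ' in (θ - Real.pi)..(θ + Real.pi),
    ((inner ℝ (X θ - X θ') (deriv X θ') / ‖X θ - X θ'‖ ^ 2
        - 1 / 2 * Real.cot ((θ - θ') / 2)) • deriv X θ'
      + deriv (fun s => tensor (X θ - X s)) θ' (deriv X θ'))

/-- The Poisson kernel of the unit disk. -/
def poisson (r θ : ℝ) : ℝ := (1 - r ^ 2) / (1 - 2 * r * Real.cos θ + r ^ 2)

/-- The semigroup `e^{tΛ}`, `Λ = - (1/4) H ∂_θ`, `t ≥ 0`: the Fourier multiplier with symbol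
`e^{-t|k|/4}`, which for `t > 0` is convolution with the Poisson kernel `P(e^{-t/4}, ·)`. -/
def semigroup (t : ℝ) (u : ℝ → Plane) (θ : ℝ) : Plane :=
  if t = 0 then u θ
  else (1 / (2 * Real.pi)) • ∫ θ' in (0 : ℝ)..(2 * Real.pi),
    poisson (Real.exp (-t / 4)) (θ - θ') • u θ'

/-- `X ∈ C([0,T]; C^{1,γ})` is a mild solution with initial value `X₀`. Only the values of `X` on
`[0,T]` matter. -/
structure IsMildSolution {γ : ℝ} (T : ℝ) (X₀ : HolderSpace 1 γ) (X : ℝ → HolderSpace 1 γ) :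
    Prop where
  continuousOn : ContinuousOn X (Icc 0 T)
  arcChord_pos : ∀ t ∈ Icc 0 T, 0 < arcChord (X t)
  initial : X 0 = X₀
  tendsto_initial : Tendsto X (𝓝[>] 0) (𝓝 X₀)
  integrable : ∀ t ∈ Ioc 0 T, ∀ θ : ℝ,
    IntervalIntegrable (fun s => semigroup (t - s) (remainder (X s)) θ) volume 0 t
  eqn : ∀ t ∈ Ioc 0 T, ∀ θ : ℝ,
    X t θ = semigroup t X₀ θ + ∫ s in (0 : ℝ)..t, semigroup (t - s) (remainder (X s)) θ

/-- `X ∈ C([0,T]; C^{1,γ}) ∩ C¹([0,T]; C^{0,γ})` is a strong solution with initial value `X₀`. Here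
`Y` is `X` regarded as a `C^{0,γ}`-valued function, and `V` is its time derivative (one-sided at the
end points). -/
structure IsStrongSolution {γ : ℝ} (T : ℝ) (X₀ : HolderSpace 1 γ) (X : ℝ → HolderSpace 1 γ) :
    Prop where
  continuousOn : ContinuousOn X (Icc 0 T)
  arcChord_pos : ∀ t ∈ Icc 0 T, 0 < arcChord (X t)
  initial : X 0 = X₀
  tendsto_initial : Tendsto X (𝓝[>] 0) (𝓝 X₀)
  eqn : ∃ Y V : ℝ → HolderSpace 0 γ,
    (∀ t ∈ Icc 0 T, ∀ θ : ℝ, Y t θ = X t θ) ∧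
    (∀ t ∈ Icc 0 T, HasDerivWithinAt Y (V t) (Icc 0 T) t) ∧
    ContinuousOn V (Icc 0 T) ∧
    ∀ t ∈ Ioc 0 T, ∀ θ : ℝ, IsBoundaryIntegral (X t) θ (V t θ)

end Peskin

end

open Set Filter Topology MeasureTheory
open scoped ContDiff ENNReal

noncomputable section

namespace Peskin

/-! ### Pointwise description of the Hölder norms -/

section HolderAPI

variable {k : ℕ} {γ : ℝ}

/-! The equation is semilinear: after `Λ X` is removed, the remainder is of lower order. Put `ΔX =
(θ - θ') d`, with `d` the secant slope, and `∂X' = d - (θ - θ') b`, with `b` the `θ'`-derivative of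
`d`. The factor multiplying `1 / (θ - θ')` in the integrand of `R(X)` vanishes when `∂X' = d`, so
each component of the integrand is a combination of the `b_j` with bounded coefficients, minus the
bounded function `cotDiff` times `∂X'` (`remainderIntegrand_apply`). For `X` in `C^{1,γ}` one has `b
= O(|θ - θ'|^(γ-1))`, and the coefficients are `γ`-Hölder at the diagonal. Freezing them there shows
that the integral lies in `C^{0,α}` for every `γ < α < min(2γ, 1)` (`exists_kernel_integral_bound`).
The coefficients are rational in `d` and `∂X'`, with denominators controlled by the arc-chord
quantity, so `R` is Lipschitz into `C^{0,α}` wherever the norm is bounded and the arc-chord quantity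
is bounded below (`exists_remainderMap`).

Weighted bounds on the Poisson kernel show that the semigroup maps `C^{0,α}` to `C^{1,γ}` with norm
`O(t^(-β))`, `β < 1` (`exists_semigroupMap`). It is uniformly bounded on `C^{1,γ}` and converges to
the identity on smooth functions, hence is strongly continuous on their closure (`exists_heatMap`).
The mild formulation is therefore a Volterra equation with an integrable singularity. In the norm
`sup e^(-lt) ‖·‖` with `l` large, the Duhamel term of a Lipschitz nonlinearity contracts by the
factor `1/2`. Two abstract facts follow: solutions depend Lipschitz continuously on the
inhomogeneity (`IsSmoothing.exists_stability`), and near a path that almost solves the equation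
there is a solution (`IsSmoothing.exists_solution`). The constant path `X₀` almost solves it for a
short time, which gives existence. Stability with equal data gives uniqueness. A given solution on
`[0,T]` almost solves the equation with nearby data on the whole interval, which gives the third
assertion.

For the equivalence, oddness of the cotangent kernel identifies the principal value with `Λ X +
R(X)` (`isBoundaryIntegral_iff`). Fourier coefficients are continuous functionals under which `Λ`
becomes multiplication by `-n/4` and the semigroup multiplication by `e^(-nt/4)`. Mode by mode, the
mild and strong formulations are the integrated and the differential form of one linear ordinary
differential equation, and the modes determine the function (`eq_of_pairing_eq`). -/

@[ext] theorem HolderSpace.ext {u v : HolderSpace k γ} (h : ∀ θ, u θ = v θ) : u = v :=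
  Subtype.ext (funext h)

@[simp] theorem HolderSpace.coe_add (u v : HolderSpace k γ) (θ : ℝ) : (u + v) θ = u θ + v θ := rfl
@[simp] theorem HolderSpace.coe_sub (u v : HolderSpace k γ) (θ : ℝ) : (u - v) θ = u θ - v θ := rfl
@[simp] theorem HolderSpace.coe_smul (c : ℝ) (u : HolderSpace k γ) (θ : ℝ) :
    (c • u) θ = c • u θ := rfl
theorem HolderSpace.norm_def (u : HolderSpace k γ) : ‖u‖ = (eHolderNorm k γ u).toReal := rfl

theorem HolderSpace.periodic (u : HolderSpace k γ) : Function.Periodic u (2 * Real.pi) := u.2.1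

theorem HolderSpace.contDiff (u : HolderSpace k γ) : ContDiff ℝ k u := u.2.2.1

theorem HolderSpace.continuous (u : HolderSpace k γ) : Continuous u := u.contDiff.continuous

theorem HolderSpace.norm_iteratedDeriv_le (u : HolderSpace k γ) {l : ℕ} (hl : l ≤ k) (θ : ℝ) :
    ‖iteratedDeriv l u θ‖ ≤ ‖u‖ := by
  rw [HolderSpace.norm_def, ← toReal_enorm]
  refine ENNReal.toReal_mono u.2.2.2.ne ?_
  refine (le_iSup (fun θ => ‖iteratedDeriv l u θ‖ₑ) θ).trans ?_
  refine le_trans ?_ le_self_add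
  exact Finset.single_le_sum (f := fun l => eSup (iteratedDeriv l u)) (fun _ _ => zero_le)
    (Finset.mem_range.2 (Nat.lt_succ_of_le hl))

theorem HolderSpace.norm_apply_le (u : HolderSpace k γ) (θ : ℝ) : ‖u θ‖ ≤ ‖u‖ := by
  simpa using u.norm_iteratedDeriv_le (Nat.zero_le k) θ

/-- The seminorm only sees pairs at distance below `1`. For the others `|θ - θ'|^γ ≥ 1` and two sup
bounds suffice, whence the factor `2`. -/
theorem HolderSpace.norm_iteratedDeriv_sub_le (u : HolderSpace k γ) (hγ : 0 < γ) (θ θ' : ℝ) :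
    ‖iteratedDeriv k u θ - iteratedDeriv k u θ'‖ ≤ 2 * ‖u‖ * |θ - θ'| ^ γ := by
  have hu : 0 ≤ ‖u‖ := norm_nonneg u
  rcases eq_or_ne θ θ' with rfl | hne
  · simp [Real.zero_rpow hγ.ne']
  have hpos : 0 < |θ - θ'| := abs_pos.2 (sub_ne_zero.2 hne)
  by_cases h1 : |θ - θ'| < 1
  · have h2 : ‖(|θ - θ'| ^ γ)⁻¹ • (iteratedDeriv k u θ - iteratedDeriv k u θ')‖ ≤ ‖u‖ := by
      rw [HolderSpace.norm_def, ← toReal_enorm]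
      refine ENNReal.toReal_mono u.2.2.2.ne ?_
      refine le_trans ?_ le_add_self
      exact le_iSup (fun p : {p : ℝ × ℝ // p.1 ≠ p.2 ∧ |p.1 - p.2| < 1} =>
        ‖(|p.1.1 - p.1.2| ^ γ)⁻¹ • (iteratedDeriv k u p.1.1 - iteratedDeriv k u p.1.2)‖ₑ)
        ⟨(θ, θ'), hne, h1⟩
    have h3 : 0 < |θ - θ'| ^ γ := Real.rpow_pos_of_pos hpos γ
    rw [norm_smul, norm_inv, Real.norm_of_nonneg h3.le, inv_mul_le_iff₀ h3] at h2
    nlinarith [mul_nonneg hu h3.le]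
  · have h3 : 1 ≤ |θ - θ'| ^ γ := Real.one_le_rpow (not_lt.1 h1) hγ.le
    calc _ ≤ ‖u‖ + ‖u‖ := (norm_sub_le _ _).trans
          (add_le_add (u.norm_iteratedDeriv_le le_rfl θ) (u.norm_iteratedDeriv_le le_rfl θ'))
      _ ≤ _ := by nlinarith

theorem HolderSpace.norm_sub_le_rpow (u : HolderSpace 0 γ) (hγ : 0 < γ) (θ θ' : ℝ) :
    ‖u θ - u θ'‖ ≤ 2 * ‖u‖ * |θ - θ'| ^ γ := by
  simpa using u.norm_iteratedDeriv_sub_le hγ θ θ'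

theorem HolderSpace.hasDerivAt (u : HolderSpace 1 γ) (θ : ℝ) :
    HasDerivAt u (deriv u θ) θ :=
  (u.contDiff.differentiable (by norm_num) θ).hasDerivAt

theorem HolderSpace.continuous_deriv (u : HolderSpace 1 γ) : Continuous (deriv u) :=
  u.contDiff.continuous_deriv (by norm_num)

theorem HolderSpace.norm_deriv_le (u : HolderSpace 1 γ) (θ : ℝ) : ‖deriv u θ‖ ≤ ‖u‖ := by
  simpa [iteratedDeriv_one] using u.norm_iteratedDeriv_le le_rfl θ

theorem HolderSpace.norm_deriv_sub_le (u : HolderSpace 1 γ) (hγ : 0 < γ) (θ θ' : ℝ) :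
    ‖deriv u θ - deriv u θ'‖ ≤ 2 * ‖u‖ * |θ - θ'| ^ γ := by
  simpa [iteratedDeriv_one] using u.norm_iteratedDeriv_sub_le hγ θ θ'

theorem HolderSpace.periodic_deriv (u : HolderSpace 1 γ) :
    Function.Periodic (deriv u) (2 * Real.pi) := fun θ => by
  rw [← deriv_comp_add_const]
  congr 1
  exact funext u.periodic

theorem HolderSpace.deriv_add (u v : HolderSpace 1 γ) (θ : ℝ) :
    deriv (u + v : HolderSpace 1 γ) θ = deriv u θ + deriv v θ :=
  ((u.hasDerivAt θ).add (v.hasDerivAt θ)).deriv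

theorem HolderSpace.deriv_sub (u v : HolderSpace 1 γ) (θ : ℝ) :
    deriv (u - v : HolderSpace 1 γ) θ = deriv u θ - deriv v θ :=
  ((u.hasDerivAt θ).sub (v.hasDerivAt θ)).deriv

theorem HolderSpace.deriv_smul (c : ℝ) (u : HolderSpace 1 γ) (θ : ℝ) :
    deriv (c • u : HolderSpace 1 γ) θ = c • deriv u θ :=
  ((u.hasDerivAt θ).const_smul c).deriv

theorem eSup_le_ofReal {f : ℝ → Plane} {A : ℝ} (h : ∀ θ, ‖f θ‖ ≤ A) :
    eSup f ≤ ENNReal.ofReal A :=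
  iSup_le fun θ => by
    rw [← ofReal_norm]
    exact ENNReal.ofReal_le_ofReal (h θ)

theorem eHolder_le_ofReal {f : ℝ → Plane} {C : ℝ}
    (h : ∀ θ θ', θ ≠ θ' → |θ - θ'| < 1 → ‖f θ - f θ'‖ ≤ C * |θ - θ'| ^ γ) :
    eHolder γ f ≤ ENNReal.ofReal C :=
  iSup_le fun p => by
    rw [← ofReal_norm]
    refine ENNReal.ofReal_le_ofReal ?_
    have h3 : 0 < |p.1.1 - p.1.2| ^ γ :=
      Real.rpow_pos_of_pos (abs_pos.2 (sub_ne_zero.2 p.2.1)) γ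
    rw [norm_smul, norm_inv, Real.norm_of_nonneg h3.le, inv_mul_le_iff₀ h3, mul_comm]
    exact h _ _ p.2.1 p.2.2

theorem continuous_of_holder {f : ℝ → Plane} {C : ℝ} (hγ : 0 < γ)
    (h : ∀ θ θ', θ ≠ θ' → |θ - θ'| < 1 → ‖f θ - f θ'‖ ≤ C * |θ - θ'| ^ γ) : Continuous f := by
  rw [continuous_iff_continuousAt]
  intro θ
  rw [ContinuousAt, tendsto_iff_norm_sub_tendsto_zero]
  have h1 : Tendsto (fun s : ℝ => C * |s - θ| ^ γ) (𝓝 θ) (𝓝 0) := by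
    have : Continuous fun s : ℝ => C * |s - θ| ^ γ :=
      continuous_const.mul (Continuous.rpow_const (by fun_prop) fun _ => Or.inr hγ.le)
    simpa [Real.zero_rpow hγ.ne'] using this.tendsto θ
  refine squeeze_zero' (Eventually.of_forall fun _ => norm_nonneg _) ?_ h1
  filter_upwards [Metric.ball_mem_nhds θ one_pos] with s hs
  rcases eq_or_ne s θ with rfl | hne
  · simp [Real.zero_rpow hγ.ne']
  · exact h s θ hne (by simpa [Real.dist_eq] using hs)

theorem norm_nonneg_of_bound {f : ℝ → Plane} {A : ℝ} (h : ∀ θ, ‖f θ‖ ≤ A) : 0 ≤ A :=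
  (norm_nonneg _).trans (h 0)

theorem nonneg_of_holder {f : ℝ → Plane} {C : ℝ}
    (h : ∀ θ θ', θ ≠ θ' → |θ - θ'| < 1 → ‖f θ - f θ'‖ ≤ C * |θ - θ'| ^ γ) : 0 ≤ C := by
  have h1 := (norm_nonneg _).trans (h (1 / 2) 0 (by norm_num) (by norm_num [abs_of_pos]))
  exact nonneg_of_mul_nonneg_left h1 (Real.rpow_pos_of_pos (by norm_num) γ)

/-- A periodic Hölder function is an element of `C^{0,γ}`. -/
theorem exists_holder_zero {f : ℝ → Plane} {A C : ℝ} (hγ : 0 < γ)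
    (hp : Function.Periodic f (2 * Real.pi)) (hA : ∀ θ, ‖f θ‖ ≤ A)
    (hC : ∀ θ θ', θ ≠ θ' → |θ - θ'| < 1 → ‖f θ - f θ'‖ ≤ C * |θ - θ'| ^ γ) :
    ∃ u : HolderSpace 0 γ, (∀ θ, u θ = f θ) ∧ ‖u‖ ≤ A + C := by
  have hn : eHolderNorm 0 γ f ≤ ENNReal.ofReal (A + C) := by
    rw [ENNReal.ofReal_add (norm_nonneg_of_bound hA) (nonneg_of_holder hC)]
    simp only [eHolderNorm, zero_add, Finset.range_one, Finset.sum_singleton, iteratedDeriv_zero]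
    exact add_le_add (eSup_le_ofReal hA) (eHolder_le_ofReal hC)
  refine ⟨⟨f, hp, contDiff_zero.2 (continuous_of_holder hγ hC), hn.trans_lt ENNReal.ofReal_lt_top⟩,
    fun _ => rfl, ?_⟩
  exact ENNReal.toReal_le_of_le_ofReal
    (add_nonneg (norm_nonneg_of_bound hA) (nonneg_of_holder hC)) hn

/-- A periodic function with Hölder derivative is an element of `C^{1,γ}`. -/
theorem exists_holder_one {f f' : ℝ → Plane} {A B C : ℝ} (hγ : 0 < γ)
    (hp : Function.Periodic f (2 * Real.pi)) (hd : ∀ θ, HasDerivAt f (f' θ) θ)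
    (hA : ∀ θ, ‖f θ‖ ≤ A) (hB : ∀ θ, ‖f' θ‖ ≤ B)
    (hC : ∀ θ θ', θ ≠ θ' → |θ - θ'| < 1 → ‖f' θ - f' θ'‖ ≤ C * |θ - θ'| ^ γ) :
    ∃ u : HolderSpace 1 γ, (∀ θ, u θ = f θ) ∧ ‖u‖ ≤ A + B + C := by
  have hdf : deriv f = f' := funext fun θ => (hd θ).deriv
  have hn : eHolderNorm 1 γ f ≤ ENNReal.ofReal (A + B + C) := by
    rw [ENNReal.ofReal_add (add_nonneg (norm_nonneg_of_bound hA) (norm_nonneg_of_bound hB))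
      (nonneg_of_holder hC), ENNReal.ofReal_add (norm_nonneg_of_bound hA) (norm_nonneg_of_bound hB)]
    simp only [eHolderNorm, Finset.sum_range_succ, Finset.range_zero, Finset.sum_empty, zero_add,
      iteratedDeriv_zero, iteratedDeriv_one, hdf]
    exact add_le_add (add_le_add (eSup_le_ofReal hA) (eSup_le_ofReal hB)) (eHolder_le_ofReal hC)
  have hc : ContDiff ℝ ((1 : ℕ) : WithTop ℕ∞) f := by
    have : ContDiff ℝ 1 f := contDiff_one_iff_deriv.2
      ⟨fun θ => (hd θ).differentiableAt, hdf ▸ continuous_of_holder hγ hC⟩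
    exact_mod_cast this
  refine ⟨⟨f, hp, hc, hn.trans_lt ENNReal.ofReal_lt_top⟩, fun _ => rfl, ?_⟩
  exact ENNReal.toReal_le_of_le_ofReal (add_nonneg (add_nonneg (norm_nonneg_of_bound hA)
    (norm_nonneg_of_bound hB)) (nonneg_of_holder hC)) hn

/-- The sharp Hölder bound on the pairs that enter the seminorm. -/
theorem HolderSpace.norm_iteratedDeriv_sub_le_of_lt (u : HolderSpace k γ) {θ θ' : ℝ}
    (hne : θ ≠ θ') (h1 : |θ - θ'| < 1) :
    ‖iteratedDeriv k u θ - iteratedDeriv k u θ'‖ ≤ ‖u‖ * |θ - θ'| ^ γ := by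
  have h2 : ‖(|θ - θ'| ^ γ)⁻¹ • (iteratedDeriv k u θ - iteratedDeriv k u θ')‖ ≤ ‖u‖ := by
    rw [HolderSpace.norm_def, ← toReal_enorm]
    refine ENNReal.toReal_mono u.2.2.2.ne ?_
    refine le_trans ?_ le_add_self
    exact le_iSup (fun p : {p : ℝ × ℝ // p.1 ≠ p.2 ∧ |p.1 - p.2| < 1} =>
      ‖(|p.1.1 - p.1.2| ^ γ)⁻¹ • (iteratedDeriv k u p.1.1 - iteratedDeriv k u p.1.2)‖ₑ)
      ⟨(θ, θ'), hne, h1⟩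
  have h3 : 0 < |θ - θ'| ^ γ := Real.rpow_pos_of_pos (abs_pos.2 (sub_ne_zero.2 hne)) γ
  rwa [norm_smul, norm_inv, Real.norm_of_nonneg h3.le, inv_mul_le_iff₀ h3, mul_comm] at h2

theorem completeSpace_holder_zero (hγ : 0 < γ) : CompleteSpace (HolderSpace 0 γ) := by
  refine Metric.complete_of_cauchySeq_tendsto fun u hu => ?_
  have hc : ∀ θ, ∃ v, Tendsto (fun n => u n θ) atTop (𝓝 v) := fun θ =>
    cauchySeq_tendsto_of_complete <| Metric.cauchySeq_iff.2 fun ε hε =>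
      (Metric.cauchySeq_iff.1 hu ε hε).imp fun N hN m hm n hn => by
        rw [dist_eq_norm]
        exact ((u m - u n).norm_apply_le θ).trans_lt (by rw [← dist_eq_norm]; exact hN m hm n hn)
  choose f hf using hc
  -- The bounds on `u m - u n` are pointwise and survive `m → ∞`, so `f - u n` is itself an element
  -- of small norm. Sup norm and seminorm each contribute one `ε`.
  have hkey : ∀ ε > 0, ∃ N, ∀ n ≥ N, ∃ w : HolderSpace 0 γ,
      (∀ θ, w θ = f θ - u n θ) ∧ ‖w‖ ≤ ε + ε := by
    intro ε hε
    obtain ⟨N, hN⟩ := Metric.cauchySeq_iff.1 hu ε hε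
    refine ⟨N, fun n hn => ?_⟩
    have hnm : ∀ᶠ m in atTop, ‖u m - u n‖ ≤ ε := by
      filter_upwards [eventually_ge_atTop N] with m hm
      rw [← dist_eq_norm]
      exact (hN m hm n hn).le
    refine exists_holder_zero hγ (fun θ => ?_) (fun θ => ?_) (fun θ θ' hne h1 => ?_)
    · have h2 : f (θ + 2 * Real.pi) = f θ :=
        tendsto_nhds_unique (hf _) (by simpa only [(u _).periodic θ] using hf θ)
      simp only [h2, (u n).periodic θ]
    · refine le_of_tendsto ((hf θ).sub_const (u n θ)).norm (hnm.mono fun m hm => ?_)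
      exact ((u m - u n).norm_apply_le θ).trans hm
    · refine le_of_tendsto (((hf θ).sub_const (u n θ)).sub ((hf θ').sub_const (u n θ'))).norm
        (hnm.mono fun m hm => ?_)
      have := (u m - u n).norm_iteratedDeriv_sub_le_of_lt hne h1
      simp only [iteratedDeriv_zero] at this
      exact this.trans (mul_le_mul_of_nonneg_right hm (by positivity))
  obtain ⟨N, hN⟩ := hkey 1 one_pos
  obtain ⟨w, hw, -⟩ := hN N le_rfl
  -- The limit `f` is recovered as an element of the space from `f - u N` and `u N`.
  refine ⟨w + u N, Metric.tendsto_atTop.2 fun ε hε => ?_⟩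
  obtain ⟨M, hM⟩ := hkey (ε / 3) (by positivity)
  refine ⟨M, fun n hn => ?_⟩
  obtain ⟨v, hv, hv'⟩ := hM n hn
  have : w + u N - u n = v := HolderSpace.ext fun θ => by simp [hw, hv]
  rw [dist_comm, dist_eq_norm, this]
  linarith

theorem completeSpace_holder_one (hγ : 0 < γ) : CompleteSpace (HolderSpace 1 γ) := by
  refine Metric.complete_of_cauchySeq_tendsto fun u hu => ?_
  have hc : ∀ θ, ∃ v, Tendsto (fun n => u n θ) atTop (𝓝 v) := fun θ =>
    cauchySeq_tendsto_of_complete <| Metric.cauchySeq_iff.2 fun ε hε =>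
      (Metric.cauchySeq_iff.1 hu ε hε).imp fun N hN m hm n hn => by
        rw [dist_eq_norm]
        exact ((u m - u n).norm_apply_le θ).trans_lt (by rw [← dist_eq_norm]; exact hN m hm n hn)
  have hc' : ∀ θ, ∃ v, Tendsto (fun n => deriv (u n) θ) atTop (𝓝 v) := fun θ =>
    cauchySeq_tendsto_of_complete <| Metric.cauchySeq_iff.2 fun ε hε =>
      (Metric.cauchySeq_iff.1 hu ε hε).imp fun N hN m hm n hn => by
        rw [dist_eq_norm, ← HolderSpace.deriv_sub]
        exact ((u m - u n).norm_deriv_le θ).trans_lt (by rw [← dist_eq_norm]; exact hN m hm n hn)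
  choose f hf using hc
  choose g hg using hc'
  have hclose : ∀ ε > 0, ∃ N, ∀ n ≥ N, ∀ θ, ‖g θ - deriv (u n) θ‖ ≤ ε := by
    intro ε hε
    obtain ⟨N, hN⟩ := Metric.cauchySeq_iff.1 hu ε hε
    refine ⟨N, fun n hn θ => le_of_tendsto ((hg θ).sub_const _).norm ?_⟩
    filter_upwards [eventually_ge_atTop N] with m hm
    rw [← HolderSpace.deriv_sub]
    refine ((u m - u n).norm_deriv_le θ).trans ?_
    rw [← dist_eq_norm]
    exact (hN m hm n hn).le
  -- The derivatives converge uniformly, so their limit is the derivative of the pointwise limit.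
  have hfg : ∀ θ, HasDerivAt f (g θ) θ := by
    refine hasDerivAt_of_tendstoUniformly (f := fun n θ => u n θ) (f' := fun n θ => deriv (u n) θ)
      (l := atTop) ?_ (Eventually.of_forall fun n θ => (u n).hasDerivAt θ) hf
    refine Metric.tendstoUniformly_iff.2 fun ε hε => ?_
    obtain ⟨N, hN⟩ := hclose (ε / 2) (by positivity)
    filter_upwards [eventually_ge_atTop N] with n hn θ
    rw [dist_eq_norm]
    exact (hN n hn θ).trans_lt (by linarith)
  have hkey : ∀ ε > 0, ∃ N, ∀ n ≥ N, ∃ w : HolderSpace 1 γ,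
      (∀ θ, w θ = f θ - u n θ) ∧ ‖w‖ ≤ ε + ε + ε := by
    intro ε hε
    obtain ⟨N, hN⟩ := Metric.cauchySeq_iff.1 hu ε hε
    refine ⟨N, fun n hn => ?_⟩
    have hnm : ∀ᶠ m in atTop, ‖u m - u n‖ ≤ ε := by
      filter_upwards [eventually_ge_atTop N] with m hm
      rw [← dist_eq_norm]
      exact (hN m hm n hn).le
    refine exists_holder_one hγ (f' := fun θ => g θ - deriv (u n) θ) (fun θ => ?_)
      (fun θ => (hfg θ).sub ((u n).hasDerivAt θ)) (fun θ => ?_) (fun θ => ?_)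
      (fun θ θ' hne h1 => ?_)
    · have h2 : f (θ + 2 * Real.pi) = f θ :=
        tendsto_nhds_unique (hf _) (by simpa only [(u _).periodic θ] using hf θ)
      simp only [h2, (u n).periodic θ]
    · refine le_of_tendsto ((hf θ).sub_const (u n θ)).norm (hnm.mono fun m hm => ?_)
      exact ((u m - u n).norm_apply_le θ).trans hm
    · refine le_of_tendsto ((hg θ).sub_const _).norm (hnm.mono fun m hm => ?_)
      rw [← HolderSpace.deriv_sub]
      exact ((u m - u n).norm_deriv_le θ).trans hm
    · refine le_of_tendsto (((hg θ).sub_const _).sub ((hg θ').sub_const _)).norm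
        (hnm.mono fun m hm => ?_)
      have := (u m - u n).norm_iteratedDeriv_sub_le_of_lt hne h1
      simp only [iteratedDeriv_one, HolderSpace.deriv_sub] at this
      exact this.trans (mul_le_mul_of_nonneg_right hm (by positivity))
  obtain ⟨N, hN⟩ := hkey 1 one_pos
  obtain ⟨w, hw, -⟩ := hN N le_rfl
  refine ⟨w + u N, Metric.tendsto_atTop.2 fun ε hε => ?_⟩
  obtain ⟨M, hM⟩ := hkey (ε / 4) (by positivity)
  refine ⟨M, fun n hn => ?_⟩
  obtain ⟨v, hv, hv'⟩ := hM n hn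
  have : w + u N - u n = v := HolderSpace.ext fun θ => by simp [hw, hv]
  rw [dist_comm, dist_eq_norm, this]
  linarith

end HolderAPI

/-! ### The arc-chord quantity -/

section ArcChord

variable {γ : ℝ}

/-- The range reaches `π + 1` because integrals at two points `θ₁`, `θ₂` at distance at most `1` are
compared over a period centred at `θ₁`. For `π < |y| ≤ π + 1` the circle distance is `2π - |y|`,
which is still at least `|y| / 3`. -/
theorem abs_div_three_le_dist {θ θ' : ℝ} (h : |θ - θ'| ≤ Real.pi + 1) :
    |θ - θ'| / 3 ≤ dist (θ : AddCircle (2 * Real.pi)) (θ' : AddCircle (2 * Real.pi)) := by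
  have hπ := Real.pi_gt_three
  rw [dist_eq_norm, ← AddCircle.coe_sub]
  set y := θ - θ'
  have h0 : |2 * Real.pi| / 2 = Real.pi := by rw [abs_of_pos (by positivity)]; ring
  by_cases h1 : |y| ≤ Real.pi
  · rw [(AddCircle.norm_coe_eq_abs_iff (2 * Real.pi) (x := y) (by positivity)).2 (by rw [h0]; exact h1)]
    linarith [abs_nonneg y]
  · push Not at h1
    have key : ∀ z : ℝ, Real.pi < z → z ≤ Real.pi + 1 →
        z / 3 ≤ ‖(z : AddCircle (2 * Real.pi))‖ := fun z hz hz' => by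
      have : (z : AddCircle (2 * Real.pi)) = ((z - 2 * Real.pi : ℝ) : AddCircle (2 * Real.pi)) := by
        rw [AddCircle.coe_sub, AddCircle.coe_period, sub_zero]
      rw [this, (AddCircle.norm_coe_eq_abs_iff (2 * Real.pi) (by positivity)).2
        (by rw [h0, abs_le]; constructor <;> linarith), abs_of_neg (by linarith)]
      linarith
    rcases abs_cases y with ⟨hy, -⟩ | ⟨hy, -⟩
    · rw [hy] at h1 h ⊢
      exact key y h1 h
    · rw [hy] at h1 h ⊢
      rw [← norm_neg, ← AddCircle.coe_neg]
      exact key (-y) h1 h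

theorem arcChord_mul_dist_le (X : ℝ → Plane) (θ θ' : ℝ) :
    arcChord X * dist (θ : AddCircle (2 * Real.pi)) (θ' : AddCircle (2 * Real.pi))
      ≤ ‖X θ - X θ'‖ := by
  by_cases h : (θ : AddCircle (2 * Real.pi)) = θ'
  · simp [h]
  · rw [← le_div_iff₀ (dist_pos.2 h)]
    exact ciInf_le (f := fun p : {p : ℝ × ℝ //
        (p.1 : AddCircle (2 * Real.pi)) ≠ (p.2 : AddCircle (2 * Real.pi))} =>
      ‖X p.1.1 - X p.1.2‖ /
      dist (p.1.1 : AddCircle (2 * Real.pi)) (p.1.2 : AddCircle (2 * Real.pi)))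
      ⟨0, by rintro _ ⟨p, rfl⟩; positivity⟩ ⟨(θ, θ'), h⟩

theorem le_arcChord {X : ℝ → Plane} {m : ℝ}
    (h : ∀ θ θ' : ℝ, m * dist (θ : AddCircle (2 * Real.pi)) (θ' : AddCircle (2 * Real.pi))
      ≤ ‖X θ - X θ'‖) : m ≤ arcChord X := by
  -- The bound below an infimum of reals requires a nonempty index set; `1` and `0` are distinct
  -- points of the circle.
  have : Nonempty {p : ℝ × ℝ //
      (p.1 : AddCircle (2 * Real.pi)) ≠ (p.2 : AddCircle (2 * Real.pi))} := by
    refine ⟨⟨(1, 0), fun h1 => ?_⟩⟩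
    have h2 := abs_div_three_le_dist (θ := 1) (θ' := 0) (by
      simp only [sub_zero, abs_one]; linarith [Real.pi_pos])
    simp only at h1
    rw [h1, dist_self] at h2
    norm_num at h2
  refine le_ciInf fun p => ?_
  rw [le_div_iff₀ (dist_pos.2 p.2)]
  exact h _ _

theorem HolderSpace.norm_sub_le_dist (u : HolderSpace 1 γ) (θ θ' : ℝ) :
    ‖u θ - u θ'‖
      ≤ ‖u‖ * dist (θ : AddCircle (2 * Real.pi)) (θ' : AddCircle (2 * Real.pi)) := by
  have hlip : ∀ a b : ℝ, ‖u a - u b‖ ≤ ‖u‖ * |a - b| := fun a b => by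
    have := Convex.norm_image_sub_le_of_norm_hasDerivWithin_le (f := u) (f' := deriv u)
      (s := univ) (C := ‖u‖) (fun x _ => (u.hasDerivAt x).hasDerivWithinAt)
      (fun x _ => u.norm_deriv_le x) convex_univ (mem_univ b) (mem_univ a)
    simpa [Real.norm_eq_abs] using this
  rw [dist_eq_norm, ← AddCircle.coe_sub, AddCircle.norm_eq]
  -- Shifting `θ` by `n` periods brings it to the representative whose real distance to `θ'` is the
  -- circle distance.
  set n := round ((2 * Real.pi)⁻¹ * (θ - θ'))
  have h1 : u (θ - n * (2 * Real.pi)) = u θ := u.periodic.sub_int_mul_eq n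
  rw [← h1]
  convert hlip (θ - n * (2 * Real.pi)) θ' using 3
  ring

/-- `X - Y` is Lipschitz on the circle with constant `‖X - Y‖`, so chords shrink by at most that
much. This keeps a `C^{1,γ}` ball around a nondegenerate curve nondegenerate. -/
theorem arcChord_sub_norm_le (X Y : HolderSpace 1 γ) : arcChord X - ‖X - Y‖ ≤ arcChord Y := by
  refine le_arcChord fun θ θ' => ?_
  have h1 := arcChord_mul_dist_le X θ θ'
  have h2 := (X - Y).norm_sub_le_dist θ θ'
  have h3 : X θ - X θ' = (Y θ - Y θ') + ((X - Y) θ - (X - Y) θ') := by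
    simp only [HolderSpace.coe_sub]; abel
  have h4 := norm_add_le (Y θ - Y θ') ((X - Y) θ - (X - Y) θ')
  rw [← h3] at h4
  rw [sub_mul]
  linarith

theorem continuous_arcChord : Continuous fun X : HolderSpace 1 γ => arcChord X := by
  refine (LipschitzWith.of_dist_le_mul (K := 1) fun X Y => ?_).continuous
  rw [Real.dist_eq, dist_eq_norm, NNReal.coe_one, one_mul, abs_le]
  have h1 := arcChord_sub_norm_le X Y
  have h2 := arcChord_sub_norm_le Y X
  rw [norm_sub_rev] at h2
  constructor <;> linarith

theorem arcChord_div_three_mul_le (X : ℝ → Plane) (hX : 0 ≤ arcChord X) {θ θ' : ℝ}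
    (h : |θ - θ'| ≤ Real.pi + 1) : arcChord X / 3 * |θ - θ'| ≤ ‖X θ - X θ'‖ := by
  have h1 := arcChord_mul_dist_le X θ θ'
  have h2 := mul_le_mul_of_nonneg_left (abs_div_three_le_dist h) hX
  linarith

/-- The chord bound passes to the limit of the slopes, which extends the lower bound to the
diagonal. -/
theorem arcChord_div_three_le_norm_deriv (X : HolderSpace 1 γ) (hX : 0 ≤ arcChord X) (θ : ℝ) :
    arcChord X / 3 ≤ ‖deriv X θ‖ := by
  refine ge_of_tendsto (hasDerivAt_iff_tendsto_slope.1 (X.hasDerivAt θ)).norm ?_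
  have h1 : ∀ᶠ s in 𝓝[≠] θ, s ∈ Metric.ball θ 1 :=
    mem_nhdsWithin_of_mem_nhds (Metric.ball_mem_nhds θ one_pos)
  filter_upwards [h1, self_mem_nhdsWithin] with s hs hne
  rw [Metric.mem_ball, Real.dist_eq] at hs
  have hpos : 0 < |s - θ| := abs_pos.2 (sub_ne_zero.2 hne)
  rw [slope_def_module, norm_smul, norm_inv, Real.norm_eq_abs, inv_mul_eq_div,
    le_div_iff₀ hpos]
  exact arcChord_div_three_mul_le X hX (by linarith [Real.pi_pos])

theorem ne_of_abs_sub_lt_two_pi (X : ℝ → Plane) (hX : 0 < arcChord X) {θ θ' : ℝ} (hne : θ ≠ θ')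
    (h : |θ - θ'| ≤ Real.pi + 1) : X θ ≠ X θ' := fun h1 => by
  have h2 := arcChord_div_three_mul_le X hX.le h
  rw [h1, sub_self, norm_zero] at h2
  have : 0 < |θ - θ'| := abs_pos.2 (sub_ne_zero.2 hne)
  nlinarith

end ArcChord

/-! ### Weakly singular kernels -/

section Kernels

variable {γ : ℝ}

theorem intervalIntegrable_abs_rpow {s : ℝ} (hs : -1 < s) (a b : ℝ) :
    IntervalIntegrable (fun y : ℝ => |y| ^ s) volume a b := by
  have h1 : ∀ c : ℝ, 0 ≤ c → IntervalIntegrable (fun y : ℝ => |y| ^ s) volume 0 c := fun c hc => by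
    refine (intervalIntegral.intervalIntegrable_rpow' hs).congr (fun y hy => ?_)
    rw [uIoc_of_le hc] at hy
    simp only [abs_of_pos hy.1]
  have h2 : ∀ c : ℝ, IntervalIntegrable (fun y : ℝ => |y| ^ s) volume 0 c := fun c => by
    rcases le_total 0 c with hc | hc
    · exact h1 c hc
    · have := (IntervalIntegrable.iff_comp_neg (by simp)).1 (h1 (-c) (by linarith))
      simpa using this
  exact (h2 a).symm.trans (h2 b)

/-- Integrals of `|θ - ·| ^ s`, `s > -1`, over windows of length `2π` near `θ`. -/
theorem exists_integral_abs_rpow_le {s : ℝ} (hs : -1 < s) :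
    ∃ J : ℝ, 0 ≤ J ∧ ∀ θ θ₀ : ℝ, |θ - θ₀| ≤ 1 →
      ∫ θ' in (θ₀ - Real.pi)..(θ₀ + Real.pi), |θ - θ'| ^ s ≤ J := by
  refine ⟨∫ y in (-(Real.pi + 1))..(Real.pi + 1), |y| ^ s, ?_, fun θ θ₀ h => ?_⟩
  · exact intervalIntegral.integral_nonneg (by linarith [Real.pi_pos]) fun _ _ => by positivity
  · rw [intervalIntegral.integral_comp_sub_left (fun y => |y| ^ s) θ]
    have h' := abs_le.1 h
    refine intervalIntegral.integral_mono_interval (by linarith) (by linarith [Real.pi_pos])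
      (by linarith) (Eventually.of_forall fun y => by positivity)
      (intervalIntegrable_abs_rpow hs _ _)

theorem intervalIntegrable_abs_sub_rpow {s : ℝ} (hs : -1 < s) (θ a b : ℝ) :
    IntervalIntegrable (fun y : ℝ => |θ - y| ^ s) volume a b := by
  have := (intervalIntegrable_abs_rpow hs (θ - a) (θ - b)).comp_sub_left θ
  simpa using this

/-- A scalar function with bounded, `γ`-Hölder derivative. -/
structure IsHolderDeriv (γ : ℝ) (u u' : ℝ → ℝ) (N : ℝ) : Prop where
  hasDerivAt : ∀ θ, HasDerivAt u (u' θ) θ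
  bound : ∀ θ, |u' θ| ≤ N
  holder : ∀ θ θ', |u' θ - u' θ'| ≤ N * |θ - θ'| ^ γ

/-- The difference quotient of `u`, extended by the derivative on the diagonal. -/
def secant (u u' : ℝ → ℝ) (θ θ' : ℝ) : ℝ :=
  if θ' = θ then u' θ else (u θ - u θ') / (θ - θ')

/-- The `θ'`-derivative of the difference quotient of `u`. -/
def secantDeriv (u u' : ℝ → ℝ) (θ θ' : ℝ) : ℝ := (secant u u' θ θ' - u' θ') / (θ - θ')

/-- Bounded kernels near the diagonal that are jointly `γ`-Hölder at the diagonal and whose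
`θ`-increments away from the diagonal are `O(|θ₁ - θ₂| |θ₁ - θ'| ^ (γ - 1))`. -/
structure IsKernel (γ : ℝ) (a : ℝ → ℝ → ℝ) (M : ℝ) : Prop where
  measurable : ∀ θ, Measurable (a θ)
  bound : ∀ θ θ', |θ - θ'| ≤ Real.pi + 1 → |a θ θ'| ≤ M
  diag : ∀ θ₀ θ θ', |θ - θ'| ≤ Real.pi + 1 →
    |a θ θ' - a θ₀ θ₀| ≤ M * (|θ - θ₀| + |θ' - θ₀|) ^ γ
  incr : ∀ θ₁ θ₂ θ', |θ₁ - θ'| ≤ Real.pi + 1 → |θ₂ - θ'| ≤ Real.pi + 1 →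
    2 * |θ₁ - θ₂| ≤ |θ₁ - θ'| → |a θ₁ θ' - a θ₂ θ'| ≤ M * (|θ₁ - θ₂| * |θ₁ - θ'| ^ (γ - 1))

/-! ### Algebra of kernels. -/

namespace IsKernel

variable {a b : ℝ → ℝ → ℝ} {M N : ℝ}

theorem nonneg (ha : IsKernel γ a M) : 0 ≤ M :=
  (abs_nonneg _).trans (ha.bound 0 0 (by simp only [sub_zero, abs_zero]; linarith [Real.pi_pos]))

theorem mono (ha : IsKernel γ a M) (h : M ≤ N) : IsKernel γ a N where
  measurable := ha.measurable
  bound θ θ' hθ := (ha.bound θ θ' hθ).trans h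
  diag θ₀ θ θ' hθ := (ha.diag θ₀ θ θ' hθ).trans (mul_le_mul_of_nonneg_right h (by positivity))
  incr θ₁ θ₂ θ' h₁ h₂ h₃ :=
    (ha.incr θ₁ θ₂ θ' h₁ h₂ h₃).trans (mul_le_mul_of_nonneg_right h (by positivity))

theorem add (ha : IsKernel γ a M) (hb : IsKernel γ b N) :
    IsKernel γ (fun θ θ' => a θ θ' + b θ θ') (M + N) where
  measurable θ := (ha.measurable θ).add (hb.measurable θ)
  bound θ θ' hθ := (abs_add_le _ _).trans (add_le_add (ha.bound θ θ' hθ) (hb.bound θ θ' hθ))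
  diag θ₀ θ θ' hθ := by
    rw [add_sub_add_comm, add_mul]
    exact (abs_add_le _ _).trans (add_le_add (ha.diag θ₀ θ θ' hθ) (hb.diag θ₀ θ θ' hθ))
  incr θ₁ θ₂ θ' h₁ h₂ h₃ := by
    rw [add_sub_add_comm, add_mul]
    exact (abs_add_le _ _).trans
      (add_le_add (ha.incr θ₁ θ₂ θ' h₁ h₂ h₃) (hb.incr θ₁ θ₂ θ' h₁ h₂ h₃))

theorem neg (ha : IsKernel γ a M) : IsKernel γ (fun θ θ' => -a θ θ') M where
  measurable θ := (ha.measurable θ).neg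
  bound θ θ' hθ := by rw [abs_neg]; exact ha.bound θ θ' hθ
  diag θ₀ θ θ' hθ := by rw [← neg_sub', abs_neg]; exact ha.diag θ₀ θ θ' hθ
  incr θ₁ θ₂ θ' h₁ h₂ h₃ := by rw [← neg_sub', abs_neg]; exact ha.incr θ₁ θ₂ θ' h₁ h₂ h₃

theorem sub (ha : IsKernel γ a M) (hb : IsKernel γ b N) :
    IsKernel γ (fun θ θ' => a θ θ' - b θ θ') (M + N) := by
  simpa only [sub_eq_add_neg] using ha.add hb.neg

theorem const (c : ℝ) : IsKernel γ (fun _ _ => c) |c| where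
  measurable _ := measurable_const
  bound _ _ _ := le_rfl
  diag _ _ _ _ := by rw [sub_self, abs_zero]; positivity
  incr _ _ _ _ _ _ := by rw [sub_self, abs_zero]; positivity

/-- Common product estimate for `diag` and `incr`: `t` stands for either modulus. -/
theorem abs_mul_sub_mul_le {x y x' y' M N t : ℝ} (hx : |x| ≤ M) (hy' : |y'| ≤ N)
    (h₁ : |x - x'| ≤ M * t) (h₂ : |y - y'| ≤ N * t) : |x * y - x' * y'| ≤ 2 * (M * N) * t := by
  have hM : 0 ≤ M := (abs_nonneg _).trans hx
  have h3 : x * y - x' * y' = x * (y - y') + (x - x') * y' := by ring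
  rw [h3]
  refine (abs_add_le _ _).trans ?_
  rw [abs_mul, abs_mul]
  have h4 := mul_le_mul hx h₂ (abs_nonneg _) hM
  have h5 := mul_le_mul h₁ hy' (abs_nonneg _) ((abs_nonneg _).trans h₁)
  linarith

theorem mul (ha : IsKernel γ a M) (hb : IsKernel γ b N) :
    IsKernel γ (fun θ θ' => a θ θ' * b θ θ') (2 * (M * N)) where
  measurable θ := (ha.measurable θ).mul (hb.measurable θ)
  bound θ θ' hθ := by
    rw [abs_mul]
    have := mul_le_mul (ha.bound θ θ' hθ) (hb.bound θ θ' hθ) (abs_nonneg _) ha.nonneg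
    have := mul_nonneg ha.nonneg hb.nonneg
    linarith
  diag θ₀ θ θ' hθ := abs_mul_sub_mul_le (ha.bound θ θ' hθ)
    (hb.bound θ₀ θ₀ (by simp only [sub_self, abs_zero]; linarith [Real.pi_pos]))
    (ha.diag θ₀ θ θ' hθ) (hb.diag θ₀ θ θ' hθ)
  incr θ₁ θ₂ θ' h₁ h₂ h₃ := abs_mul_sub_mul_le (ha.bound θ₁ θ' h₁) (hb.bound θ₂ θ' h₂)
    (ha.incr θ₁ θ₂ θ' h₁ h₂ h₃) (hb.incr θ₁ θ₂ θ' h₁ h₂ h₃)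

theorem abs_inv_sub_inv_le {x y m t : ℝ} (hm : 0 < m) (hx : m ≤ x) (hy : m ≤ y)
    (h : |x - y| ≤ t) : |x⁻¹ - y⁻¹| ≤ t / m ^ 2 := by
  have hx0 : 0 < x := hm.trans_le hx
  have hy0 : 0 < y := hm.trans_le hy
  rw [inv_sub_inv hx0.ne' hy0.ne', abs_div, abs_of_pos (mul_pos hx0 hy0), abs_sub_comm]
  exact div_le_div₀ ((abs_nonneg _).trans h) h (by positivity) (by nlinarith)

/-- Inversion is Lipschitz on `[m, ∞)` with constant `1 / m ^ 2`; positivity is only available on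
the window `|θ - θ'| ≤ π + 1`. -/
theorem inv {m : ℝ} (ha : IsKernel γ a M) (hm : 0 < m)
    (h : ∀ θ θ', |θ - θ'| ≤ Real.pi + 1 → m ≤ a θ θ') :
    IsKernel γ (fun θ θ' => (a θ θ')⁻¹) (m⁻¹ + M / m ^ 2) where
  measurable θ := (ha.measurable θ).inv
  bound θ θ' hθ := by
    have h1 := h θ θ' hθ
    rw [abs_inv, abs_of_pos (hm.trans_le h1)]
    have h2 := inv_anti₀ hm h1
    have : 0 ≤ M / m ^ 2 := div_nonneg ha.nonneg (by positivity)
    linarith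
  diag θ₀ θ θ' hθ := by
    refine (abs_inv_sub_inv_le hm (h θ θ' hθ)
      (h θ₀ θ₀ (by simp only [sub_self, abs_zero]; linarith [Real.pi_pos]))
      (ha.diag θ₀ θ θ' hθ)).trans ?_
    rw [mul_div_right_comm]
    exact mul_le_mul_of_nonneg_right (by linarith [inv_pos.2 hm]) (by positivity)
  incr θ₁ θ₂ θ' h₁ h₂ h₃ := by
    refine (abs_inv_sub_inv_le hm (h θ₁ θ' h₁) (h θ₂ θ' h₂)
      (ha.incr θ₁ θ₂ θ' h₁ h₂ h₃)).trans ?_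
    rw [mul_div_right_comm]
    exact mul_le_mul_of_nonneg_right (by linarith [inv_pos.2 hm]) (by positivity)

end IsKernel

/-! ### Estimates for secants and their derivatives. -/

namespace IsHolderDeriv

variable {u u' : ℝ → ℝ} {N : ℝ}

theorem nonneg (hu : IsHolderDeriv γ u u' N) : 0 ≤ N := (abs_nonneg _).trans (hu.bound 0)

theorem continuous (hu : IsHolderDeriv γ u u' N) : Continuous u :=
  continuous_iff_continuousAt.2 fun θ => (hu.hasDerivAt θ).continuousAt

theorem continuous_deriv (hu : IsHolderDeriv γ u u' N) (hγ : 0 < γ) : Continuous u' := by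
  rw [continuous_iff_continuousAt]
  intro θ
  rw [ContinuousAt, tendsto_iff_norm_sub_tendsto_zero]
  have : Continuous fun s : ℝ => N * |s - θ| ^ γ :=
    continuous_const.mul (Continuous.rpow_const (by fun_prop) fun _ => Or.inr hγ.le)
  exact squeeze_zero (fun _ => norm_nonneg _) (fun s => hu.holder s θ)
    (by simpa [Real.zero_rpow hγ.ne'] using this.tendsto θ)

theorem abs_secant_le (hu : IsHolderDeriv γ u u' N) (θ θ' : ℝ) : |secant u u' θ θ'| ≤ N := by
  unfold secant
  split_ifs with h
  · exact hu.bound θ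
  · have := Convex.norm_image_sub_le_of_norm_hasDerivWithin_le (f := u) (f' := u')
      (s := univ) (C := N) (fun x _ => (hu.hasDerivAt x).hasDerivWithinAt)
      (fun x _ => hu.bound x) convex_univ (mem_univ θ') (mem_univ θ)
    rw [abs_div, div_le_iff₀ (abs_pos.2 (sub_ne_zero.2 (Ne.symm h)))]
    exact this

/-- Mean value inequality for `x ↦ u x - u' θ₀ * x` between `θ'` and `θ`, where the derivative is
controlled by the distance of the segment's points to `θ₀`. -/
theorem abs_secant_sub_le (hu : IsHolderDeriv γ u u' N) (hγ : 0 < γ) (θ₀ θ θ' : ℝ) :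
    |secant u u' θ θ' - u' θ₀| ≤ N * (|θ - θ₀| + |θ' - θ₀|) ^ γ := by
  unfold secant
  split_ifs with h
  · refine (hu.holder θ θ₀).trans (mul_le_mul_of_nonneg_left ?_ hu.nonneg)
    exact Real.rpow_le_rpow (abs_nonneg _) (by linarith [abs_nonneg (θ' - θ₀)]) hγ.le
  · have hne : θ - θ' ≠ 0 := sub_ne_zero.2 (Ne.symm h)
    have := Convex.norm_image_sub_le_of_norm_hasDerivWithin_le (f := fun x => u x - u' θ₀ * x)
      (f' := fun x => u' x - u' θ₀)
      (s := uIcc θ' θ) (C := N * (|θ - θ₀| + |θ' - θ₀|) ^ γ)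
      (fun x _ => by
        have := (hu.hasDerivAt x).sub ((hasDerivAt_id x).const_mul (u' θ₀))
        simp only [mul_one] at this
        exact this.hasDerivWithinAt)
      (fun x hx => by
        refine (hu.holder x θ₀).trans (mul_le_mul_of_nonneg_left ?_ hu.nonneg)
        refine Real.rpow_le_rpow (abs_nonneg _) ?_ hγ.le
        rcases le_total θ' θ with h1 | h1
        · rw [uIcc_of_le h1] at hx
          rcases abs_cases (x - θ₀) with ⟨h2, -⟩ | ⟨h2, -⟩ <;> rw [h2]
          · linarith [hx.2, le_abs_self (θ - θ₀), abs_nonneg (θ' - θ₀)]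
          · linarith [hx.1, neg_abs_le (θ' - θ₀), abs_nonneg (θ - θ₀)]
        · rw [uIcc_of_ge h1] at hx
          rcases abs_cases (x - θ₀) with ⟨h2, -⟩ | ⟨h2, -⟩ <;> rw [h2]
          · linarith [hx.2, le_abs_self (θ' - θ₀), abs_nonneg (θ - θ₀)]
          · linarith [hx.1, neg_abs_le (θ - θ₀), abs_nonneg (θ' - θ₀)])
      (convex_uIcc _ _) left_mem_uIcc right_mem_uIcc
    have h3 : (u θ - u θ') / (θ - θ') - u' θ₀
        = ((u θ - u' θ₀ * θ) - (u θ' - u' θ₀ * θ')) / (θ - θ') := by field_simp; ring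
    rw [h3, abs_div, div_le_iff₀ (abs_pos.2 hne)]
    exact this

theorem measurable_secant (hu : IsHolderDeriv γ u u' N) (θ : ℝ) : Measurable (secant u u' θ) := by
  have h1 := hu.continuous.measurable
  exact Measurable.ite (measurableSet_eq_fun measurable_id measurable_const) measurable_const
    (by fun_prop)

/-- The increment equals `(θ₁ - θ₂) / (θ₁ - θ')` times the difference of the secants over `(θ₁, θ₂)`
and `(θ₂, θ')`. Both are compared with `u' θ₂`; their errors contribute `1` and `2` to the constant
`3`. -/
theorem abs_secant_incr_le (hu : IsHolderDeriv γ u u' N) (hγ : 0 < γ) (hγ₁ : γ < 1)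
    {θ₁ θ₂ θ' : ℝ} (h : 2 * |θ₁ - θ₂| ≤ |θ₁ - θ'|) :
    |secant u u' θ₁ θ' - secant u u' θ₂ θ'| ≤ 3 * N * (|θ₁ - θ₂| * |θ₁ - θ'| ^ (γ - 1)) := by
  rcases eq_or_ne θ₁ θ₂ with rfl | h12
  · simp
  have hh : 0 < |θ₁ - θ₂| := abs_pos.2 (sub_ne_zero.2 h12)
  have hy : 0 < |θ₁ - θ'| := by linarith
  have hy2 : |θ₂ - θ'| ≤ 2 * |θ₁ - θ'| := by
    have := abs_sub_le θ₂ θ₁ θ'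
    rw [abs_sub_comm θ₂ θ₁] at this
    linarith
  have hy2' : 0 < |θ₂ - θ'| := by
    have := abs_sub_le θ₁ θ₂ θ'
    linarith
  have hne1 : θ₁ - θ' ≠ 0 := abs_pos.1 hy
  have hne2 : θ₂ - θ' ≠ 0 := abs_pos.1 hy2'
  have hne3 : θ₁ - θ₂ ≠ 0 := abs_pos.1 hh
  have e : secant u u' θ₁ θ' - secant u u' θ₂ θ'
      = (θ₁ - θ₂) * (secant u u' θ₁ θ₂ - secant u u' θ₂ θ') / (θ₁ - θ') := by
    rw [secant, secant, secant, if_neg (by simpa [sub_eq_zero, eq_comm] using hne1),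
      if_neg (by simpa [sub_eq_zero, eq_comm] using hne2), if_neg h12.symm]
    field_simp
    ring
  have b1 := hu.abs_secant_sub_le hγ θ₂ θ₁ θ₂
  have b2 := hu.abs_secant_sub_le hγ θ₂ θ₂ θ'
  rw [sub_self, abs_zero, add_zero] at b1
  rw [sub_self, abs_zero, zero_add, abs_sub_comm θ' θ₂] at b2
  have c1 : |θ₁ - θ₂| ^ γ ≤ |θ₁ - θ'| ^ γ :=
    Real.rpow_le_rpow hh.le (by linarith) hγ.le
  have c2 : |θ₂ - θ'| ^ γ ≤ 2 * |θ₁ - θ'| ^ γ := by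
    refine (Real.rpow_le_rpow hy2'.le hy2 hγ.le).trans ?_
    rw [Real.mul_rpow (by norm_num) hy.le]
    refine mul_le_mul_of_nonneg_right ?_ (by positivity)
    calc (2 : ℝ) ^ γ ≤ 2 ^ (1 : ℝ) := Real.rpow_le_rpow_of_exponent_le (by norm_num) hγ₁.le
      _ = 2 := by norm_num
  have b3 : |secant u u' θ₁ θ₂ - secant u u' θ₂ θ'| ≤ 3 * N * |θ₁ - θ'| ^ γ := by
    have := abs_sub_le (secant u u' θ₁ θ₂) (u' θ₂) (secant u u' θ₂ θ')
    rw [abs_sub_comm (u' θ₂)] at this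
    have := mul_le_mul_of_nonneg_left c1 hu.nonneg
    have := mul_le_mul_of_nonneg_left c2 hu.nonneg
    linarith
  rw [e, abs_div, abs_mul, div_le_iff₀ hy]
  have e2 : |θ₁ - θ'| ^ (γ - 1) * |θ₁ - θ'| = |θ₁ - θ'| ^ γ := by
    rw [← Real.rpow_add_one hy.ne', sub_add_cancel]
  calc _ ≤ |θ₁ - θ₂| * (3 * N * |θ₁ - θ'| ^ γ) := mul_le_mul_of_nonneg_left b3 hh.le
    _ = _ := by rw [← e2]; ring

theorem isKernel_secant (hu : IsHolderDeriv γ u u' N) (hγ : 0 < γ) (hγ₁ : γ < 1) :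
    IsKernel γ (secant u u') (3 * N) where
  measurable := hu.measurable_secant
  bound θ θ' _ := (hu.abs_secant_le θ θ').trans (by linarith [hu.nonneg])
  diag θ₀ θ θ' _ := by
    have e : secant u u' θ₀ θ₀ = u' θ₀ := if_pos rfl
    rw [e]
    exact (hu.abs_secant_sub_le hγ θ₀ θ θ').trans
      (mul_le_mul_of_nonneg_right (by linarith [hu.nonneg]) (by positivity))
  incr θ₁ θ₂ θ' _ _ h := hu.abs_secant_incr_le hγ hγ₁ h

theorem isKernel_deriv (hu : IsHolderDeriv γ u u' N) (hγ : 0 < γ) :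
    IsKernel γ (fun _ θ' => u' θ') N where
  measurable _ := (hu.continuous_deriv hγ).measurable
  bound θ θ' _ := hu.bound θ'
  diag θ₀ θ θ' _ := (hu.holder θ' θ₀).trans (mul_le_mul_of_nonneg_left
    (Real.rpow_le_rpow (abs_nonneg _) (by linarith [abs_nonneg (θ - θ₀)]) hγ.le) hu.nonneg)
  incr _ _ _ _ _ _ := by
    rw [sub_self, abs_zero]
    exact mul_nonneg hu.nonneg (by positivity)

theorem abs_secantDeriv_le (hu : IsHolderDeriv γ u u' N) (hγ : 0 < γ) {θ θ' : ℝ} (h : θ ≠ θ') :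
    |secantDeriv u u' θ θ'| ≤ N * |θ - θ'| ^ (γ - 1) := by
  have hy : 0 < |θ - θ'| := abs_pos.2 (sub_ne_zero.2 h)
  have b := hu.abs_secant_sub_le hγ θ' θ θ'
  rw [sub_self, abs_zero, add_zero] at b
  rw [secantDeriv, abs_div, div_le_iff₀ hy, mul_assoc, ← Real.rpow_add_one hy.ne', sub_add_cancel]
  exact b

/-- The increment is split between the numerator (constant `3`) and the denominator (constant `2`,
using that `|θ₂ - θ'|` is at least half of `|θ₁ - θ'|`). -/
theorem abs_secantDeriv_incr_le (hu : IsHolderDeriv γ u u' N) (hγ : 0 < γ) (hγ₁ : γ < 1)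
    {θ₁ θ₂ θ' : ℝ} (h1 : θ₁ ≠ θ') (h : 2 * |θ₁ - θ₂| ≤ |θ₁ - θ'|) :
    |secantDeriv u u' θ₁ θ' - secantDeriv u u' θ₂ θ'|
      ≤ 5 * N * (|θ₁ - θ₂| * |θ₁ - θ'| ^ (γ - 2)) := by
  have hy : 0 < |θ₁ - θ'| := abs_pos.2 (sub_ne_zero.2 h1)
  have hy2 : |θ₁ - θ'| / 2 ≤ |θ₂ - θ'| := by
    have := abs_sub_le θ₁ θ₂ θ'
    linarith
  have hy2' : 0 < |θ₂ - θ'| := by linarith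
  have hne1 : θ₁ - θ' ≠ 0 := abs_pos.1 hy
  have hne2 : θ₂ - θ' ≠ 0 := abs_pos.1 hy2'
  have e : secantDeriv u u' θ₁ θ' - secantDeriv u u' θ₂ θ'
      = (secant u u' θ₁ θ' - secant u u' θ₂ θ') / (θ₁ - θ')
        - secantDeriv u u' θ₂ θ' * (θ₁ - θ₂) / (θ₁ - θ') := by
    rw [secantDeriv, secantDeriv]
    field_simp
    ring
  have b1 := hu.abs_secant_incr_le hγ hγ₁ h
  have b2 := hu.abs_secantDeriv_le hγ (sub_ne_zero.1 hne2)
  have c2 : |θ₂ - θ'| ^ (γ - 1) ≤ 2 * |θ₁ - θ'| ^ (γ - 1) := by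
    refine (Real.rpow_le_rpow_of_nonpos (by linarith) hy2 (by linarith)).trans ?_
    rw [div_eq_mul_inv, mul_comm, Real.mul_rpow (by norm_num) hy.le]
    refine mul_le_mul_of_nonneg_right ?_ (by positivity)
    rw [Real.inv_rpow (by norm_num), ← Real.rpow_neg (by norm_num)]
    calc (2 : ℝ) ^ (-(γ - 1)) ≤ 2 ^ (1 : ℝ) :=
          Real.rpow_le_rpow_of_exponent_le (by norm_num) (by linarith)
      _ = 2 := by norm_num
  have e2 : |θ₁ - θ'| ^ (γ - 2) = |θ₁ - θ'| ^ (γ - 1) / |θ₁ - θ'| := by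
    rw [← Real.rpow_sub_one hy.ne']; congr 1; ring
  rw [e, e2]
  refine (abs_sub _ _).trans ?_
  rw [abs_div, abs_div, abs_mul, ← add_div, ← mul_div_assoc, ← mul_div_assoc]
  refine div_le_div_of_nonneg_right ?_ hy.le
  have := mul_le_mul_of_nonneg_left c2 hu.nonneg
  have := mul_le_mul_of_nonneg_right (b2.trans this) (abs_nonneg (θ₁ - θ₂))
  linarith

theorem hasDerivAt_secant (hu : IsHolderDeriv γ u u' N) {θ θ' : ℝ} (h : θ ≠ θ') :
    HasDerivAt (secant u u' θ) (secantDeriv u u' θ θ') θ' := by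
  have hne : θ - θ' ≠ 0 := sub_ne_zero.2 h
  have h1 : HasDerivAt (fun s => (u θ - u s) / (θ - s)) (secantDeriv u u' θ θ') θ' := by
    have := ((hu.hasDerivAt θ').const_sub (u θ)).div ((hasDerivAt_id θ').const_sub θ) hne
    refine this.congr_deriv ?_
    simp only [secantDeriv, secant, if_neg h.symm, id]
    field_simp
    ring
  refine h1.congr_of_eventuallyEq ?_
  filter_upwards [isOpen_ne.mem_nhds h.symm] with s hs
  exact if_neg hs

theorem continuous_secant (hu : IsHolderDeriv γ u u' N) (hγ : 0 < γ) (θ : ℝ) :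
    Continuous (secant u u' θ) := by
  rw [continuous_iff_continuousAt]
  intro θ'
  rcases eq_or_ne θ θ' with rfl | h
  · rw [ContinuousAt, tendsto_iff_norm_sub_tendsto_zero]
    have e : secant u u' θ θ = u' θ := if_pos rfl
    have : Continuous fun s : ℝ => N * (|θ - θ| + |s - θ|) ^ γ :=
      continuous_const.mul (Continuous.rpow_const (by fun_prop) fun _ => Or.inr hγ.le)
    rw [e]
    exact squeeze_zero (fun _ => norm_nonneg _) (fun s => hu.abs_secant_sub_le hγ θ θ s)
      (by simpa [Real.zero_rpow hγ.ne'] using this.tendsto θ)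
  · exact (hu.hasDerivAt_secant h).continuousAt

theorem measurable_secantDeriv (hu : IsHolderDeriv γ u u' N) (hγ : 0 < γ) (θ : ℝ) :
    Measurable (secantDeriv u u' θ) := by
  have h1 := hu.measurable_secant θ
  have h2 := (hu.continuous_deriv hγ).measurable
  unfold secantDeriv
  fun_prop

end IsHolderDeriv

theorem ae_ne_restrict (θ a b : ℝ) : ∀ᵐ θ' ∂(volume.restrict (uIoc a b)), θ' ≠ θ :=
  ae_restrict_of_ae (by simp [ae_iff, measure_singleton])

/-- Integrability against the derivative of a secant. -/
theorem intervalIntegrable_kernel_mul {a : ℝ → ℝ → ℝ} {u u' : ℝ → ℝ} {M N : ℝ} (hγ : 0 < γ)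
    (ha : IsKernel γ a M) (hu : IsHolderDeriv γ u u' N) {θ θ₀ : ℝ} (h : |θ - θ₀| ≤ 1) :
    IntervalIntegrable (fun θ' => a θ θ' * secantDeriv u u' θ θ') volume
      (θ₀ - Real.pi) (θ₀ + Real.pi) := by
  refine ((intervalIntegrable_abs_sub_rpow (s := γ - 1) (by linarith) θ _ _).const_mul
    (M * N)).mono_fun ?_ ?_
  · exact ((ha.measurable θ).mul (hu.measurable_secantDeriv hγ θ)).aestronglyMeasurable
  · filter_upwards [ae_ne_restrict θ _ _, ae_restrict_mem measurableSet_uIoc] with θ' hne hmem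
    rw [uIoc_of_le (by linarith [Real.pi_pos])] at hmem
    have h' := abs_le.1 h
    rw [norm_mul, Real.norm_eq_abs, Real.norm_eq_abs, Real.norm_of_nonneg
      (mul_nonneg (mul_nonneg ha.nonneg hu.nonneg) (by positivity)), mul_assoc]
    exact mul_le_mul (ha.bound θ θ' (abs_le.2 ⟨by linarith [hmem.2], by linarith [hmem.1]⟩))
      (hu.abs_secantDeriv_le hγ hne.symm) (abs_nonneg _) ha.nonneg

end Kernels

/-! ### Hölder regularity of integrals of kernels against secant derivatives. -/

section KernelHolder

variable {γ α : ℝ}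

theorem mul_rpow_le_mul_rpow {c x p : ℝ} (hc : 1 ≤ c) (hx : 0 ≤ x) (hp1 : p ≤ 1) :
    (c * x) ^ p ≤ c * x ^ p := by
  rw [Real.mul_rpow (by linarith) hx]
  refine mul_le_mul_of_nonneg_right ?_ (by positivity)
  calc c ^ p ≤ c ^ (1 : ℝ) := Real.rpow_le_rpow_of_exponent_le hc hp1
    _ = c := Real.rpow_one c

/-- Pointwise estimate of the increment in `θ` of a kernel minus its diagonal value, times a secant
derivative. -/
theorem abs_kernel_mul_incr_le {a : ℝ → ℝ → ℝ} {u u' : ℝ → ℝ} {M N : ℝ} (hγ : 0 < γ)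
    (hγα : γ < α) (hα : α < 1) (ha : IsKernel γ a M)
    (hu : IsHolderDeriv γ u u' N) {θ₁ θ₂ θ' : ℝ} (h1 : |θ₁ - θ'| ≤ Real.pi + 1)
    (h2 : |θ₂ - θ'| ≤ Real.pi + 1) (hne1 : θ₁ ≠ θ') (hne2 : θ₂ ≠ θ') (h12 : θ₁ ≠ θ₂) :
    |(a θ₁ θ' - a θ₁ θ₁) * secantDeriv u u' θ₁ θ' - (a θ₂ θ' - a θ₁ θ₁) * secantDeriv u u' θ₂ θ'|
      ≤ 11 * (M * N) * |θ₁ - θ₂| ^ α *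
        (|θ₁ - θ'| ^ (2 * γ - α - 1) + |θ₂ - θ'| ^ (2 * γ - α - 1)) := by
  have hM := ha.nonneg
  have hN := hu.nonneg
  have hγ₁ : γ < 1 := hγα.trans hα
  have hh : 0 < |θ₁ - θ₂| := abs_pos.2 (sub_ne_zero.2 h12)
  have hy1 : 0 < |θ₁ - θ'| := abs_pos.2 (sub_ne_zero.2 hne1)
  have hy2 : 0 < |θ₂ - θ'| := abs_pos.2 (sub_ne_zero.2 hne2)
  have t2 : |θ₂ - θ'| ≤ |θ₁ - θ₂| + |θ₁ - θ'| := by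
    have := abs_sub_le θ₂ θ₁ θ'
    rwa [abs_sub_comm θ₂ θ₁] at this
  have a1 := ha.diag θ₁ θ₁ θ' h1
  have a2 := ha.diag θ₁ θ₂ θ' h2
  rw [sub_self, abs_zero, zero_add, abs_sub_comm θ' θ₁] at a1
  rw [abs_sub_comm θ₂ θ₁, abs_sub_comm θ' θ₁] at a2
  have b1 := hu.abs_secantDeriv_le hγ hne1
  have b2 := hu.abs_secantDeriv_le hγ hne2
  set h := |θ₁ - θ₂|
  set y₁ := |θ₁ - θ'|
  set y₂ := |θ₂ - θ'|
  set B₁ := secantDeriv u u' θ₁ θ'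
  set B₂ := secantDeriv u u' θ₂ θ'
  have hMN : 0 ≤ M * N := mul_nonneg hM hN
  -- Away from the diagonal the increments of both factors are used. Within distance `2h` of it the
  -- two terms are estimated separately, each being small because the coefficient was frozen at the
  -- diagonal.
  rcases le_or_gt (2 * h) y₁ with hfar | hnear
  · have ai := ha.incr θ₁ θ₂ θ' h1 h2 hfar
    have bi := hu.abs_secantDeriv_incr_le hγ hγ₁ hne1 hfar
    have a2' : |a θ₂ θ' - a θ₁ θ₁| ≤ M * (2 * y₁ ^ γ) := by
      refine a2.trans (mul_le_mul_of_nonneg_left ?_ hM)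
      exact (Real.rpow_le_rpow (by positivity) (by linarith) hγ.le).trans
        (mul_rpow_le_mul_rpow (by norm_num) hy1.le hγ₁.le)
    have e : (a θ₁ θ' - a θ₁ θ₁) * B₁ - (a θ₂ θ' - a θ₁ θ₁) * B₂
        = (a θ₁ θ' - a θ₂ θ') * B₁ + (a θ₂ θ' - a θ₁ θ₁) * (B₁ - B₂) := by ring
    rw [e]
    have p1 := mul_le_mul ai b1 (abs_nonneg _) ((abs_nonneg _).trans ai)
    have p2 := mul_le_mul a2' bi (abs_nonneg _) ((abs_nonneg _).trans a2')
    have e1 : y₁ ^ (γ - 1) * y₁ ^ (γ - 1) = y₁ ^ (2 * γ - 2) := by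
      rw [← Real.rpow_add hy1]; congr 1; ring
    have e2 : y₁ ^ γ * y₁ ^ (γ - 2) = y₁ ^ (2 * γ - 2) := by
      rw [← Real.rpow_add hy1]; congr 1; ring
    -- Part of the power of `h` is traded for a power of `y₁ ≥ 2h`, which makes the singularity in
    -- `θ'` integrable.
    have e3 : h * y₁ ^ (2 * γ - 2) ≤ h ^ α * y₁ ^ (2 * γ - α - 1) := by
      have : h = h ^ α * h ^ (1 - α) := by
        rw [← Real.rpow_add hh]; simp
      have e4 : y₁ ^ (2 * γ - α - 1) = y₁ ^ (1 - α) * y₁ ^ (2 * γ - 2) := by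
        rw [← Real.rpow_add hy1]; congr 1; ring
      have e5 : h ^ (1 - α) ≤ y₁ ^ (1 - α) :=
        Real.rpow_le_rpow hh.le (by linarith) (by linarith)
      rw [e4, ← mul_assoc]
      nth_rewrite 1 [this]
      gcongr
    have q := mul_nonneg (mul_nonneg hMN (Real.rpow_nonneg hh.le α))
      (Real.rpow_nonneg hy2.le (2 * γ - α - 1))
    calc _ ≤ |(a θ₁ θ' - a θ₂ θ') * B₁| + |(a θ₂ θ' - a θ₁ θ₁) * (B₁ - B₂)| := abs_add_le _ _
      _ ≤ M * (h * y₁ ^ (γ - 1)) * (N * y₁ ^ (γ - 1))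
          + M * (2 * y₁ ^ γ) * (5 * N * (h * y₁ ^ (γ - 2))) := by
        rw [abs_mul, abs_mul]; exact add_le_add p1 p2
      _ = (M * N) * (h * (y₁ ^ (γ - 1) * y₁ ^ (γ - 1)))
          + 10 * (M * N) * (h * (y₁ ^ γ * y₁ ^ (γ - 2))) := by ring
      _ = 11 * (M * N) * (h * y₁ ^ (2 * γ - 2)) := by rw [e1, e2]; ring
      _ ≤ 11 * (M * N) * (h ^ α * y₁ ^ (2 * γ - α - 1)) :=
        mul_le_mul_of_nonneg_left e3 (by positivity)
      _ ≤ _ := by linarith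
  · have p1 := mul_le_mul a1 b1 (abs_nonneg _) ((abs_nonneg _).trans a1)
    have p2 := mul_le_mul a2 b2 (abs_nonneg _) ((abs_nonneg _).trans a2)
    have e1 : y₁ ^ γ * y₁ ^ (γ - 1) ≤ 2 * h ^ α * y₁ ^ (2 * γ - α - 1) := by
      have : y₁ ^ γ * y₁ ^ (γ - 1) = y₁ ^ α * y₁ ^ (2 * γ - α - 1) := by
        rw [← Real.rpow_add hy1, ← Real.rpow_add hy1]; congr 1; ring
      rw [this]
      refine mul_le_mul_of_nonneg_right ?_ (by positivity)
      exact (Real.rpow_le_rpow hy1.le hnear.le (by linarith)).trans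
        (mul_rpow_le_mul_rpow (by norm_num) hh.le hα.le)
    have e2 : (h + y₁) ^ γ * y₂ ^ (γ - 1) ≤ 3 * h ^ α * y₂ ^ (2 * γ - α - 1) := by
      have c1 : (h + y₁) ^ γ ≤ (3 * h) ^ γ :=
        Real.rpow_le_rpow (by positivity) (by linarith) hγ.le
      have c2 : (3 * h) ^ γ = (3 * h) ^ α * (3 * h) ^ (γ - α) := by
        rw [← Real.rpow_add (by positivity)]; congr 1; ring
      -- The exponent `γ - α` is negative, so `y₂ ≤ 3h` bounds this factor by a power of `y₂`.
      have c3 : (3 * h) ^ (γ - α) ≤ y₂ ^ (γ - α) :=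
        Real.rpow_le_rpow_of_nonpos hy2 (by linarith) (by linarith)
      have c4 : (3 * h) ^ α ≤ 3 * h ^ α := mul_rpow_le_mul_rpow (by norm_num) hh.le hα.le
      have c5 : y₂ ^ (2 * γ - α - 1) = y₂ ^ (γ - α) * y₂ ^ (γ - 1) := by
        rw [← Real.rpow_add hy2]; congr 1; ring
      rw [c5, ← mul_assoc]
      refine mul_le_mul_of_nonneg_right (c1.trans ?_) (by positivity)
      rw [c2]
      exact mul_le_mul c4 c3 (by positivity) (by positivity)
    have q1 := mul_nonneg (mul_nonneg hMN (Real.rpow_nonneg hh.le α))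
      (Real.rpow_nonneg hy2.le (2 * γ - α - 1))
    have q2 := mul_nonneg (mul_nonneg hMN (Real.rpow_nonneg hh.le α))
      (Real.rpow_nonneg hy1.le (2 * γ - α - 1))
    calc _ ≤ |(a θ₁ θ' - a θ₁ θ₁) * B₁| + |(a θ₂ θ' - a θ₁ θ₁) * B₂| := abs_sub _ _
      _ ≤ M * y₁ ^ γ * (N * y₁ ^ (γ - 1)) + M * (h + y₁) ^ γ * (N * y₂ ^ (γ - 1)) := by
        rw [abs_mul, abs_mul]; exact add_le_add p1 p2
      _ = (M * N) * (y₁ ^ γ * y₁ ^ (γ - 1)) + (M * N) * ((h + y₁) ^ γ * y₂ ^ (γ - 1)) := by ring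
      _ ≤ (M * N) * (2 * h ^ α * y₁ ^ (2 * γ - α - 1))
          + (M * N) * (3 * h ^ α * y₂ ^ (2 * γ - α - 1)) := by gcongr
      _ ≤ _ := by linarith

/-- The secant derivative integrates to a difference of secants. -/
theorem integral_secantDeriv {u u' : ℝ → ℝ} {N : ℝ} (hγ : 0 < γ) (hu : IsHolderDeriv γ u u' N)
    {θ θ₀ : ℝ} (h : |θ - θ₀| ≤ 1) :
    ∫ θ' in (θ₀ - Real.pi)..(θ₀ + Real.pi), secantDeriv u u' θ θ'
      = secant u u' θ (θ₀ + Real.pi) - secant u u' θ (θ₀ - Real.pi) := by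
  have hi := intervalIntegrable_kernel_mul hγ (IsKernel.const (γ := γ) 1) hu h
  simp only [one_mul] at hi
  refine integral_eq_of_hasDerivAt_off_countable _ _ (countable_singleton θ)
    (hu.continuous_secant hγ θ).continuousOn (fun x hx => ?_) hi
  exact hu.hasDerivAt_secant (fun h => hx.2 h.symm)

/-- Exact integration leaves only secants at the end points `θ₁ ± π`, far from the singularity, so
the increment is linear in `|θ₁ - θ₂|`. Integrating the pointwise bounds would only yield the
exponent `γ`. -/
theorem abs_integral_secantDeriv_incr_le {u u' : ℝ → ℝ} {N : ℝ} (hγ : 0 < γ) (hγ₁ : γ < 1)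
    (hu : IsHolderDeriv γ u u' N) {θ₁ θ₂ : ℝ} (h : |θ₁ - θ₂| ≤ 1) :
    |(∫ θ' in (θ₁ - Real.pi)..(θ₁ + Real.pi), secantDeriv u u' θ₁ θ')
      - ∫ θ' in (θ₁ - Real.pi)..(θ₁ + Real.pi), secantDeriv u u' θ₂ θ'| ≤ 6 * N * |θ₁ - θ₂| := by
  have hπ := Real.pi_gt_three
  have hN := hu.nonneg
  rw [integral_secantDeriv hγ hu (θ := θ₁) (by simp), integral_secantDeriv hγ hu (θ := θ₂)
    (by rwa [abs_sub_comm])]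
  have hp : Real.pi ^ (γ - 1) ≤ 1 :=
    Real.rpow_le_one_of_one_le_of_nonpos (by linarith) (by linarith)
  have key : ∀ θ', |θ₁ - θ'| = Real.pi →
      |secant u u' θ₁ θ' - secant u u' θ₂ θ'| ≤ 3 * N * |θ₁ - θ₂| := fun θ' hθ' => by
    refine (hu.abs_secant_incr_le hγ hγ₁ (by rw [hθ']; linarith)).trans ?_
    rw [hθ']
    exact mul_le_mul_of_nonneg_left (mul_le_of_le_one_right (abs_nonneg _) hp) (by positivity)
  have k1 := key (θ₁ + Real.pi) (by rw [sub_add_cancel_left, abs_neg, abs_of_pos Real.pi_pos])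
  have k2 := key (θ₁ - Real.pi) (by rw [sub_sub_cancel, abs_of_pos Real.pi_pos])
  have e : ∀ a b c d : ℝ, (a - b) - (c - d) = (a - c) - (b - d) := fun a b c d => by ring
  rw [e]
  refine (abs_sub _ _).trans ?_
  linarith

/-- Integral operators with a kernel of class `IsKernel` against secant derivatives gain Hölder
regularity up to the exponent `2γ`. -/
theorem exists_kernel_integral_bound (hγ : 0 < γ) (hγα : γ < α) (hα : α < 1) (hα2 : α < 2 * γ) :
    ∃ C : ℝ, 0 ≤ C ∧ ∀ (a : ℝ → ℝ → ℝ) (u u' : ℝ → ℝ) (M N : ℝ), IsKernel γ a M →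
      IsHolderDeriv γ u u' N →
      (∀ θ, |∫ θ' in (θ - Real.pi)..(θ + Real.pi), a θ θ' * secantDeriv u u' θ θ'|
        ≤ C * (M * N)) ∧
      ∀ θ₁ θ₂, |θ₁ - θ₂| ≤ 1 →
        |(∫ θ' in (θ₁ - Real.pi)..(θ₁ + Real.pi), a θ₁ θ' * secantDeriv u u' θ₁ θ')
          - ∫ θ' in (θ₁ - Real.pi)..(θ₁ + Real.pi), a θ₂ θ' * secantDeriv u u' θ₂ θ'|
          ≤ C * (M * N) * |θ₁ - θ₂| ^ α := by
  have hγ₁ := hγα.trans hα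
  have hπ := Real.pi_pos
  obtain ⟨J, hJ, hJb⟩ := exists_integral_abs_rpow_le (s := γ - 1) (by linarith)
  obtain ⟨K, hK, hKb⟩ := exists_integral_abs_rpow_le (s := 2 * γ - α - 1) (by linarith)
  -- `J` bounds the integral itself, `22 * K = 11 * (K + K)` comes from the two singular weights in
  -- the increment, and `6` from the frozen coefficient. The exponent of the weights exceeds `-1`
  -- precisely because `α < 2γ`.
  refine ⟨J + 22 * K + 6, by positivity, fun a u u' M N ha hu => ?_⟩
  have hM := ha.nonneg
  have hN := hu.nonneg
  have hMN : 0 ≤ M * N := mul_nonneg hM hN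
  refine ⟨fun θ => ?_, fun θ₁ θ₂ h => ?_⟩
  · rw [← Real.norm_eq_abs]
    refine (intervalIntegral.norm_integral_le_of_norm_le (by linarith) (g := fun θ' =>
      (M * N) * |θ - θ'| ^ (γ - 1)) ?_
      ((intervalIntegrable_abs_sub_rpow (by linarith) θ _ _).const_mul _)).trans ?_
    · have h0 : ∀ᵐ θ' : ℝ, θ' ≠ θ := by simp [ae_iff, measure_singleton]
      filter_upwards [h0] with θ' hne hmem
      rw [norm_mul, Real.norm_eq_abs, Real.norm_eq_abs, mul_assoc]
      exact mul_le_mul (ha.bound θ θ' (abs_le.2 ⟨by linarith [hmem.2], by linarith [hmem.1]⟩))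
        (hu.abs_secantDeriv_le hγ hne.symm) (abs_nonneg _) hM
    · rw [intervalIntegral.integral_const_mul]
      have := mul_le_mul_of_nonneg_left (hJb θ θ (by simp)) hMN
      have : 0 ≤ (22 * K + 6) * (M * N) := by positivity
      linarith
  · rcases eq_or_ne θ₁ θ₂ with rfl | h12
    · rw [sub_self, abs_zero]; positivity
    have h' := abs_le.1 h
    have h21 : |θ₂ - θ₁| ≤ 1 := by rwa [abs_sub_comm]
    have hh : 0 < |θ₁ - θ₂| := abs_pos.2 (sub_ne_zero.2 h12)
    have i1 := intervalIntegrable_kernel_mul hγ ha hu (θ := θ₁) (θ₀ := θ₁) (by simp)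
    have i2 := intervalIntegrable_kernel_mul hγ ha hu h21
    have j1 := intervalIntegrable_kernel_mul hγ (IsKernel.const (γ := γ) (a θ₁ θ₁)) hu
      (θ := θ₁) (θ₀ := θ₁) (by simp)
    have j2 := intervalIntegrable_kernel_mul hγ (IsKernel.const (γ := γ) (a θ₁ θ₁)) hu h21
    -- Freeze the coefficient at `a θ₁ θ₁` in both integrals: the difference gains a power at the
    -- diagonal, and the frozen part is an integral of secant derivatives alone.
    have e : (∫ θ' in (θ₁ - Real.pi)..(θ₁ + Real.pi), a θ₁ θ' * secantDeriv u u' θ₁ θ')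
          - (∫ θ' in (θ₁ - Real.pi)..(θ₁ + Real.pi), a θ₂ θ' * secantDeriv u u' θ₂ θ')
        = (∫ θ' in (θ₁ - Real.pi)..(θ₁ + Real.pi),
            ((a θ₁ θ' - a θ₁ θ₁) * secantDeriv u u' θ₁ θ'
              - (a θ₂ θ' - a θ₁ θ₁) * secantDeriv u u' θ₂ θ'))
          + a θ₁ θ₁ * ((∫ θ' in (θ₁ - Real.pi)..(θ₁ + Real.pi), secantDeriv u u' θ₁ θ')
            - ∫ θ' in (θ₁ - Real.pi)..(θ₁ + Real.pi), secantDeriv u u' θ₂ θ') := by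
      rw [mul_sub, ← intervalIntegral.integral_const_mul, ← intervalIntegral.integral_const_mul,
        ← intervalIntegral.integral_sub j1 j2, ← intervalIntegral.integral_add _ (j1.sub j2),
        ← intervalIntegral.integral_sub i1 i2]
      · refine intervalIntegral.integral_congr fun θ' _ => ?_
        ring
      · refine ((i1.sub j1).sub (i2.sub j2)).congr fun θ' _ => ?_
        ring
    rw [e]
    have b1 : ‖∫ θ' in (θ₁ - Real.pi)..(θ₁ + Real.pi),
            ((a θ₁ θ' - a θ₁ θ₁) * secantDeriv u u' θ₁ θ'
              - (a θ₂ θ' - a θ₁ θ₁) * secantDeriv u u' θ₂ θ')‖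
        ≤ 11 * (M * N) * |θ₁ - θ₂| ^ α * (K + K) := by
      refine (intervalIntegral.norm_integral_le_of_norm_le (by linarith) (g := fun θ' =>
        11 * (M * N) * |θ₁ - θ₂| ^ α *
        (|θ₁ - θ'| ^ (2 * γ - α - 1) + |θ₂ - θ'| ^ (2 * γ - α - 1))) ?_
        (((intervalIntegrable_abs_sub_rpow (by linarith) θ₁ _ _).add
          (intervalIntegrable_abs_sub_rpow (by linarith) θ₂ _ _)).const_mul _)).trans ?_
      · have h0 : ∀ θ : ℝ, ∀ᵐ θ' : ℝ, θ' ≠ θ := fun θ => by simp [ae_iff, measure_singleton]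
        filter_upwards [h0 θ₁, h0 θ₂] with θ' hne1 hne2 hmem
        exact abs_kernel_mul_incr_le hγ hγα hα ha hu
          (abs_le.2 ⟨by linarith [hmem.2], by linarith [hmem.1]⟩)
          (abs_le.2 ⟨by linarith [hmem.2], by linarith [hmem.1]⟩) hne1.symm hne2.symm h12
      · rw [intervalIntegral.integral_const_mul, intervalIntegral.integral_add
          (intervalIntegrable_abs_sub_rpow (by linarith) θ₁ _ _)
          (intervalIntegrable_abs_sub_rpow (by linarith) θ₂ _ _)]
        exact mul_le_mul_of_nonneg_left (add_le_add (hKb θ₁ θ₁ (by simp)) (hKb θ₂ θ₁ h21))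
          (by positivity)
    have b2 := abs_integral_secantDeriv_incr_le hγ hγ₁ hu h
    have b3 := mul_le_mul (ha.bound θ₁ θ₁ (by simp only [sub_self, abs_zero]; positivity)) b2
      (abs_nonneg _) hM
    have b4 : |θ₁ - θ₂| ≤ |θ₁ - θ₂| ^ α := by
      have := Real.rpow_le_rpow_of_exponent_ge hh h hα.le
      rwa [Real.rpow_one] at this
    have b5 := mul_le_mul_of_nonneg_left b4 (show (0 : ℝ) ≤ 6 * (M * N) by positivity)
    refine (abs_add_le _ _).trans ?_
    rw [abs_mul (a θ₁ θ₁)]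
    rw [Real.norm_eq_abs] at b1
    have : 0 ≤ J * (M * N) * |θ₁ - θ₂| ^ α := by positivity
    linarith

end KernelHolder

/-! ### The integrand of the remainder -/

section Integrand

variable {γ : ℝ}

/-- Differentiability holds for the operator-valued map, but only the action on `p` is needed. It is
computed from `s ↦ tensor (X θ - X s) p` by uniqueness of derivatives. -/
theorem hasDerivAt_tensor_sub {X : ℝ → Plane} {p : Plane} {θ θ' : ℝ} (hX : HasDerivAt X p θ')
    (hne : X θ ≠ X θ') :
    ∃ D : Plane →L[ℝ] Plane, HasDerivAt (fun s => tensor (X θ - X s)) D θ' ∧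
      D p = (2 * inner ℝ (X θ - X θ') p ^ 2 / ‖X θ - X θ'‖ ^ 4
          - ‖p‖ ^ 2 / ‖X θ - X θ'‖ ^ 2) • (X θ - X θ')
        - (inner ℝ (X θ - X θ') p / ‖X θ - X θ'‖ ^ 2) • p := by
  have hx : HasDerivAt (fun s => X θ - X s) (-p) θ' := hX.const_sub (X θ)
  have hx0 : X θ - X θ' ≠ 0 := sub_ne_zero.2 hne
  have hn : ‖X θ - X θ'‖ ^ 2 ≠ 0 := pow_ne_zero 2 (norm_ne_zero_iff.2 hx0)
  have h1 : HasDerivAt (fun s => (‖X θ - X s‖ ^ 2)⁻¹) _ θ' := hx.norm_sq.inv hn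
  have h2 : DifferentiableAt ℝ (fun s => InnerProductSpace.rankOne ℝ (X θ - X s) (X θ - X s)) θ' := by
    have h3 : DifferentiableAt ℝ (fun s => (innerSL ℝ (X θ - X s)).smulRight (X θ - X s)) θ' := by
      have h4 : DifferentiableAt ℝ (fun s => innerSL ℝ (X θ - X s)) θ' :=
        (innerSL ℝ (E := Plane)).differentiableAt.comp θ' hx.differentiableAt
      exact (isBoundedBilinearMap_smulRight.differentiableAt
        (innerSL ℝ (X θ - X θ'), X θ - X θ')).comp θ' (h4.prodMk hx.differentiableAt)
    exact h3
  have h5 : DifferentiableAt ℝ (fun s => tensor (X θ - X s)) θ' :=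
    h1.differentiableAt.smul h2
  refine ⟨_, h5.hasDerivAt, ?_⟩
  have h6 := h5.hasDerivAt.clm_apply (hasDerivAt_const θ' p)
  have h7 : HasDerivAt (fun s => (‖X θ - X s‖ ^ 2)⁻¹ • (inner ℝ (X θ - X s) p • (X θ - X s))) _ θ' :=
    h1.smul ((hx.inner ℝ (hasDerivAt_const θ' p)).smul hx)
  have h8 := h6.unique h7
  rw [map_zero, add_zero] at h8
  rw [h8]
  simp only [inner_neg_right, inner_neg_left, inner_zero_right, real_inner_self_eq_norm_sq]
  have hn' : ‖X θ - X θ'‖ ≠ 0 := norm_ne_zero_iff.2 hx0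
  ext i
  simp only [PiLp.add_apply, PiLp.sub_apply, PiLp.smul_apply, PiLp.neg_apply, smul_eq_mul]
  field_simp
  ring

/-- The integrand of the remainder. -/
def remainderIntegrand (X : ℝ → Plane) (θ θ' : ℝ) : Plane :=
  (inner ℝ (X θ - X θ') (deriv X θ') / ‖X θ - X θ'‖ ^ 2
      - 1 / 2 * Real.cot ((θ - θ') / 2)) • deriv X θ'
    + deriv (fun s => tensor (X θ - X s)) θ' (deriv X θ')

theorem remainder_eq (X : ℝ → Plane) (θ : ℝ) : remainder X θ = -(1 / (4 * Real.pi)) •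
    ∫ θ' in (θ - Real.pi)..(θ + Real.pi), remainderIntegrand X θ θ' := rfl

/-- The logarithmic part of the Stokeslet cancels the part of the tensor derivative along `∂X'`.
What remains is a multiple of the chord and the cotangent term. -/
theorem remainderIntegrand_eq {X : ℝ → Plane} {θ θ' : ℝ} (hX : DifferentiableAt ℝ X θ')
    (hne : X θ ≠ X θ') :
    remainderIntegrand X θ θ' =
      (2 * inner ℝ (X θ - X θ') (deriv X θ') ^ 2 / ‖X θ - X θ'‖ ^ 4
          - ‖deriv X θ'‖ ^ 2 / ‖X θ - X θ'‖ ^ 2) • (X θ - X θ')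
        - (1 / 2 * Real.cot ((θ - θ') / 2)) • deriv X θ' := by
  obtain ⟨D, hD, hDp⟩ := hasDerivAt_tensor_sub hX.hasDerivAt hne
  rw [remainderIntegrand, hD.deriv, hDp, sub_smul]
  abel

theorem cot_add_pi (x : ℝ) : Real.cot (x + Real.pi) = Real.cot x := by
  rw [Real.cot_eq_cos_div_sin, Real.cot_eq_cos_div_sin, Real.cos_add_pi, Real.sin_add_pi, neg_div_neg_eq]

theorem deriv_periodic {E : Type*} [NormedAddCommGroup E] [NormedSpace ℝ E] {f : ℝ → E} {T : ℝ}
    (hf : Function.Periodic f T) : Function.Periodic (deriv f) T := fun θ => by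
  rw [← deriv_comp_add_const]
  congr 1
  exact funext hf

theorem remainderIntegrand_periodic {X : ℝ → Plane} (hX : Function.Periodic X (2 * Real.pi))
    (θ : ℝ) : Function.Periodic (remainderIntegrand X θ) (2 * Real.pi) := fun θ' => by
  have h1 : Real.cot ((θ - (θ' + 2 * Real.pi)) / 2) = Real.cot ((θ - θ') / 2) := by
    rw [← cot_add_pi]; congr 1; ring
  have h2 : Function.Periodic (fun s => tensor (X θ - X s)) (2 * Real.pi) := fun s => by
    simp only [hX s]
  rw [remainderIntegrand, remainderIntegrand, h1, hX θ', deriv_periodic hX θ', deriv_periodic h2 θ']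

theorem remainderIntegrand_periodic_left {X : ℝ → Plane}
    (hX : Function.Periodic X (2 * Real.pi)) (θ θ' : ℝ) :
    remainderIntegrand X (θ + 2 * Real.pi) θ' = remainderIntegrand X θ θ' := by
  have h1 : Real.cot ((θ + 2 * Real.pi - θ') / 2) = Real.cot ((θ - θ') / 2) := by
    rw [← cot_add_pi ((θ - θ') / 2)]; congr 1; ring
  rw [remainderIntegrand, remainderIntegrand, h1, hX θ]

/-- By periodicity any window of length `2π` may be used, which allows integrals at different `θ` to
be compared over a common one. -/
theorem integral_remainderIntegrand_window {X : ℝ → Plane}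
    (hX : Function.Periodic X (2 * Real.pi)) (θ θ₁ θ₂ : ℝ) :
    ∫ θ' in (θ₁ - Real.pi)..(θ₁ + Real.pi), remainderIntegrand X θ θ'
      = ∫ θ' in (θ₂ - Real.pi)..(θ₂ + Real.pi), remainderIntegrand X θ θ' := by
  have := (remainderIntegrand_periodic hX θ).intervalIntegral_add_eq (θ₁ - Real.pi) (θ₂ - Real.pi)
  convert this using 2 <;> ring

theorem remainder_periodic {X : ℝ → Plane} (hX : Function.Periodic X (2 * Real.pi)) :
    Function.Periodic (remainder X) (2 * Real.pi) := fun θ => by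
  rw [remainder_eq, remainder_eq, integral_remainderIntegrand_window hX _ _ θ]
  simp only [remainderIntegrand_periodic_left hX]

end Integrand

/-! ### The cotangent kernel -/

section Cotangent

/-- Jordan's inequality up to `π`, and its reflection `sin x = sin (π - x)` beyond. -/
theorem div_eight_le_sin {y : ℝ} (h0 : 0 ≤ y) (h : y ≤ Real.pi + 1) : y / 8 ≤ Real.sin (y / 2) := by
  have hπ := Real.pi_gt_three
  have hπ4 := Real.pi_le_four
  have h2 : (1 : ℝ) / 2 ≤ 2 / Real.pi := by rw [div_le_div_iff₀] <;> linarith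
  rcases le_total y Real.pi with h1 | h1
  · have := Real.mul_le_sin (x := y / 2) (by linarith) (by linarith)
    nlinarith
  · have := Real.mul_le_sin (x := Real.pi - y / 2) (by linarith) (by linarith)
    rw [Real.sin_pi_sub] at this
    have h3 : (1 : ℝ) / 2 * (Real.pi - y / 2) ≤ 2 / Real.pi * (Real.pi - y / 2) :=
      mul_le_mul_of_nonneg_right h2 (by linarith)
    linarith

theorem abs_div_eight_le_abs_sin {y : ℝ} (h : |y| ≤ Real.pi + 1) :
    |y| / 8 ≤ |Real.sin (y / 2)| := by
  rcases abs_cases y with ⟨hy, -⟩ | ⟨hy, -⟩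
  · rw [hy] at h ⊢
    exact (div_eight_le_sin (by linarith [abs_nonneg y]) h).trans (le_abs_self _)
  · rw [hy] at h ⊢
    have := div_eight_le_sin (by linarith [abs_nonneg y]) h
    rw [neg_div (2 : ℝ) y, Real.sin_neg] at this
    exact this.trans (neg_le_abs _)

theorem sin_half_ne_zero {y : ℝ} (h0 : y ≠ 0) (h : |y| ≤ Real.pi + 1) : Real.sin (y / 2) ≠ 0 := by
  have h1 := abs_div_eight_le_abs_sin h
  have h2 : 0 < |y| := abs_pos.2 h0
  exact abs_pos.1 (by linarith)

/-- The difference between `cot (y / 2) / 2` and `1 / y`. -/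
def cotDiff (y : ℝ) : ℝ := 1 / 2 * Real.cot (y / 2) - y⁻¹

theorem cotDiff_neg (y : ℝ) : cotDiff (-y) = -cotDiff y := by
  rw [cotDiff, cotDiff, Real.cot_eq_cos_div_sin, Real.cot_eq_cos_div_sin, neg_div, Real.cos_neg,
    Real.sin_neg, div_neg, inv_neg]
  ring

theorem hasDerivAt_cotDiff {y : ℝ} (h0 : 0 < y) (h : y ≤ Real.pi + 1) :
    HasDerivAt cotDiff (1 / y ^ 2 - 1 / (4 * Real.sin (y / 2) ^ 2)) y := by
  have hs : Real.sin (y / 2) ≠ 0 := sin_half_ne_zero h0.ne' (by rwa [abs_of_pos h0])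
  have h1 : HasDerivAt (fun y : ℝ => y / 2) (1 / 2) y := (hasDerivAt_id y).div_const 2
  have h2 := ((h1.cos.div h1.sin hs).const_mul (1 / 2 : ℝ)).sub (hasDerivAt_inv h0.ne')
  have e : cotDiff = fun y : ℝ => 1 / 2 * (Real.cos (y / 2) / Real.sin (y / 2)) - y⁻¹ :=
    funext fun y => by rw [cotDiff, Real.cot_eq_cos_div_sin]
  rw [e]
  refine h2.congr_deriv ?_
  have h3 := Real.sin_sq_add_cos_sq (y / 2)
  field_simp
  linear_combination (-4 * y ^ 2) * h3

/-- Over a common denominator the numerator is `(y/2 - s)(y/2 + s)` with `s = sin (y/2)`, which is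
`O(y^4)` by the cubic lower bound for the sine and so compensates `y² s²`. -/
theorem abs_deriv_cotDiff_le {y : ℝ} (h0 : 0 < y) (h : y ≤ Real.pi + 1) :
    |1 / y ^ 2 - 1 / (4 * Real.sin (y / 2) ^ 2)| ≤ 2 := by
  have h1 := div_eight_le_sin h0.le h
  have h2 : Real.sin (y / 2) < y / 2 := Real.sin_lt (by linarith)
  have h3 : y / 2 - (y / 2) ^ 3 / 6 < Real.sin (y / 2) := Real.sin_gt_sub_cube (by linarith)
  set s := Real.sin (y / 2)
  have hs : 0 < s := by linarith
  have e : 1 / y ^ 2 - 1 / (4 * s ^ 2) = -((y / 2 - s) * (y / 2 + s) / (y ^ 2 * s ^ 2)) := by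
    field_simp; ring
  have hnn : 0 ≤ (y / 2 - s) * (y / 2 + s) := mul_nonneg (by linarith) (by linarith)
  rw [e, abs_neg, abs_of_nonneg (by positivity), div_le_iff₀ (by positivity)]
  have h4 : (y / 2 - s) * (y / 2 + s) ≤ (y ^ 3 / 48) * y :=
    mul_le_mul (by nlinarith) (by linarith) (by linarith) (by positivity)
  have h5 : (y / 8) ^ 2 ≤ s ^ 2 := pow_le_pow_left₀ (by linarith) h1 2
  have h6 := mul_le_mul_of_nonneg_left h5 (show (0 : ℝ) ≤ 2 * y ^ 2 by positivity)
  have h7 : 0 ≤ y ^ 4 := by positivity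
  nlinarith

theorem abs_cotDiff_sub_le_of_pos {y z : ℝ} (hy : 0 < y) (hy' : y ≤ Real.pi + 1) (hz : 0 < z)
    (hz' : z ≤ Real.pi + 1) : |cotDiff y - cotDiff z| ≤ 2 * |y - z| := by
  have := Convex.norm_image_sub_le_of_norm_hasDerivWithin_le (f := cotDiff)
    (f' := fun y => 1 / y ^ 2 - 1 / (4 * Real.sin (y / 2) ^ 2)) (s := Ioc 0 (Real.pi + 1)) (C := 2)
    (fun x hx => (hasDerivAt_cotDiff hx.1 hx.2).hasDerivWithinAt)
    (fun x hx => abs_deriv_cotDiff_le hx.1 hx.2) (convex_Ioc _ _) ⟨hz, hz'⟩ ⟨hy, hy'⟩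
  simpa [Real.norm_eq_abs] using this

/-- The Lipschitz bound on the half line propagates the value at `π`, where the cotangent vanishes;
oddness covers negative arguments. -/
theorem abs_cotDiff_le {y : ℝ} (h0 : y ≠ 0) (h : |y| ≤ Real.pi + 1) : |cotDiff y| ≤ 12 := by
  have hπ := Real.pi_gt_three
  have hπ4 := Real.pi_le_four
  have key : ∀ z : ℝ, 0 < z → z ≤ Real.pi + 1 → |cotDiff z| ≤ 12 := fun z hz hz' => by
    have h1 := abs_cotDiff_sub_le_of_pos hz hz' Real.pi_pos (by linarith)
    have h2 : cotDiff Real.pi = -Real.pi⁻¹ := by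
      rw [cotDiff, Real.cot_eq_cos_div_sin, Real.cos_pi_div_two]; simp
    have h3 : |cotDiff Real.pi| ≤ 1 := by
      rw [h2, abs_neg, abs_of_pos (by positivity)]
      exact inv_le_one_of_one_le₀ (by linarith)
    have h4 : |z - Real.pi| ≤ 4 := abs_le.2 ⟨by linarith, by linarith⟩
    have h5 := abs_sub_abs_le_abs_sub (cotDiff z) (cotDiff Real.pi)
    linarith
  rcases lt_or_gt_of_ne h0 with h1 | h1
  · rw [abs_of_neg h1] at h
    rw [← neg_neg y, cotDiff_neg, abs_neg]
    exact key _ (by linarith) h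
  · rw [abs_of_pos h1] at h
    exact key _ h1 h

theorem measurable_cotDiff : Measurable cotDiff := by
  have : cotDiff = fun y : ℝ => 1 / 2 * (Real.cos (y / 2) / Real.sin (y / 2)) - y⁻¹ :=
    funext fun y => by rw [cotDiff, Real.cot_eq_cos_div_sin]
  rw [this]
  fun_prop

/-- Increments of `cotDiff`, in a form that is integrable at the origin. -/
theorem abs_cotDiff_sub_le {α y z : ℝ} (hα0 : 0 < α) (hα : α < 1) (hy0 : y ≠ 0) (hz0 : z ≠ 0)
    (hy : |y| ≤ Real.pi + 1) (hz : |z| ≤ Real.pi + 1) :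
    |cotDiff y - cotDiff z| ≤ 48 * |y - z| ^ α * |y| ^ (-α) := by
  have hy1 : 0 < |y| := abs_pos.2 hy0
  rcases eq_or_ne y z with rfl | hne
  · rw [sub_self, abs_zero]; positivity
  have hh : 0 < |y - z| := abs_pos.2 (sub_ne_zero.2 hne)
  have hone : |y| ^ α * |y| ^ (-α) = 1 := by rw [← Real.rpow_add hy1]; simp
  -- In the first case `y` and `z` lie on the same side of the origin and the Lipschitz bound
  -- applies, with a power of `|y - z|` traded for one of `|y|`. In the second the sup bound
  -- suffices.
  rcases le_or_gt (2 * |y - z|) |y| with hfar | hnear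
  · have b : |cotDiff y - cotDiff z| ≤ 2 * |y - z| := by
      rcases abs_cases y with ⟨h1, h2⟩ | ⟨h1, h2⟩
      · have hz1 : 0 < z := by
          rw [h1] at hfar hy1
          linarith [le_abs_self (y - z)]
        rw [abs_of_pos hz1] at hz
        rw [h1] at hy hy1
        exact abs_cotDiff_sub_le_of_pos hy1 hy hz1 hz
      · have hz1 : z < 0 := by
          rw [h1] at hfar hy1
          linarith [neg_abs_le (y - z)]
        rw [abs_of_neg hz1] at hz
        rw [h1] at hy hy1
        have := abs_cotDiff_sub_le_of_pos hy1 hy (show 0 < -z by linarith) hz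
        rwa [cotDiff_neg, cotDiff_neg, ← neg_sub', abs_neg, ← neg_sub', abs_neg] at this
    have c1 : |y - z| = |y - z| ^ α * |y - z| ^ (1 - α) := by rw [← Real.rpow_add hh]; simp
    have c2 : |y - z| ^ (1 - α) ≤ |y| ^ (1 - α) :=
      Real.rpow_le_rpow hh.le (by linarith) (by linarith)
    have c3 : |y| ^ (1 - α) = |y| * |y| ^ (-α) := by
      rw [sub_eq_add_neg, Real.rpow_add hy1, Real.rpow_one]
    have c4 : |y| * |y| ^ (-α) ≤ 5 * |y| ^ (-α) :=
      mul_le_mul_of_nonneg_right (by linarith [Real.pi_le_four]) (by positivity)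
    have c5 : |y - z| ≤ |y - z| ^ α * (5 * |y| ^ (-α)) := by
      nth_rewrite 1 [c1]
      exact mul_le_mul_of_nonneg_left (c2.trans (c3.trans_le c4)) (by positivity)
    have : 0 ≤ |y - z| ^ α * |y| ^ (-α) := by positivity
    linarith
  · have b := (abs_sub (cotDiff y) (cotDiff z)).trans
      (add_le_add (abs_cotDiff_le hy0 hy) (abs_cotDiff_le hz0 hz))
    have c1 : |y| ^ α ≤ 2 * |y - z| ^ α :=
      (Real.rpow_le_rpow hy1.le hnear.le hα0.le).trans
        (mul_rpow_le_mul_rpow (by norm_num) hh.le hα.le)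
    have c2 := mul_le_mul_of_nonneg_right c1 (show 0 ≤ |y| ^ (-α) by positivity)
    rw [hone] at c2
    linarith

end Cotangent

/-! ### Lipschitz dependence of kernels on the curve -/

section LipFamily

variable {γ α : ℝ}

/-- `F` is bounded and Lipschitz on `U`, with respect to the bounds expressed by `P`. -/
def LipFamily (P : (ℝ → ℝ → ℝ) → ℝ → Prop) (U : Set (HolderSpace 1 γ))
    (F : HolderSpace 1 γ → ℝ → ℝ → ℝ) : Prop :=
  ∃ C : ℝ, ∀ X ∈ U, P (F X) C ∧
    ∀ Y ∈ U, P (fun θ θ' => F X θ θ' - F Y θ θ') (C * ‖X - Y‖)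

/-- Integrands whose window integrals are bounded and `α`-Hölder in `θ`. -/
structure HolderIntegral (α : ℝ) (g : ℝ → ℝ → ℝ) (C : ℝ) : Prop where
  integrable : ∀ θ θ₀, |θ - θ₀| ≤ 1 →
    IntervalIntegrable (g θ) volume (θ₀ - Real.pi) (θ₀ + Real.pi)
  bound : ∀ θ, |∫ θ' in (θ - Real.pi)..(θ + Real.pi), g θ θ'| ≤ C
  incr : ∀ θ₁ θ₂, |θ₁ - θ₂| ≤ 1 →
    |(∫ θ' in (θ₁ - Real.pi)..(θ₁ + Real.pi), g θ₁ θ')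
      - ∫ θ' in (θ₁ - Real.pi)..(θ₁ + Real.pi), g θ₂ θ'| ≤ C * |θ₁ - θ₂| ^ α

/-! ### Linear operations on integrands. -/

namespace HolderIntegral

variable {f g : ℝ → ℝ → ℝ} {A B : ℝ}

theorem mono (hf : HolderIntegral α f A) (h : A ≤ B) : HolderIntegral α f B where
  integrable := hf.integrable
  bound θ := (hf.bound θ).trans h
  incr θ₁ θ₂ h₁ := (hf.incr θ₁ θ₂ h₁).trans (mul_le_mul_of_nonneg_right h (by positivity))

theorem neg (hf : HolderIntegral α f A) : HolderIntegral α (fun θ θ' => -f θ θ') A where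
  integrable θ θ₀ h := (hf.integrable θ θ₀ h).neg
  bound θ := by
    rw [intervalIntegral.integral_neg, abs_neg]
    exact hf.bound θ
  incr θ₁ θ₂ h := by
    rw [intervalIntegral.integral_neg, intervalIntegral.integral_neg, ← neg_sub', abs_neg]
    exact hf.incr θ₁ θ₂ h

theorem add (hf : HolderIntegral α f A) (hg : HolderIntegral α g B) :
    HolderIntegral α (fun θ θ' => f θ θ' + g θ θ') (A + B) where
  integrable θ θ₀ h := (hf.integrable θ θ₀ h).add (hg.integrable θ θ₀ h)
  bound θ := by
    rw [intervalIntegral.integral_add (hf.integrable θ θ (by simp)) (hg.integrable θ θ (by simp))]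
    exact (abs_add_le _ _).trans (add_le_add (hf.bound θ) (hg.bound θ))
  incr θ₁ θ₂ h := by
    have h' : |θ₂ - θ₁| ≤ 1 := by rwa [abs_sub_comm]
    rw [intervalIntegral.integral_add (hf.integrable θ₁ θ₁ (by simp))
      (hg.integrable θ₁ θ₁ (by simp)), intervalIntegral.integral_add (hf.integrable θ₂ θ₁ h')
      (hg.integrable θ₂ θ₁ h'), add_sub_add_comm, add_mul]
    exact (abs_add_le _ _).trans (add_le_add (hf.incr θ₁ θ₂ h) (hg.incr θ₁ θ₂ h))

/-- Only integrals over windows enter, and the diagonal is a null set, so pointwise identities are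
needed only off the diagonal. -/
theorem congr (hf : HolderIntegral α f A)
    (h : ∀ θ θ', |θ - θ'| ≤ Real.pi + 1 → θ ≠ θ' → f θ θ' = g θ θ') : HolderIntegral α g A := by
  have hae : ∀ θ θ₀, |θ - θ₀| ≤ 1 →
      ∀ᵐ θ' ∂volume, θ' ∈ uIoc (θ₀ - Real.pi) (θ₀ + Real.pi) → f θ θ' = g θ θ' := fun θ θ₀ hθ => by
    have h0 : ∀ᵐ θ' : ℝ, θ' ≠ θ := by simp [ae_iff, measure_singleton]
    filter_upwards [h0] with θ' hne hmem
    rw [uIoc_of_le (by linarith [Real.pi_pos])] at hmem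
    have h' := abs_le.1 hθ
    exact h θ θ' (abs_le.2 ⟨by linarith [hmem.2], by linarith [hmem.1]⟩) hne.symm
  refine ⟨fun θ θ₀ hθ => ?_, fun θ => ?_, fun θ₁ θ₂ h => ?_⟩
  · exact (hf.integrable θ θ₀ hθ).congr_ae
      ((ae_restrict_iff' measurableSet_uIoc).2 (hae θ θ₀ hθ))
  · rw [← intervalIntegral.integral_congr_ae (hae θ θ (by simp))]
    exact hf.bound θ
  · rw [← intervalIntegral.integral_congr_ae (hae θ₁ θ₁ (by simp)),
      ← intervalIntegral.integral_congr_ae (hae θ₂ θ₁ (by rwa [abs_sub_comm]))]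
    exact hf.incr θ₁ θ₂ h

end HolderIntegral

/-! ### Closure properties of Lipschitz families. -/

namespace LipFamily

variable {U : Set (HolderSpace 1 γ)} {F G : HolderSpace 1 γ → ℝ → ℝ → ℝ}

theorem kernel_add (hF : LipFamily (IsKernel γ) U F) (hG : LipFamily (IsKernel γ) U G) :
    LipFamily (IsKernel γ) U (fun X θ θ' => F X θ θ' + G X θ θ') := by
  obtain ⟨A, hA⟩ := hF
  obtain ⟨B, hB⟩ := hG
  refine ⟨A + B, fun X hX => ⟨(hA X hX).1.add (hB X hX).1, fun Y hY => ?_⟩⟩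
  have := ((hA X hX).2 Y hY).add ((hB X hX).2 Y hY)
  rw [← add_mul] at this
  simpa only [add_sub_add_comm] using this

theorem kernel_neg (hF : LipFamily (IsKernel γ) U F) :
    LipFamily (IsKernel γ) U (fun X θ θ' => -F X θ θ') := by
  obtain ⟨A, hA⟩ := hF
  refine ⟨A, fun X hX => ⟨(hA X hX).1.neg, fun Y hY => ?_⟩⟩
  simpa only [neg_sub'] using ((hA X hX).2 Y hY).neg

theorem kernel_sub (hF : LipFamily (IsKernel γ) U F) (hG : LipFamily (IsKernel γ) U G) :
    LipFamily (IsKernel γ) U (fun X θ θ' => F X θ θ' - G X θ θ') := by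
  simpa only [sub_eq_add_neg] using hF.kernel_add hG.kernel_neg

theorem kernel_const (c : ℝ) : LipFamily (IsKernel γ) U (fun _ _ _ => c) := by
  refine ⟨|c|, fun X _ => ⟨IsKernel.const c, fun Y _ => ?_⟩⟩
  simp only [sub_self]
  exact (IsKernel.const 0).mono (by rw [abs_zero]; positivity)

/-- The difference of products is `(F X - F Y) G X + F Y (G X - G Y)`; each term costs `2AB` by the
product rule for kernels. -/
theorem kernel_mul (hF : LipFamily (IsKernel γ) U F) (hG : LipFamily (IsKernel γ) U G) :
    LipFamily (IsKernel γ) U (fun X θ θ' => F X θ θ' * G X θ θ') := by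
  obtain ⟨A, hA⟩ := hF
  obtain ⟨B, hB⟩ := hG
  refine ⟨4 * (A * B), fun X hX => ?_⟩
  have hA0 := (hA X hX).1.nonneg
  have hB0 := (hB X hX).1.nonneg
  have hAB := mul_nonneg hA0 hB0
  refine ⟨((hA X hX).1.mul (hB X hX).1).mono (by linarith), fun Y hY => ?_⟩
  have h1 := ((hA X hX).2 Y hY).mul (hB X hX).1
  have h2 := (hA Y hY).1.mul ((hB X hX).2 Y hY)
  convert h1.add h2 using 1
  · funext θ θ'; ring
  · ring

/-- The difference of inverses is `-(F X)⁻¹ (F Y)⁻¹ (F X - F Y)`, a product of kernels already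
controlled. -/
theorem kernel_inv {m : ℝ} (hF : LipFamily (IsKernel γ) U F) (hm : 0 < m)
    (h : ∀ X ∈ U, ∀ θ θ', |θ - θ'| ≤ Real.pi + 1 → m ≤ F X θ θ') :
    LipFamily (IsKernel γ) U (fun X θ θ' => (F X θ θ')⁻¹) := by
  obtain ⟨A, hA⟩ := hF
  refine ⟨m⁻¹ + A / m ^ 2 + 4 * ((m⁻¹ + A / m ^ 2) * (m⁻¹ + A / m ^ 2) * A), fun X hX => ?_⟩
  have hA0 := (hA X hX).1.nonneg
  set B := m⁻¹ + A / m ^ 2 with hB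
  have hB0 : 0 ≤ B := by positivity
  refine ⟨((hA X hX).1.inv hm (h X hX)).mono
    (by rw [← hB]; linarith [show 0 ≤ 4 * (B * B * A) by positivity]), fun Y hY => ?_⟩
  have k := (((hA X hX).1.inv hm (h X hX)).mul ((hA Y hY).1.inv hm (h Y hY))).mul
    ((hA X hX).2 Y hY)
  rw [← hB] at k
  have k2 := k.neg
  refine IsKernel.mono (M := 2 * (2 * (B * B) * (A * ‖X - Y‖))) ?_ ?_
  · have e : ∀ θ θ', |θ - θ'| ≤ Real.pi + 1 →
        -((F X θ θ')⁻¹ * (F Y θ θ')⁻¹ * (F X θ θ' - F Y θ θ'))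
          = (F X θ θ')⁻¹ - (F Y θ θ')⁻¹ := fun θ θ' hθ => by
      have h1 := (hm.trans_le (h X hX θ θ' hθ)).ne'
      have h2 := (hm.trans_le (h Y hY θ θ' hθ)).ne'
      field_simp
      ring
    have h0 : ∀ θ : ℝ, |θ - θ| ≤ Real.pi + 1 := fun θ => by
      rw [sub_self, abs_zero]; linarith [Real.pi_pos]
    refine ⟨fun θ => ?_, fun θ θ' hθ => ?_, fun θ₀ θ θ' hθ => ?_, fun θ₁ θ₂ θ' h₁ h₂ h₃ => ?_⟩
    · exact (((hA X hX).1.inv hm (h X hX)).measurable θ).sub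
        (((hA Y hY).1.inv hm (h Y hY)).measurable θ)
    · have := k2.bound θ θ' hθ
      rwa [e θ θ' hθ] at this
    · have := k2.diag θ₀ θ θ' hθ
      rwa [e θ θ' hθ, e θ₀ θ₀ (h0 θ₀)] at this
    · have := k2.incr θ₁ θ₂ θ' h₁ h₂ h₃
      rwa [e θ₁ θ' h₁, e θ₂ θ' h₂] at this
  · have : 0 ≤ B * ‖X - Y‖ := by positivity
    linarith

theorem integral_add (hF : LipFamily (HolderIntegral α) U F)
    (hG : LipFamily (HolderIntegral α) U G) :
    LipFamily (HolderIntegral α) U (fun X θ θ' => F X θ θ' + G X θ θ') := by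
  obtain ⟨A, hA⟩ := hF
  obtain ⟨B, hB⟩ := hG
  refine ⟨A + B, fun X hX => ⟨(hA X hX).1.add (hB X hX).1, fun Y hY => ?_⟩⟩
  have := ((hA X hX).2 Y hY).add ((hB X hX).2 Y hY)
  rw [← add_mul] at this
  simpa only [add_sub_add_comm] using this

theorem integral_neg (hF : LipFamily (HolderIntegral α) U F) :
    LipFamily (HolderIntegral α) U (fun X θ θ' => -F X θ θ') := by
  obtain ⟨A, hA⟩ := hF
  refine ⟨A, fun X hX => ⟨(hA X hX).1.neg, fun Y hY => ?_⟩⟩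
  simpa only [neg_sub'] using ((hA X hX).2 Y hY).neg

theorem integral_congr (hF : LipFamily (HolderIntegral α) U F)
    (h : ∀ X ∈ U, ∀ θ θ', |θ - θ'| ≤ Real.pi + 1 → θ ≠ θ' → F X θ θ' = G X θ θ') :
    LipFamily (HolderIntegral α) U G := by
  obtain ⟨A, hA⟩ := hF
  refine ⟨A, fun X hX => ⟨(hA X hX).1.congr (h X hX), fun Y hY => ((hA X hX).2 Y hY).congr ?_⟩⟩
  intro θ θ' h1 h2
  rw [h X hX θ θ' h1 h2, h Y hY θ θ' h1 h2]

end LipFamily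

/-! ### Components -/

theorem abs_apply_le_norm (v : Plane) (j : Fin 2) : |v j| ≤ ‖v‖ := PiLp.norm_apply_le v j

theorem HolderSpace.isHolderDeriv (hγ : 0 < γ) (X : HolderSpace 1 γ) (j : Fin 2) :
    IsHolderDeriv γ (fun θ => X θ j) (fun θ => deriv X θ j) (2 * ‖X‖) where
  hasDerivAt θ := (EuclideanSpace.proj (𝕜 := ℝ) j).hasFDerivAt.comp_hasDerivAt θ (X.hasDerivAt θ)
  bound θ := ((abs_apply_le_norm _ j).trans (X.norm_deriv_le θ)).trans
    (by linarith [norm_nonneg X])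
  holder θ θ' := by
    have := abs_apply_le_norm (deriv X θ - deriv X θ') j
    exact this.trans (X.norm_deriv_sub_le hγ θ θ')

/-- The secant slope of the `j`-th component. -/
def secantComp (j : Fin 2) (X : ℝ → Plane) : ℝ → ℝ → ℝ :=
  secant (fun θ => X θ j) (fun θ => deriv X θ j)

/-- The `θ'`-derivative of the secant slope of the `j`-th component. -/
def secantDerivComp (j : Fin 2) (X : ℝ → Plane) : ℝ → ℝ → ℝ :=
  secantDeriv (fun θ => X θ j) (fun θ => deriv X θ j)

theorem secantComp_sub (j : Fin 2) (X Y : HolderSpace 1 γ) (θ θ' : ℝ) :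
    secantComp j (X - Y : HolderSpace 1 γ) θ θ' = secantComp j X θ θ' - secantComp j Y θ θ' := by
  unfold secantComp secant
  split_ifs
  · exact congrArg (fun v : Plane => v j) (HolderSpace.deriv_sub X Y θ)
  · simp only [HolderSpace.coe_sub, PiLp.sub_apply]
    ring

theorem secantDerivComp_sub (j : Fin 2) (X Y : HolderSpace 1 γ) (θ θ' : ℝ) :
    secantDerivComp j (X - Y : HolderSpace 1 γ) θ θ'
      = secantDerivComp j X θ θ' - secantDerivComp j Y θ θ' := by
  have := secantComp_sub j X Y θ θ'
  unfold secantComp at this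
  have h := congrArg (fun v : Plane => v j) (HolderSpace.deriv_sub X Y θ')
  simp only [PiLp.sub_apply] at h
  unfold secantDerivComp secantDeriv
  rw [this]
  beta_reduce
  rw [h]
  ring

variable {U : Set (HolderSpace 1 γ)}

/-- Secants are linear in the curve, so the difference is the secant of `X - Y`. The constant `6 (M
+ 1)` serves the bound `6 ‖X‖` and the Lipschitz constant `6` together. -/
theorem lipFamily_secantComp (hγ : 0 < γ) (hγ₁ : γ < 1) {M : ℝ} (hU : ∀ X ∈ U, ‖X‖ ≤ M)
    (j : Fin 2) : LipFamily (IsKernel γ) U (fun X => secantComp j X) := by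
  refine ⟨6 * (M + 1), fun X hX => ⟨((X.isHolderDeriv hγ j).isKernel_secant hγ hγ₁).mono
    (by linarith [hU X hX]), fun Y hY => ?_⟩⟩
  have := ((X - Y).isHolderDeriv hγ j).isKernel_secant hγ hγ₁
  have hM := (norm_nonneg X).trans (hU X hX)
  simp only [← secantComp_sub]
  refine IsKernel.mono this ?_
  have := mul_nonneg hM (norm_nonneg (X - Y))
  linarith

theorem lipFamily_deriv (hγ : 0 < γ) {M : ℝ} (hU : ∀ X ∈ U, ‖X‖ ≤ M)
    (j : Fin 2) : LipFamily (IsKernel γ) U (fun X _ θ' => deriv X θ' j) := by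
  refine ⟨2 * (M + 1), fun X hX => ⟨((X.isHolderDeriv hγ j).isKernel_deriv hγ).mono
    (by linarith [hU X hX]), fun Y hY => ?_⟩⟩
  have := ((X - Y).isHolderDeriv hγ j).isKernel_deriv hγ
  have hM := (norm_nonneg X).trans (hU X hX)
  have e : ∀ θ', deriv X θ' j - deriv Y θ' j = deriv (X - Y : HolderSpace 1 γ) θ' j :=
    fun θ' => by rw [HolderSpace.deriv_sub]; rfl
  simp only [e]
  refine IsKernel.mono this ?_
  have := mul_nonneg hM (norm_nonneg (X - Y))
  linarith

/-- `exists_kernel_integral_bound` is bilinear in the kernel and the curve. The difference is split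
into the change of the kernel and the change of the curve. -/
theorem lipFamily_kernel_mul_secantDeriv (hγ : 0 < γ) (hγα : γ < α) (hα : α < 1)
    (hα2 : α < 2 * γ) {M : ℝ} (hU : ∀ X ∈ U, ‖X‖ ≤ M) {F : HolderSpace 1 γ → ℝ → ℝ → ℝ}
    (hF : LipFamily (IsKernel γ) U F) (j : Fin 2) :
    LipFamily (HolderIntegral α) U (fun X θ θ' => F X θ θ' * secantDerivComp j X θ θ') := by
  obtain ⟨C, hC, hCb⟩ := exists_kernel_integral_bound hγ hγα hα hα2
  have key : ∀ (a : ℝ → ℝ → ℝ) (A : ℝ) (X : HolderSpace 1 γ), IsKernel γ a A →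
      HolderIntegral α (fun θ θ' => a θ θ' * secantDerivComp j X θ θ') (C * (A * (2 * ‖X‖))) :=
    fun a A X ha => by
      have h := hCb a _ _ A _ ha (X.isHolderDeriv hγ j)
      exact ⟨fun θ θ₀ hθ => intervalIntegrable_kernel_mul hγ ha (X.isHolderDeriv hγ j) hθ, h.1, h.2⟩
  obtain ⟨A, hA⟩ := hF
  refine ⟨C * (2 * A * (M + 1)), fun X hX => ?_⟩
  have hA0 := (hA X hX).1.nonneg
  have hX0 := hU X hX
  have hM0 := (norm_nonneg X).trans hX0
  refine ⟨(key _ _ X (hA X hX).1).mono ?_, fun Y hY => ?_⟩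
  · refine mul_le_mul_of_nonneg_left ?_ hC
    have := mul_le_mul_of_nonneg_left hX0 hA0
    linarith
  · have h1 := key _ _ X ((hA X hX).2 Y hY)
    have h2 := key _ _ (X - Y) (hA Y hY).1
    have h3 := h1.add h2
    refine HolderIntegral.mono (A := C * (A * ‖X - Y‖ * (2 * ‖X‖)) + C * (A * (2 * ‖X - Y‖))) ?_ ?_
    · refine h3.congr fun θ θ' _ _ => ?_
      rw [secantDerivComp_sub]
      ring
    · rw [← mul_add, mul_assoc C]
      refine mul_le_mul_of_nonneg_left ?_ hC
      have := mul_le_mul_of_nonneg_left hX0 (mul_nonneg hA0 (norm_nonneg (X - Y)))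
      linarith

/-- No regularity of `p` beyond continuity and boundedness is needed: the Hölder increment comes
from `cotDiff` alone, with weight `|θ₁ - θ'|^(-α)`, integrable since `α < 1`. -/
theorem exists_holderIntegral_cotDiff (hα0 : 0 < α) (hα : α < 1) :
    ∃ C : ℝ, 0 ≤ C ∧ ∀ (p : ℝ → ℝ) (N : ℝ), Continuous p → (∀ θ, |p θ| ≤ N) →
      HolderIntegral α (fun θ θ' => cotDiff (θ - θ') * p θ') (C * N) := by
  have hπ := Real.pi_pos
  obtain ⟨J, hJ, hJb⟩ := exists_integral_abs_rpow_le (s := -α) (by linarith)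
  refine ⟨24 * Real.pi + 48 * J, by positivity, fun p N hp hN => ?_⟩
  have hN0 : 0 ≤ N := (abs_nonneg _).trans (hN 0)
  have h0 : ∀ θ : ℝ, ∀ᵐ θ' : ℝ, θ' ≠ θ := fun θ => by simp [ae_iff, measure_singleton]
  have hI : ∀ θ θ₀, |θ - θ₀| ≤ 1 → IntervalIntegrable (fun θ' => cotDiff (θ - θ') * p θ') volume
      (θ₀ - Real.pi) (θ₀ + Real.pi) := fun θ θ₀ h => by
    refine (intervalIntegrable_const (c := 12 * N)).mono_fun ?_ ?_
    · exact ((measurable_cotDiff.comp (measurable_const.sub measurable_id)).mul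
        hp.measurable).aestronglyMeasurable
    · filter_upwards [ae_ne_restrict θ _ _, ae_restrict_mem measurableSet_uIoc] with θ' hne hmem
      rw [uIoc_of_le (by linarith [Real.pi_pos])] at hmem
      have h' := abs_le.1 h
      rw [norm_mul, Real.norm_eq_abs, Real.norm_eq_abs, Real.norm_of_nonneg (by positivity)]
      exact mul_le_mul (abs_cotDiff_le (sub_ne_zero.2 hne.symm)
        (abs_le.2 ⟨by linarith [hmem.2], by linarith [hmem.1]⟩)) (hN θ') (abs_nonneg _) (by norm_num)
  refine ⟨hI, fun θ => ?_, fun θ₁ θ₂ h => ?_⟩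
  · rw [← Real.norm_eq_abs]
    refine (intervalIntegral.norm_integral_le_of_norm_le (by linarith) (g := fun _ => 12 * N) ?_
      intervalIntegrable_const).trans ?_
    · filter_upwards [h0 θ] with θ' hne hmem
      rw [norm_mul, Real.norm_eq_abs, Real.norm_eq_abs]
      exact mul_le_mul (abs_cotDiff_le (sub_ne_zero.2 hne.symm)
        (abs_le.2 ⟨by linarith [hmem.2], by linarith [hmem.1]⟩)) (hN θ') (abs_nonneg _) (by norm_num)
    · rw [intervalIntegral.integral_const, smul_eq_mul]
      have : 0 ≤ J * N := by positivity
      linarith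
  · have h' := abs_le.1 h
    have h21 : |θ₂ - θ₁| ≤ 1 := by rwa [abs_sub_comm]
    rw [← intervalIntegral.integral_sub (hI θ₁ θ₁ (by simp)) (hI θ₂ θ₁ h21), ← Real.norm_eq_abs]
    refine (intervalIntegral.norm_integral_le_of_norm_le (by linarith) (g := fun θ' =>
      48 * |θ₁ - θ₂| ^ α * N * |θ₁ - θ'| ^ (-α)) ?_
      ((intervalIntegrable_abs_sub_rpow (by linarith) θ₁ _ _).const_mul _)).trans ?_
    · filter_upwards [h0 θ₁, h0 θ₂] with θ' hne1 hne2 hmem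
      have b := abs_cotDiff_sub_le hα0 hα (sub_ne_zero.2 hne1.symm) (sub_ne_zero.2 hne2.symm)
        (abs_le.2 ⟨by linarith [hmem.2], by linarith [hmem.1]⟩)
        (abs_le.2 ⟨by linarith [hmem.2], by linarith [hmem.1]⟩)
      rw [sub_sub_sub_cancel_right] at b
      rw [← sub_mul, norm_mul, Real.norm_eq_abs, Real.norm_eq_abs]
      have := mul_le_mul b (hN θ') (abs_nonneg _) ((abs_nonneg _).trans b)
      linarith
    · rw [intervalIntegral.integral_const_mul]
      have := mul_le_mul_of_nonneg_left (hJb θ₁ θ₁ (by simp))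
        (show 0 ≤ 48 * |θ₁ - θ₂| ^ α * N by positivity)
      have : 0 ≤ 24 * Real.pi * N * |θ₁ - θ₂| ^ α := by positivity
      linarith

theorem lipFamily_cotDiff_mul_deriv (hγ : 0 < γ) (hα0 : 0 < α) (hα : α < 1) {M : ℝ}
    (hU : ∀ X ∈ U, ‖X‖ ≤ M) (j : Fin 2) :
    LipFamily (HolderIntegral α) U (fun X θ θ' => cotDiff (θ - θ') * deriv X θ' j) := by
  obtain ⟨C, hC, hCb⟩ := exists_holderIntegral_cotDiff hα0 hα
  have key : ∀ X : HolderSpace 1 γ,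
      HolderIntegral α (fun θ θ' => cotDiff (θ - θ') * deriv X θ' j) (C * (2 * ‖X‖)) := fun X =>
    hCb _ _ ((X.isHolderDeriv hγ j).continuous_deriv hγ) (X.isHolderDeriv hγ j).bound
  refine ⟨C * (2 * (M + 1)), fun X hX => ?_⟩
  have hX0 := hU X hX
  have hM0 := (norm_nonneg X).trans hX0
  refine ⟨(key X).mono (mul_le_mul_of_nonneg_left (by linarith) hC), fun Y hY => ?_⟩
  refine HolderIntegral.mono (A := C * (2 * ‖X - Y‖)) ?_ ?_
  · refine (key (X - Y)).congr fun θ θ' _ _ => ?_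
    rw [HolderSpace.deriv_sub, PiLp.sub_apply, mul_sub]
  · rw [mul_assoc]
    refine mul_le_mul_of_nonneg_left ?_ hC
    have := mul_nonneg hM0 (norm_nonneg (X - Y))
    linarith

end LipFamily

/-! ### The remainder as a map from `C^{1,γ}` to `C^{0,α}` -/

section Remainder

variable {γ α : ℝ}

/-- The squared length of the secant slope. -/
def secantSq (X : ℝ → Plane) (θ θ' : ℝ) : ℝ :=
  secantComp 0 X θ θ' * secantComp 0 X θ θ' + secantComp 1 X θ θ' * secantComp 1 X θ θ'

theorem Plane.norm_sq (v : Plane) : ‖v‖ ^ 2 = v 0 * v 0 + v 1 * v 1 := by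
  rw [EuclideanSpace.real_norm_sq_eq, Fin.sum_univ_two]; ring

theorem Plane.inner_eq (v w : Plane) : inner ℝ v w = v 0 * w 0 + v 1 * w 1 := by
  rw [PiLp.inner_apply, Fin.sum_univ_two]
  simp only [RCLike.inner_apply, conj_trivial]
  ring

theorem Plane.norm_le (v : Plane) : ‖v‖ ≤ |v 0| + |v 1| := by
  refine abs_le_of_sq_le_sq' ?_ (by positivity) |>.2
  rw [Plane.norm_sq, add_sq, sq_abs, sq_abs]
  nlinarith [mul_nonneg (abs_nonneg (v 0)) (abs_nonneg (v 1))]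

/-- Off the diagonal this is the chord bound divided by `|θ - θ'|`; on it, the lower bound for the
derivative. -/
theorem secantSq_lower (X : HolderSpace 1 γ) (hX : 0 ≤ arcChord X) {θ θ' : ℝ}
    (h : |θ - θ'| ≤ Real.pi + 1) : (arcChord X / 3) ^ 2 ≤ secantSq X θ θ' := by
  unfold secantSq secantComp secant
  split_ifs with h1
  · have := pow_le_pow_left₀ (by positivity) (arcChord_div_three_le_norm_deriv X hX θ) 2
    rwa [Plane.norm_sq] at this
  · have hy : 0 < |θ - θ'| := abs_pos.2 (sub_ne_zero.2 (Ne.symm h1))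
    have := pow_le_pow_left₀ (by positivity) (arcChord_div_three_mul_le X hX h) 2
    rw [mul_pow, sq_abs, Plane.norm_sq] at this
    have hy2 : 0 < (θ - θ') ^ 2 := by rw [← sq_abs]; positivity
    rw [div_mul_div_comm, div_mul_div_comm, ← add_div, ← sq (θ - θ'), le_div_iff₀ hy2]
    exact this

/-- The coefficient of `secantDerivComp j` in the `i`-th component of the integrand. -/
def remainderCoeff (i j : Fin 2) (X : ℝ → Plane) (θ θ' : ℝ) : ℝ :=
  (if i = j then 1 else 0)
    - 2 * (secantComp i X θ θ' * secantComp j X θ θ' * (secantSq X θ θ')⁻¹)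
    + 2 * (secantComp i X θ θ' * (secantSq X θ θ')⁻¹ * (secantSq X θ θ')⁻¹
      * (secantComp 0 X θ θ' * (secantComp 0 X θ θ' - deriv X θ' 0)
        + secantComp 1 X θ θ' * (secantComp 1 X θ θ' - deriv X θ' 1)) * secantComp j X θ θ')
    - secantComp i X θ θ' * (secantSq X θ θ')⁻¹ * (secantComp j X θ θ' - deriv X θ' j)

/-- With `y = θ - θ'`, secant slope `d` and `p = ∂X'`, the integrand is `y⁻¹ ((2 (d·p)² / |d|⁴ -
|p|² / |d|²) d - p) - cotDiff y • p`. The bracket vanishes at `p = d`, and `p = d - y b` turns it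
into `y` times an expression linear in `b`, once the coefficients are allowed to contain `d - p`. -/
theorem remainderIntegrand_apply (X : HolderSpace 1 γ) (hX : 0 < arcChord X) {θ θ' : ℝ}
    (h : |θ - θ'| ≤ Real.pi + 1) (hne : θ ≠ θ') (i : Fin 2) :
    remainderIntegrand X θ θ' i
      = remainderCoeff i 0 X θ θ' * secantDerivComp 0 X θ θ'
        + remainderCoeff i 1 X θ θ' * secantDerivComp 1 X θ θ'
        + -(cotDiff (θ - θ') * deriv X θ' i) := by
  have hy : θ - θ' ≠ 0 := sub_ne_zero.2 hne
  have hpos := secantSq_lower X hX.le h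
  have hn : secantSq X θ θ' ≠ 0 := ((by positivity : 0 < (arcChord X / 3) ^ 2).trans_le hpos).ne'
  rw [remainderIntegrand_eq (X.hasDerivAt θ').differentiableAt
    (ne_of_abs_sub_lt_two_pi X hX hne h)]
  have hd : ∀ j, (X θ - X θ') j = (θ - θ') * secantComp j X θ θ' := fun j => by
    rw [secantComp, secant, if_neg hne.symm, mul_div_cancel₀ _ hy, PiLp.sub_apply]
  have hb : ∀ j, secantDerivComp j X θ θ' = (secantComp j X θ θ' - deriv X θ' j) / (θ - θ') :=
    fun j => rfl
  have h4 : ‖X θ - X θ'‖ ^ 4 = (‖X θ - X θ'‖ ^ 2) ^ 2 := by ring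
  have hc : 1 / 2 * Real.cot ((θ - θ') / 2) = cotDiff (θ - θ') + (θ - θ')⁻¹ := by
    rw [cotDiff]; ring
  rw [PiLp.sub_apply, PiLp.smul_apply, PiLp.smul_apply, smul_eq_mul, smul_eq_mul, h4, Plane.norm_sq, Plane.norm_sq, Plane.inner_eq, hc, hd, hd, hd, hb, hb]
  unfold remainderCoeff
  unfold secantSq at hn ⊢
  revert i
  refine Fin.forall_fin_two.2 ⟨?_, ?_⟩
  all_goals
    generalize secantComp 0 X θ θ' = d0 at *
    generalize secantComp 1 X θ θ' = d1 at *
    generalize deriv X θ' 0 = p0 at *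
    generalize deriv X θ' 1 = p1 at *
    generalize θ - θ' = y at *
    have hn' : d0 ^ 2 + d1 ^ 2 ≠ 0 := by rwa [sq, sq]
    have hn2 : d1 ^ 2 + d0 ^ 2 ≠ 0 := by rwa [add_comm]
    simp only [if_pos, zero_ne_one, one_ne_zero, if_false]
    field_simp
    ring

variable {U : Set (HolderSpace 1 γ)}

/-- The closure rules are applied along the expression defining the coefficient. The arc-chord bound
enters only through the inverse of `secantSq`. -/
theorem lipFamily_remainderCoeff (hγ : 0 < γ) (hγ₁ : γ < 1) {M m : ℝ} (hm : 0 < m)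
    (hU : ∀ X ∈ U, ‖X‖ ≤ M) (hUm : ∀ X ∈ U, m ≤ arcChord X) (i j : Fin 2) :
    LipFamily (IsKernel γ) U (fun X => remainderCoeff i j X) := by
  have d := fun j => lipFamily_secantComp hγ hγ₁ hU j
  have p := fun j => lipFamily_deriv hγ hU j
  have sq : LipFamily (IsKernel γ) U (fun X => secantSq X) :=
    ((d 0).kernel_mul (d 0)).kernel_add ((d 1).kernel_mul (d 1))
  have w : LipFamily (IsKernel γ) U (fun X θ θ' => (secantSq X θ θ')⁻¹) :=
    sq.kernel_inv (m := (m / 3) ^ 2) (by positivity) fun X hX θ θ' h => by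
      have h1 := hUm X hX
      refine le_trans ?_ (secantSq_lower X (hm.le.trans h1) h)
      exact pow_le_pow_left₀ (by positivity) (by linarith) 2
  have q := fun j => (d j).kernel_sub (p j)
  have two : LipFamily (IsKernel γ) U (fun _ _ _ => (2 : ℝ)) := LipFamily.kernel_const 2
  exact (((LipFamily.kernel_const _).kernel_sub
    (two.kernel_mul (((d i).kernel_mul (d j)).kernel_mul w))).kernel_add
    (two.kernel_mul (((((d i).kernel_mul w).kernel_mul w).kernel_mul
      (((d 0).kernel_mul (q 0)).kernel_add ((d 1).kernel_mul (q 1)))).kernel_mul (d j)))).kernel_sub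
    (((d i).kernel_mul w).kernel_mul (q j))

theorem lipFamily_remainderIntegrand (hγ : 0 < γ) (hγα : γ < α) (hα : α < 1) (hα2 : α < 2 * γ)
    {M m : ℝ} (hm : 0 < m) (hU : ∀ X ∈ U, ‖X‖ ≤ M) (hUm : ∀ X ∈ U, m ≤ arcChord X) (i : Fin 2) :
    LipFamily (HolderIntegral α) U (fun X θ θ' => remainderIntegrand X θ θ' i) := by
  have hγ₁ := hγα.trans hα
  have h := fun j => lipFamily_kernel_mul_secantDeriv hγ hγα hα hα2 hU
    (lipFamily_remainderCoeff hγ hγ₁ hm hU hUm i j) j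
  have h3 := lipFamily_cotDiff_mul_deriv hγ (hγ.trans hγα) hα hU i
  exact (((h 0).integral_add (h 1)).integral_add h3.integral_neg).integral_congr
    fun X hX θ θ' h1 h2 => (remainderIntegrand_apply X (hm.trans_le (hUm X hX)) h1 h2 i).symm

theorem plane_eq_smul_add (v : Plane) :
    v = v 0 • EuclideanSpace.single (0 : Fin 2) (1 : ℝ)
      + v 1 • EuclideanSpace.single (1 : Fin 2) (1 : ℝ) := by
  ext i
  fin_cases i <;> simp

theorem intervalIntegrable_of_apply {f : ℝ → Plane} {a b : ℝ}
    (h : ∀ i, IntervalIntegrable (fun s => f s i) volume a b) : IntervalIntegrable f volume a b := by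
  have e : f = fun s => f s 0 • EuclideanSpace.single (0 : Fin 2) (1 : ℝ)
      + f s 1 • EuclideanSpace.single (1 : Fin 2) (1 : ℝ) := funext fun s => plane_eq_smul_add (f s)
  rw [e]
  have k : ∀ i (v : Plane), IntervalIntegrable (fun s => f s i • v) volume a b := fun i v =>
    ⟨Integrable.smul_const (h i).1 v, Integrable.smul_const (h i).2 v⟩
  exact (k 0 _).add (k 1 _)

theorem intervalIntegral_apply {f : ℝ → Plane} {a b : ℝ} (h : IntervalIntegrable f volume a b)
    (i : Fin 2) : (∫ s in a..b, f s) i = ∫ s in a..b, f s i :=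
  ((EuclideanSpace.proj (𝕜 := ℝ) i).intervalIntegral_comp_comm h).symm

theorem intervalIntegrable_remainderIntegrand (hγ : 0 < γ) (hγ₁ : γ < 1) (X : HolderSpace 1 γ)
    (hX : 0 < arcChord X) {θ θ₀ : ℝ} (h : |θ - θ₀| ≤ 1) :
    IntervalIntegrable (remainderIntegrand X θ) volume (θ₀ - Real.pi) (θ₀ + Real.pi) := by
  refine intervalIntegrable_of_apply fun i => ?_
  -- Any exponent strictly between `γ` and `min(2γ, 1)` would do, as only integrability is
  -- extracted.
  obtain ⟨C, hC⟩ := lipFamily_remainderIntegrand (α := γ + min γ (1 - γ) / 2) (U := {X}) hγ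
    (by have : 0 < min γ (1 - γ) := lt_min hγ (by linarith)
        linarith) (by linarith [min_le_right γ (1 - γ)])
    (by linarith [min_le_left γ (1 - γ)]) hX
    (M := ‖X‖) (fun Y hY => by rw [mem_singleton_iff.1 hY])
    (fun Y hY => by rw [mem_singleton_iff.1 hY]) i
  exact (hC X rfl).1.integrable θ θ₀ h

theorem abs_remainder_apply_le {c A : ℝ} (hc : |c| ≤ A) : |-(1 / (4 * Real.pi)) * c| ≤ A := by
  have hπ := Real.pi_gt_three
  rw [abs_mul, abs_neg, abs_of_pos (by positivity)]
  refine le_trans ?_ hc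
  refine mul_le_of_le_one_left (abs_nonneg c) ?_
  rw [div_le_one (by positivity)]
  linarith

theorem remainder_apply (hγ : 0 < γ) (hγ₁ : γ < 1) (X : HolderSpace 1 γ) (hX : 0 < arcChord X)
    {θ θ₀ : ℝ} (h : |θ - θ₀| ≤ 1) (i : Fin 2) : remainder X θ i = -(1 / (4 * Real.pi)) *
      ∫ θ' in (θ₀ - Real.pi)..(θ₀ + Real.pi), remainderIntegrand X θ θ' i := by
  rw [remainder_eq, integral_remainderIntegrand_window X.periodic θ θ θ₀, PiLp.smul_apply,
    smul_eq_mul, intervalIntegral_apply (intervalIntegrable_remainderIntegrand hγ hγ₁ X hX h)]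

/-- On sets of curves with bounded `C^{1,γ}` norm and arc-chord quantity bounded below, the
remainder is bounded and Lipschitz with values in `C^{0,α}`, for `γ < α < min(2γ, 1)`. -/
theorem exists_remainder_bounds (hγ : 0 < γ) (hγα : γ < α) (hα : α < 1) (hα2 : α < 2 * γ)
    (M : ℝ) {m : ℝ} (hm : 0 < m) :
    ∃ C : ℝ, 0 ≤ C ∧ ∀ X : HolderSpace 1 γ, ‖X‖ ≤ M → m ≤ arcChord X →
      (∀ θ, ‖remainder X θ‖ ≤ C) ∧
      (∀ θ₁ θ₂, |θ₁ - θ₂| ≤ 1 → ‖remainder X θ₁ - remainder X θ₂‖ ≤ C * |θ₁ - θ₂| ^ α) ∧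
      ∀ Y : HolderSpace 1 γ, ‖Y‖ ≤ M → m ≤ arcChord Y →
        (∀ θ, ‖remainder X θ - remainder Y θ‖ ≤ C * ‖X - Y‖) ∧
        (∀ θ₁ θ₂, |θ₁ - θ₂| ≤ 1 → ‖(remainder X θ₁ - remainder Y θ₁)
          - (remainder X θ₂ - remainder Y θ₂)‖ ≤ C * ‖X - Y‖ * |θ₁ - θ₂| ^ α) := by
  have hγ₁ := hγα.trans hα
  set U : Set (HolderSpace 1 γ) := {X | ‖X‖ ≤ M ∧ m ≤ arcChord X} with hUdef
  have h := fun i => lipFamily_remainderIntegrand (U := U) hγ hγα hα hα2 hm (fun X hX => hX.1)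
    (fun X hX => hX.2) i
  choose C hC using h
  have hC0 : ∀ X ∈ U, ∀ i, 0 ≤ C i := fun X hX i =>
    (abs_nonneg _).trans ((hC i X hX).1.bound 0)
  -- `C i` is known to be nonnegative only once some curve belongs to `U`, hence the maximum with
  -- `0`.
  refine ⟨max (C 0) 0 + max (C 1) 0, by positivity, fun X hX hX' => ?_⟩
  have hXU : X ∈ U := ⟨hX, hX'⟩
  have hXp := hm.trans_le hX'
  rw [max_eq_left (hC0 X hXU 0), max_eq_left (hC0 X hXU 1)]
  have self : ∀ θ : ℝ, |θ - θ| ≤ 1 := fun θ => by simp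
  refine ⟨fun θ => ?_, fun θ₁ θ₂ h => ?_, fun Y hY hY' => ⟨fun θ => ?_, fun θ₁ θ₂ h => ?_⟩⟩
  · have k : ∀ i, |remainder X θ i| ≤ C i := fun i => by
      rw [remainder_apply hγ hγ₁ X hXp (self θ)]
      exact abs_remainder_apply_le ((hC i X hXU).1.bound θ)
    exact (Plane.norm_le _).trans (add_le_add (k 0) (k 1))
  · have k : ∀ i, |(remainder X θ₁ - remainder X θ₂) i| ≤ C i * |θ₁ - θ₂| ^ α := fun i => by
      rw [PiLp.sub_apply, remainder_apply hγ hγ₁ X hXp (self θ₁),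
        remainder_apply hγ hγ₁ X hXp (θ := θ₂) (θ₀ := θ₁) (by rwa [abs_sub_comm]), ← mul_sub]
      exact abs_remainder_apply_le ((hC i X hXU).1.incr θ₁ θ₂ h)
    rw [add_mul]
    exact (Plane.norm_le _).trans (add_le_add (k 0) (k 1))
  all_goals
    have hYU : Y ∈ U := ⟨hY, hY'⟩
    have hYp := hm.trans_le hY'
    have hint : ∀ (Z : HolderSpace 1 γ), Z ∈ U → ∀ i θ θ₀, |θ - θ₀| ≤ 1 → IntervalIntegrable
        (fun θ' => remainderIntegrand Z θ θ' i) volume (θ₀ - Real.pi) (θ₀ + Real.pi) :=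
      fun Z hZ i θ θ₀ h => (hC i Z hZ).1.integrable θ θ₀ h
    have e : ∀ i θ θ₀, |θ - θ₀| ≤ 1 → (remainder X θ - remainder Y θ) i = -(1 / (4 * Real.pi)) *
        ∫ θ' in (θ₀ - Real.pi)..(θ₀ + Real.pi),
          (remainderIntegrand X θ θ' i - remainderIntegrand Y θ θ' i) := fun i θ θ₀ h => by
      rw [PiLp.sub_apply, remainder_apply hγ hγ₁ X hXp h, remainder_apply hγ hγ₁ Y hYp h,
        ← mul_sub, intervalIntegral.integral_sub (hint X hXU i θ θ₀ h) (hint Y hYU i θ θ₀ h)]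
  · have k : ∀ i, |(remainder X θ - remainder Y θ) i| ≤ C i * ‖X - Y‖ := fun i => by
      rw [e i θ θ (self θ)]
      exact abs_remainder_apply_le (((hC i X hXU).2 Y hYU).bound θ)
    rw [add_mul]
    exact (Plane.norm_le _).trans (add_le_add (k 0) (k 1))
  · have k : ∀ i, |((remainder X θ₁ - remainder Y θ₁) - (remainder X θ₂ - remainder Y θ₂)) i|
        ≤ C i * ‖X - Y‖ * |θ₁ - θ₂| ^ α := fun i => by
      rw [PiLp.sub_apply, e i θ₁ θ₁ (self θ₁), e i θ₂ θ₁ (by rwa [abs_sub_comm]), ← mul_sub]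
      exact abs_remainder_apply_le (((hC i X hXU).2 Y hYU).incr θ₁ θ₂ h)
    rw [add_mul, add_mul]
    exact (Plane.norm_le _).trans (add_le_add (k 0) (k 1))

/-- The remainder as an element of `C^{0,α}`, extended by zero to degenerate curves. -/
theorem exists_remainderMap (hγ : 0 < γ) (hγα : γ < α) (hα : α < 1) (hα2 : α < 2 * γ) :
    ∃ R : HolderSpace 1 γ → HolderSpace 0 α,
      (∀ X : HolderSpace 1 γ, 0 < arcChord X → ∀ θ, R X θ = remainder X θ) ∧
      ∀ M m : ℝ, 0 < m → ∃ L : NNReal, LipschitzOnWith L R {X | ‖X‖ ≤ M ∧ m ≤ arcChord X} := by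
  have h1 : ∀ X : HolderSpace 1 γ, ∃ u : HolderSpace 0 α,
      0 < arcChord X → ∀ θ, u θ = remainder X θ := fun X => by
    by_cases hX : 0 < arcChord X
    · obtain ⟨C, hC, hCb⟩ := exists_remainder_bounds hγ hγα hα hα2 ‖X‖ hX
      obtain ⟨b1, b2, -⟩ := hCb X le_rfl le_rfl
      obtain ⟨u, hu, -⟩ := exists_holder_zero (hγ.trans hγα) (remainder_periodic X.periodic) b1
        (fun θ θ' _ h => b2 θ θ' h.le)
      exact ⟨u, fun _ => hu⟩
    · exact ⟨0, fun h => absurd h hX⟩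
  choose R hR using h1
  refine ⟨R, hR, fun M m hm => ?_⟩
  obtain ⟨C, hC, hCb⟩ := exists_remainder_bounds hγ hγα hα hα2 M hm
  -- The sup norm and the seminorm contribute `C` each.
  refine ⟨Real.toNNReal (2 * C), LipschitzOnWith.of_dist_le_mul fun X hX Y hY => ?_⟩
  obtain ⟨b1, b2⟩ := (hCb X hX.1 hX.2).2.2 Y hY.1 hY.2
  have hper : Function.Periodic (fun θ => remainder X θ - remainder Y θ) (2 * Real.pi) :=
    fun θ => by simp only [remainder_periodic X.periodic θ, remainder_periodic Y.periodic θ]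
  obtain ⟨u, hu, hun⟩ := exists_holder_zero (hγ.trans hγα) hper b1
    (fun θ θ' _ h => b2 θ θ' h.le)
  have e : R X - R Y = u := HolderSpace.ext fun θ => by
    rw [HolderSpace.coe_sub, hu, hR X (hm.trans_le hX.2), hR Y (hm.trans_le hY.2)]
  rw [dist_eq_norm, dist_eq_norm, e]
  refine hun.trans (le_of_eq ?_)
  rw [Real.coe_toNNReal _ (by positivity)]
  ring

end Remainder

/-! ### Convolution on the circle -/

section Convolution

/-- Differentiation under an interval integral with jointly continuous derivative. -/
theorem hasDerivAt_intervalIntegral_of_continuous {F F' : ℝ → ℝ → Plane}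
    (hF : ∀ θ, Continuous (F θ)) (hF' : Continuous (Function.uncurry F'))
    (hd : ∀ θ s, HasDerivAt (fun θ => F θ s) (F' θ s) θ) (a b θ : ℝ) :
    HasDerivAt (fun θ => ∫ s in a..b, F θ s) (∫ s in a..b, F' θ s) θ := by
  obtain ⟨C, hC⟩ := ((isCompact_closedBall θ 1).prod (isCompact_uIcc (a := a) (b := b))).exists_bound_of_continuousOn
    hF'.continuousOn
  refine (intervalIntegral.hasDerivAt_integral_of_dominated_loc_of_deriv_le
    (s := Metric.closedBall θ 1) (bound := fun _ => C) (Metric.closedBall_mem_nhds θ one_pos)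
    (Eventually.of_forall fun x => (hF x).aestronglyMeasurable) ((hF θ).intervalIntegrable _ _)
    ?_ ?_ intervalIntegrable_const ?_).2
  · exact (hF'.comp (by fun_prop : Continuous fun s : ℝ => (θ, s))).aestronglyMeasurable
  · exact Eventually.of_forall fun s hs x hx => hC (x, s) ⟨hx, uIoc_subset_uIcc hs⟩
  · exact Eventually.of_forall fun s _ x _ => hd x s

/-- Convolution on the circle `ℝ / 2πℤ`. -/
def conv (k : ℝ → ℝ) (u : ℝ → Plane) (θ : ℝ) : Plane :=
  (1 / (2 * Real.pi)) • ∫ y in (-Real.pi)..Real.pi, k y • u (θ - y)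

variable {k k' : ℝ → ℝ} {u u' : ℝ → Plane}

/-- One form places `θ` in the function, the other in the kernel. Accordingly a derivative can be
put on either factor. -/
theorem conv_eq (hk : Function.Periodic k (2 * Real.pi)) (hu : Function.Periodic u (2 * Real.pi))
    (θ : ℝ) : conv k u θ
      = (1 / (2 * Real.pi)) • ∫ θ' in (0 : ℝ)..(2 * Real.pi), k (θ - θ') • u θ' := by
  have hp : Function.Periodic (fun y => k y • u (θ - y)) (2 * Real.pi) := fun y => by
    simp only [hk y, ← sub_sub, hu.sub_eq]
  have h1 := hp.intervalIntegral_add_eq (-Real.pi) (θ - 2 * Real.pi)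
  have h2 := intervalIntegral.integral_comp_sub_left (a := 0) (b := 2 * Real.pi)
    (fun y => k y • u (θ - y)) θ
  simp only [sub_sub_cancel, sub_zero] at h2
  rw [conv, h2]
  rw [show -Real.pi + 2 * Real.pi = Real.pi by ring, sub_add_cancel] at h1
  rw [h1]

theorem hasDerivAt_conv_left (hk : ∀ y, HasDerivAt k (k' y) y) (hk' : Continuous k')
    (hkp : Function.Periodic k (2 * Real.pi)) (hkp' : Function.Periodic k' (2 * Real.pi))
    (hu : Continuous u) (hup : Function.Periodic u (2 * Real.pi)) (θ : ℝ) :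
    HasDerivAt (conv k u) (conv k' u θ) θ := by
  have hkc : Continuous k := continuous_iff_continuousAt.2 fun y => (hk y).continuousAt
  rw [conv_eq hkp' hup, funext (conv_eq hkp hup)]
  refine HasDerivAt.const_smul (1 / (2 * Real.pi)) (hasDerivAt_intervalIntegral_of_continuous
    (F := fun θ θ' => k (θ - θ') • u θ') (F' := fun θ θ' => k' (θ - θ') • u θ')
    (fun θ => by fun_prop) (by unfold Function.uncurry; fun_prop) (fun θ s => ?_) _ _ θ)
  have h1 : HasDerivAt (fun θ => k (θ - s)) (k' (θ - s)) θ := (hk (θ - s)).comp_sub_const θ s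
  exact h1.smul_const (u s)

theorem hasDerivAt_conv_right (hk : Continuous k) (hu : ∀ θ, HasDerivAt u (u' θ) θ)
    (hu' : Continuous u') (θ : ℝ) : HasDerivAt (conv k u) (conv k u' θ) θ := by
  have huc : Continuous u := continuous_iff_continuousAt.2 fun y => (hu y).continuousAt
  refine HasDerivAt.const_smul (1 / (2 * Real.pi)) (hasDerivAt_intervalIntegral_of_continuous
    (F := fun θ y => k y • u (θ - y)) (F' := fun θ y => k y • u' (θ - y))
    (fun θ => by fun_prop) (by unfold Function.uncurry; fun_prop) (fun θ s => ?_) _ _ θ)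
  have h1 : HasDerivAt (fun θ => u (θ - s)) (u' (θ - s)) θ := (hu (θ - s)).comp_sub_const θ s
  exact h1.const_smul (k s)

theorem conv_periodic (hu : Function.Periodic u (2 * Real.pi)) :
    Function.Periodic (conv k u) (2 * Real.pi) := fun θ => by
  simp only [conv, add_sub_right_comm, hu _]

theorem norm_conv_le (hk : Continuous k) {A : ℝ} (hu : ∀ θ, ‖u θ‖ ≤ A) (θ : ℝ) :
    ‖conv k u θ‖ ≤ (1 / (2 * Real.pi) * ∫ y in (-Real.pi)..Real.pi, |k y|) * A := by
  have hπ := Real.pi_pos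
  rw [conv, norm_smul, Real.norm_of_nonneg (by positivity), mul_assoc,
    ← intervalIntegral.integral_mul_const]
  refine mul_le_mul_of_nonneg_left ?_ (by positivity)
  refine intervalIntegral.norm_integral_le_of_norm_le (by linarith) ?_
    ((by fun_prop : Continuous fun y => |k y| * A).intervalIntegrable _ _)
  refine Eventually.of_forall fun y _ => ?_
  rw [norm_smul, Real.norm_eq_abs]
  exact mul_le_mul_of_nonneg_left (hu _) (abs_nonneg _)

theorem conv_sub_left {l : ℝ → ℝ} (hk : Continuous k) (hl : Continuous l) (hu : Continuous u)
    (θ : ℝ) : conv (fun y => k y - l y) u θ = conv k u θ - conv l u θ := by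
  simp only [conv]
  rw [← smul_sub, ← intervalIntegral.integral_sub]
  · simp only [sub_smul]
  all_goals exact Continuous.intervalIntegrable (by fun_prop) _ _

theorem conv_add_right {v : ℝ → Plane} (hk : Continuous k) (hu : Continuous u) (hv : Continuous v)
    (θ : ℝ) : conv k (fun θ => u θ + v θ) θ = conv k u θ + conv k v θ := by
  simp only [conv]
  rw [← smul_add, ← intervalIntegral.integral_add]
  · simp only [smul_add]
  all_goals exact Continuous.intervalIntegrable (by fun_prop) _ _

theorem conv_smul_right (c : ℝ) (θ : ℝ) :
    conv k (fun θ => c • u θ) θ = c • conv k u θ := by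
  simp only [conv, smul_comm _ c, intervalIntegral.integral_smul]

theorem conv_sub_right {v : ℝ → Plane} (hk : Continuous k) (hu : Continuous u) (hv : Continuous v)
    (θ : ℝ) : conv k (fun θ => u θ - v θ) θ = conv k u θ - conv k v θ := by
  simp only [conv]
  rw [← smul_sub, ← intervalIntegral.integral_sub]
  · simp only [smul_sub]
  all_goals exact Continuous.intervalIntegrable (by fun_prop) _ _

theorem conv_const_right (v : Plane) (θ : ℝ) :
    conv k (fun _ => v) θ = (1 / (2 * Real.pi) * ∫ y in (-Real.pi)..Real.pi, k y) • v := by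
  rw [conv, intervalIntegral.integral_smul_const, smul_smul]

/-- Derivatives of the Poisson kernel thus have mean zero, so `u θ` may be subtracted from `u`
inside the convolution to gain a power of `|y|`. -/
theorem integral_deriv_periodic_eq_zero (hk : ∀ y, HasDerivAt k (k' y) y) (hk' : Continuous k')
    (hkp : Function.Periodic k (2 * Real.pi)) : ∫ y in (-Real.pi)..Real.pi, k' y = 0 := by
  rw [intervalIntegral.integral_eq_sub_of_hasDerivAt (fun y _ => hk y)
    (hk'.intervalIntegrable _ _), sub_eq_zero, ← hkp (-Real.pi)]
  congr 1; ring

/-- Estimate of a convolution minus a multiple of the function by weighted `L¹` norms of the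
kernel. -/
theorem norm_conv_sub_le (hk : Continuous k) (hu : Continuous u) {g : ℝ → ℝ}
    (hg : IntervalIntegrable g volume (-Real.pi) Real.pi)
    {θ : ℝ} (h : ∀ y, y ≠ 0 → |y| ≤ Real.pi → |k y| * ‖u (θ - y) - u θ‖ ≤ g y) :
    ‖conv k u θ - (1 / (2 * Real.pi) * ∫ y in (-Real.pi)..Real.pi, k y) • u θ‖
      ≤ ∫ y in (-Real.pi)..Real.pi, g y := by
  have hπ := Real.pi_gt_three
  rw [← conv_const_right (u θ) θ, conv, conv, ← smul_sub, ← intervalIntegral.integral_sub, norm_smul,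
    Real.norm_of_nonneg (by positivity)]
  · have h1 : ‖∫ y in (-Real.pi)..Real.pi, (k y • u (θ - y) - k y • u θ)‖
        ≤ ∫ y in (-Real.pi)..Real.pi, g y := by
      refine intervalIntegral.norm_integral_le_of_norm_le (by linarith) ?_ hg
      have h0 : ∀ᵐ y : ℝ, y ≠ 0 := by simp [ae_iff, measure_singleton]
      filter_upwards [h0] with y hy hmem
      rw [← smul_sub, norm_smul, Real.norm_eq_abs]
      exact h y hy (abs_le.2 ⟨by linarith [hmem.1], hmem.2⟩)
    refine (mul_le_of_le_one_left (norm_nonneg _) ?_).trans h1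
    rw [div_le_one (by positivity)]
    linarith
  all_goals exact Continuous.intervalIntegrable (by fun_prop) _ _

end Convolution

/-! ### The Poisson kernel -/

section Poisson

variable {r : ℝ}

/-- The denominator of the Poisson kernel. -/
def poissonDenom (r y : ℝ) : ℝ := 1 - 2 * r * Real.cos y + r ^ 2

/-- The first derivative of the Poisson kernel. -/
def poissonDeriv (r y : ℝ) : ℝ :=
  -((1 - r ^ 2) * (2 * r * Real.sin y)) / poissonDenom r y ^ 2

/-- The second derivative of the Poisson kernel. -/
def poissonDerivTwo (r y : ℝ) : ℝ :=
  -((1 - r ^ 2) * (2 * r * Real.cos y)) / poissonDenom r y ^ 2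
    + 2 * (1 - r ^ 2) * (2 * r * Real.sin y) ^ 2 / poissonDenom r y ^ 3

theorem poissonDenom_eq (r y : ℝ) :
    poissonDenom r y = (1 - r) ^ 2 + 2 * r * (1 - Real.cos y) := by
  unfold poissonDenom; ring

theorem sq_le_poissonDenom (h0 : 0 ≤ r) (y : ℝ) : (1 - r) ^ 2 ≤ poissonDenom r y := by
  rw [poissonDenom_eq]
  nlinarith [Real.cos_le_one y]

theorem poissonDenom_pos (h0 : 0 ≤ r) (h1 : r < 1) (y : ℝ) : 0 < poissonDenom r y :=
  (pow_pos (by linarith) 2).trans_le (sq_le_poissonDenom h0 y)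

theorem hasDerivAt_poissonDenom (r y : ℝ) :
    HasDerivAt (poissonDenom r) (2 * r * Real.sin y) y := by
  have := (((Real.hasDerivAt_cos y).const_mul (2 * r)).const_sub 1).add_const (r ^ 2)
  refine this.congr_deriv ?_
  ring

theorem hasDerivAt_poisson (h0 : 0 ≤ r) (h1 : r < 1) (y : ℝ) :
    HasDerivAt (poisson r) (poissonDeriv r y) y := by
  have h := (hasDerivAt_const y (1 - r ^ 2)).div (hasDerivAt_poissonDenom r y)
    (poissonDenom_pos h0 h1 y).ne'
  refine h.congr_deriv ?_
  rw [poissonDeriv]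
  ring

theorem hasDerivAt_poissonDeriv (h0 : 0 ≤ r) (h1 : r < 1) (y : ℝ) :
    HasDerivAt (poissonDeriv r) (poissonDerivTwo r y) y := by
  have hD := (poissonDenom_pos h0 h1 y).ne'
  have h2 := (((Real.hasDerivAt_sin y).const_mul (2 * r)).const_mul (1 - r ^ 2)).neg
  have h := h2.div ((hasDerivAt_poissonDenom r y).pow 2) (pow_ne_zero 2 hD)
  refine h.congr_deriv ?_
  rw [poissonDerivTwo]
  simp only [Pi.pow_apply, Pi.neg_apply]
  field_simp
  ring

theorem continuous_poissonDerivTwo (h0 : 0 ≤ r) (h1 : r < 1) : Continuous (poissonDerivTwo r) := by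
  have hD : ∀ y, poissonDenom r y ≠ 0 := fun y => (poissonDenom_pos h0 h1 y).ne'
  have hc : Continuous (poissonDenom r) := by unfold poissonDenom; fun_prop
  unfold poissonDerivTwo
  exact (Continuous.div (by fun_prop) (by fun_prop) fun y => pow_ne_zero 2 (hD y)).add
    (Continuous.div (by fun_prop) (by fun_prop) fun y => pow_ne_zero 3 (hD y))

theorem continuous_poisson (h0 : 0 ≤ r) (h1 : r < 1) : Continuous (poisson r) :=
  continuous_iff_continuousAt.2 fun y => (hasDerivAt_poisson h0 h1 y).continuousAt

theorem poisson_periodic (r : ℝ) : Function.Periodic (poisson r) (2 * Real.pi) := fun y => by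
  simp only [poisson, Real.cos_add_two_pi]

theorem poissonDeriv_periodic (r : ℝ) : Function.Periodic (poissonDeriv r) (2 * Real.pi) :=
  fun y => by simp only [poissonDeriv, poissonDenom, Real.cos_add_two_pi, Real.sin_add_two_pi]

theorem poissonDerivTwo_periodic (r : ℝ) : Function.Periodic (poissonDerivTwo r) (2 * Real.pi) :=
  fun y => by simp only [poissonDerivTwo, poissonDenom, Real.cos_add_two_pi, Real.sin_add_two_pi]

theorem poisson_nonneg (h0 : 0 ≤ r) (h1 : r < 1) (y : ℝ) : 0 ≤ poisson r y :=
  div_nonneg (by nlinarith) (poissonDenom_pos h0 h1 y).le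

theorem poisson_neg (r y : ℝ) : poisson r (-y) = poisson r y := by
  simp only [poisson, Real.cos_neg]

theorem integral_cos_nat_mul {n : ℕ} (hn : n ≠ 0) :
    ∫ y in (-Real.pi)..Real.pi, Real.cos (n * y) = 0 := by
  have hn' : (n : ℝ) ≠ 0 := Nat.cast_ne_zero.2 hn
  rw [intervalIntegral.integral_comp_mul_left Real.cos hn', integral_cos, mul_neg, Real.sin_neg,
    Real.sin_nat_mul_pi]
  simp

/-- The Fourier coefficients of the Poisson kernel. -/
theorem integral_poisson_mul_cos (h0 : 0 < r) (h1 : r < 1) (n : ℕ) :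
    ∫ y in (-Real.pi)..Real.pi, poisson r y * Real.cos (n * y) = 2 * Real.pi * r ^ n := by
  have hπ := Real.pi_pos
  have hPc := continuous_poisson h0.le h1
  set c : ℕ → ℝ := fun n => ∫ y in (-Real.pi)..Real.pi, poisson r y * Real.cos (n * y) with hc
  have hint : ∀ n : ℕ, IntervalIntegrable (fun y => poisson r y * Real.cos (n * y)) volume
      (-Real.pi) Real.pi := fun n => Continuous.intervalIntegrable (by fun_prop) _ _
  have hDP : ∀ y, (1 + r ^ 2) * poisson r y - 2 * r * (Real.cos y * poisson r y) = 1 - r ^ 2 := by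
    intro y
    have hD := (poissonDenom_pos h0.le h1 y).ne'
    unfold poissonDenom at hD
    have : poisson r y * (1 - 2 * r * Real.cos y + r ^ 2) = 1 - r ^ 2 := div_mul_cancel₀ _ hD
    linear_combination this
  -- Multiplying the kernel by its denominator gives a constant, hence a three-term recursion with
  -- characteristic roots `r` and `1 / r`.
  have hrec : ∀ n : ℕ, (1 + r ^ 2) * c (n + 1) - r * (c (n + 2) + c n) = 0 := by
    intro n
    rw [← intervalIntegral.integral_const_mul, ← intervalIntegral.integral_add (hint _) (hint _),
      ← intervalIntegral.integral_const_mul, ← intervalIntegral.integral_sub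
        ((hint _).const_mul _) (((hint _).add (hint _)).const_mul _)]
    have : ∀ y, (1 + r ^ 2) * (poisson r y * Real.cos ((n + 1 : ℕ) * y))
        - r * (poisson r y * Real.cos ((n + 2 : ℕ) * y) + poisson r y * Real.cos (n * y))
        = (1 - r ^ 2) * Real.cos ((n + 1 : ℕ) * y) := fun y => by
      have e1 : ((n + 2 : ℕ) : ℝ) * y = ((n + 1 : ℕ) : ℝ) * y + y := by push_cast; ring
      have e2 : (n : ℝ) * y = ((n + 1 : ℕ) : ℝ) * y - y := by push_cast; ring
      rw [e1, e2, Real.cos_add, Real.cos_sub, ← hDP y]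
      ring
    simp only [this, intervalIntegral.integral_const_mul, integral_cos_nat_mul (Nat.succ_ne_zero n),
      mul_zero]
  have hzero : (1 + r ^ 2) * c 0 - 2 * r * c 1 = 2 * Real.pi * (1 - r ^ 2) := by
    rw [← intervalIntegral.integral_const_mul, ← intervalIntegral.integral_const_mul,
      ← intervalIntegral.integral_sub ((hint _).const_mul _) ((hint _).const_mul _)]
    have : ∀ y, (1 + r ^ 2) * (poisson r y * Real.cos ((0 : ℕ) * y))
        - 2 * r * (poisson r y * Real.cos ((1 : ℕ) * y)) = 1 - r ^ 2 := fun y => by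
      rw [← hDP y]
      simp only [Nat.cast_zero, zero_mul, Real.cos_zero, Nat.cast_one, one_mul]
      ring
    simp only [this, intervalIntegral.integral_const, smul_eq_mul]
    ring
  have hbd : ∀ n, |c n| ≤ c 0 := fun n => by
    rw [hc, ← Real.norm_eq_abs]
    refine intervalIntegral.norm_integral_le_of_norm_le (by linarith)
      (Eventually.of_forall fun y _ => ?_) (hint 0)
    rw [norm_mul, Real.norm_of_nonneg (poisson_nonneg h0.le h1 y), Nat.cast_zero, zero_mul,
      Real.cos_zero]
    exact mul_le_mul_of_nonneg_left (Real.abs_cos_le_one _) (poisson_nonneg h0.le h1 y)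
  -- `c (n + 1) - r * c n` grows like `r ^ (-n)` unless it vanishes. The coefficients are bounded by
  -- `c 0`, so the root `1 / r` is excluded.
  have he : ∀ n, c 1 - r * c 0 = r ^ n * (c (n + 1) - r * c n) := fun n => by
    induction n with
    | zero => simp
    | succ n ih =>
      rw [ih, pow_succ]
      linear_combination (r ^ n) * hrec n
  have he0 : c 1 - r * c 0 = 0 := by
    have h2 : Tendsto (fun n : ℕ => r ^ n * (2 * c 0)) atTop (𝓝 (0 * (2 * c 0))) :=
      (tendsto_pow_atTop_nhds_zero_of_lt_one h0.le h1).mul_const _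
    rw [zero_mul] at h2
    have h3 : |c 1 - r * c 0| ≤ 0 := by
      refine ge_of_tendsto h2 (Eventually.of_forall fun n => ?_)
      rw [he n, abs_mul, abs_of_pos (pow_pos h0 n)]
      refine mul_le_mul_of_nonneg_left ?_ (by positivity)
      refine (abs_sub _ _).trans ?_
      rw [abs_mul, abs_of_pos h0]
      have a1 := hbd (n + 1)
      have a2 := hbd n
      have a3 : r * |c n| ≤ 1 * |c n| := mul_le_mul_of_nonneg_right h1.le (abs_nonneg _)
      linarith
    exact abs_nonpos_iff.1 h3
  have hc0 : c 0 = 2 * Real.pi := by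
    have h2 : (1 - r ^ 2) * (c 0 - 2 * Real.pi) = 0 := by linear_combination hzero + 2 * r * he0
    have h3 : 1 - r ^ 2 ≠ 0 := by nlinarith
    linarith [(mul_eq_zero.1 h2).resolve_left h3]
  change c n = _
  induction n with
  | zero => rw [hc0]; ring
  | succ n ih =>
    have h2 := he n
    rw [he0] at h2
    have h3 := (mul_eq_zero.1 h2.symm).resolve_left (pow_pos h0 n).ne'
    rw [pow_succ]
    linear_combination h3 + r * ih

theorem integral_poisson (h0 : 0 < r) (h1 : r < 1) :
    ∫ y in (-Real.pi)..Real.pi, poisson r y = 2 * Real.pi := by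
  simpa using integral_poisson_mul_cos h0 h1 0

/-- Everything is measured against `√D`: both `1 - r ^ 2` and `|2 r sin y|` are at most `2 √D`. -/
theorem abs_poissonDeriv_le (h0 : 0 ≤ r) (h1 : r < 1) (y : ℝ) :
    |poissonDeriv r y| ≤ 4 / poissonDenom r y ∧
      |poissonDerivTwo r y| ≤ 20 / (poissonDenom r y * √(poissonDenom r y)) := by
  have hD := poissonDenom_pos h0 h1 y
  set D := poissonDenom r y with hDdef
  have hs : 0 < √D := Real.sqrt_pos.2 hD
  have hsq : √D * √D = D := Real.mul_self_sqrt hD.le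
  have b1 : 1 - r ^ 2 ≤ 2 * √D := by
    have : 1 - r ≤ √D := Real.le_sqrt_of_sq_le (sq_le_poissonDenom h0 y)
    nlinarith
  have b0 : 0 ≤ 1 - r ^ 2 := by nlinarith
  have b2 : (2 * r * Real.sin y) ^ 2 ≤ 4 * D := by
    have h2 := Real.sin_sq_add_cos_sq y
    have h3 := Real.cos_le_one y
    have h4 := Real.neg_one_le_cos y
    rw [hDdef, poissonDenom_eq]
    have h5 : Real.sin y ^ 2 ≤ 2 * (1 - Real.cos y) := by nlinarith
    have h6 : r ^ 2 * Real.sin y ^ 2 ≤ r * (2 * (1 - Real.cos y)) :=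
      mul_le_mul (by nlinarith) h5 (by positivity) h0
    nlinarith [sq_nonneg (1 - r)]
  have b3 : |2 * r * Real.sin y| ≤ 2 * √D := by
    refine abs_le_of_sq_le_sq ?_ (by positivity)
    rw [mul_pow 2 (√D), Real.sq_sqrt hD.le]
    linarith
  have b4 : |2 * r * Real.cos y| ≤ 2 := by
    rw [abs_mul, abs_of_nonneg (by positivity)]
    have := mul_le_mul (show 2 * r ≤ 2 by linarith) (Real.abs_cos_le_one y) (abs_nonneg _)
      (by norm_num)
    linarith
  constructor
  · rw [poissonDeriv, abs_div, abs_neg, abs_mul, abs_of_nonneg b0, abs_of_pos (pow_pos hD 2),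
      div_le_div_iff₀ (pow_pos hD 2) hD]
    have := mul_le_mul b1 b3 (abs_nonneg _) (by positivity)
    have := mul_le_mul_of_nonneg_right this hD.le
    nlinarith
  · rw [poissonDerivTwo]
    refine (abs_add_le _ _).trans ?_
    have c1 : |-((1 - r ^ 2) * (2 * r * Real.cos y)) / D ^ 2| ≤ 4 / (D * √D) := by
      rw [abs_div, abs_neg, abs_mul, abs_of_nonneg b0, abs_of_pos (pow_pos hD 2),
        div_le_div_iff₀ (pow_pos hD 2) (by positivity)]
      have := mul_le_mul b1 b4 (abs_nonneg _) (by positivity)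
      calc _ ≤ (2 * √D * 2) * (D * √D) := mul_le_mul_of_nonneg_right this (by positivity)
        _ = 4 * D * (√D * √D) := by ring
        _ = _ := by rw [hsq]; ring
    have c2 : |2 * (1 - r ^ 2) * (2 * r * Real.sin y) ^ 2 / D ^ 3| ≤ 16 / (D * √D) := by
      rw [abs_div, abs_of_nonneg (by positivity), abs_of_pos (pow_pos hD 3),
        div_le_div_iff₀ (pow_pos hD 3) (by positivity)]
      have := mul_le_mul (mul_le_mul_of_nonneg_left b1 (zero_le_two)) b2 (by positivity)
        (by positivity)
      calc _ ≤ (2 * (2 * √D) * (4 * D)) * (D * √D) :=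
            mul_le_mul_of_nonneg_right this (by positivity)
        _ = 16 * D ^ 2 * (√D * √D) := by ring
        _ = _ := by rw [hsq]; ring
    refine (add_le_add c1 c2).trans (le_of_eq ?_)
    rw [← add_div]
    norm_num

/-- The lower bound for the denominator in terms of time. -/
theorem poissonDenom_lower {T t y : ℝ} (ht : 0 < t) (htT : t ≤ T) (hy : |y| ≤ Real.pi) :
    Real.exp (-T / 2) / 16 * (t ^ 2 + y ^ 2) ≤ poissonDenom (Real.exp (-t / 4)) y := by
  have hπ := Real.pi_gt_three
  have hπ4 := Real.pi_le_four
  set r := Real.exp (-t / 4) with hr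
  set q := Real.exp (-T / 4) with hq
  have hq0 : 0 < q := Real.exp_pos _
  have hrq : q ≤ r := Real.exp_le_exp.2 (by linarith)
  have hq1 : q ≤ 1 := Real.exp_le_one_iff.2 (by linarith)
  have hqq : Real.exp (-T / 2) = q ^ 2 := by rw [hq, ← Real.exp_nat_mul]; congr 1; push_cast; ring
  have h1 : t / 4 * q ≤ 1 - r := by
    have h2 := Real.add_one_le_exp (t / 4)
    have h3 : Real.exp (t / 4) * r = 1 := by rw [hr, ← Real.exp_add]; simp; ring
    have h4 : t / 4 * r ≤ 1 - r := by
      have := mul_le_mul_of_nonneg_right h2 (Real.exp_pos (-t / 4)).le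
      rw [← hr, h3] at this
      linarith
    exact (mul_le_mul_of_nonneg_left hrq (by positivity)).trans h4
  have h5 := pow_le_pow_left₀ (by positivity) h1 2
  have h6 := Real.cos_le_one_sub_mul_cos_sq hy
  have h7 : (1 : ℝ) / 8 ≤ 2 / Real.pi ^ 2 := by
    rw [div_le_div_iff₀ (by norm_num) (by positivity)]
    nlinarith
  have h8 : 1 / 8 * y ^ 2 ≤ 1 - Real.cos y := by
    have := mul_le_mul_of_nonneg_right h7 (sq_nonneg y)
    linarith
  rw [poissonDenom_eq, hqq]
  have h9 : 2 * q * (1 / 8 * y ^ 2) ≤ 2 * r * (1 - Real.cos y) :=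
    mul_le_mul (by linarith) h8 (by positivity) (by positivity)
  have h10 : q ^ 2 * y ^ 2 ≤ q * y ^ 2 := mul_le_mul_of_nonneg_right (by nlinarith) (sq_nonneg y)
  have h11 : 0 ≤ q * y ^ 2 := by positivity
  linarith

/-- Interpolates between decay in time and in space. The free exponent `a` is later tuned to make
both singularities integrable. -/
theorem rpow_mul_rpow_le_sq_add_sq {a t y : ℝ} (ha0 : 0 ≤ a) (ha2 : a ≤ 2) (ht : 0 < t)
    (hy : 0 < y) : t ^ a * y ^ (2 - a) ≤ t ^ 2 + y ^ 2 := by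
  rcases le_total t y with h | h
  · have h1 : t ^ a ≤ y ^ a := Real.rpow_le_rpow ht.le h ha0
    calc _ ≤ y ^ a * y ^ (2 - a) := mul_le_mul_of_nonneg_right h1 (by positivity)
      _ = y ^ 2 := by rw [← Real.rpow_add hy]; norm_num
      _ ≤ _ := by nlinarith
  · have h1 : y ^ (2 - a) ≤ t ^ (2 - a) := Real.rpow_le_rpow hy.le h (by linarith)
    calc _ ≤ t ^ a * t ^ (2 - a) := mul_le_mul_of_nonneg_left h1 (by positivity)
      _ = t ^ 2 := by rw [← Real.rpow_add ht]; norm_num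
      _ ≤ _ := by nlinarith

theorem exp_neg_div_four_lt_one {t : ℝ} (ht : 0 < t) : Real.exp (-t / 4) < 1 :=
  Real.exp_lt_one_iff.2 (by linarith)

/-- Weighted pointwise bounds for the Poisson kernel and its derivatives, up to time `T`. -/
theorem exists_poisson_bounds (T : ℝ) {a : ℝ} (ha0 : 0 ≤ a) (ha2 : a ≤ 2) :
    ∃ K : ℝ, 0 ≤ K ∧ ∀ t y : ℝ, 0 < t → t ≤ T → y ≠ 0 → |y| ≤ Real.pi →
      poisson (Real.exp (-t / 4)) y ≤ K * (t * t ^ (-a)) * |y| ^ (a - 2) ∧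
      |poissonDeriv (Real.exp (-t / 4)) y| ≤ K * t ^ (-a) * |y| ^ (a - 2) ∧
      |poissonDerivTwo (Real.exp (-t / 4)) y| ≤ K * (t ^ (-a) / t) * |y| ^ (a - 2) := by
  set c := Real.exp (-T / 2) / 16 with hc
  have hc0 : 0 < c := by positivity
  refine ⟨1 / c + 4 / c + 20 / (c * √c), by positivity, fun t y ht htT hy hyπ => ?_⟩
  have hy0 : 0 < |y| := abs_pos.2 hy
  have hr0 : 0 ≤ Real.exp (-t / 4) := (Real.exp_pos _).le
  have hr1 := exp_neg_div_four_lt_one ht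
  have hD := poissonDenom_pos hr0 hr1 y
  have hlow := poissonDenom_lower ht htT hyπ
  rw [← hc] at hlow
  have hlow2 := rpow_mul_rpow_le_sq_add_sq ha0 ha2 ht hy0
  rw [sq_abs] at hlow2
  obtain ⟨b1, b2⟩ := abs_poissonDeriv_le hr0 hr1 y
  set D := poissonDenom (Real.exp (-t / 4)) y with hDdef
  have hE : (t ^ a * |y| ^ (2 - a))⁻¹ = t ^ (-a) * |y| ^ (a - 2) := by
    rw [mul_inv, Real.rpow_neg ht.le, ← Real.rpow_neg hy0.le, neg_sub]
  have hEpos : 0 < t ^ a * |y| ^ (2 - a) := by positivity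
  have hDinv : D⁻¹ ≤ 1 / c * (t ^ (-a) * |y| ^ (a - 2)) := by
    rw [← hE, one_div, ← mul_inv]
    exact inv_anti₀ (by positivity) ((mul_le_mul_of_nonneg_left hlow2 hc0.le).trans hlow)
  -- The additional factor `(√D)⁻¹` in the second derivative is spent entirely on a power of time.
  have hsD : √c * t ≤ √D := by
    refine Real.le_sqrt_of_sq_le ?_
    rw [mul_pow, Real.sq_sqrt hc0.le]
    have : 0 ≤ c * y ^ 2 := by positivity
    linarith
  have hsc : 0 < √c := Real.sqrt_pos.2 hc0
  have hsDinv : (√D)⁻¹ ≤ 1 / √c * t⁻¹ := by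
    rw [one_div, ← mul_inv]
    exact inv_anti₀ (by positivity) hsD
  set Z := t ^ (-a) * |y| ^ (a - 2) with hZ
  have hZ0 : 0 ≤ Z := by positivity
  have p1 : 0 ≤ 1 / c := by positivity
  have p2 : 0 ≤ 4 / c := by positivity
  have p3 : 0 ≤ 20 / (c * √c) := by positivity
  refine ⟨?_, ?_, ?_⟩
  · have h2 : 1 - Real.exp (-t / 4) ^ 2 ≤ t := by
      rw [← Real.exp_nat_mul]
      have := Real.add_one_le_exp ((2 : ℕ) * (-t / 4))
      push_cast at this ⊢
      linarith
    calc poisson (Real.exp (-t / 4)) y = (1 - Real.exp (-t / 4) ^ 2) * D⁻¹ := div_eq_mul_inv _ _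
      _ ≤ t * (1 / c * Z) := mul_le_mul h2 hDinv (by positivity) ht.le
      _ = 1 / c * (t * Z) := by ring
      _ ≤ (1 / c + 4 / c + 20 / (c * √c)) * (t * Z) :=
        mul_le_mul_of_nonneg_right (by linarith) (by positivity)
      _ = _ := by rw [hZ]; ring
  · calc _ ≤ 4 / D := b1
      _ = 4 * D⁻¹ := div_eq_mul_inv _ _
      _ ≤ 4 * (1 / c * Z) := mul_le_mul_of_nonneg_left hDinv (by norm_num)
      _ = 4 / c * Z := by ring
      _ ≤ (1 / c + 4 / c + 20 / (c * √c)) * Z := mul_le_mul_of_nonneg_right (by linarith) hZ0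
      _ = _ := by rw [hZ]; ring
  · calc _ ≤ 20 / (D * √D) := b2
      _ = 20 * (D⁻¹ * (√D)⁻¹) := by rw [div_eq_mul_inv, mul_inv]
      _ ≤ 20 * ((1 / c * Z) * (1 / √c * t⁻¹)) := by
        refine mul_le_mul_of_nonneg_left ?_ (by norm_num)
        exact mul_le_mul hDinv hsDinv (by positivity) (by positivity)
      _ = 20 / (c * √c) * (Z * t⁻¹) := by field_simp
      _ ≤ (1 / c + 4 / c + 20 / (c * √c)) * (Z * t⁻¹) :=
        mul_le_mul_of_nonneg_right (by linarith) (by positivity)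
      _ = _ := by rw [hZ]; ring

end Poisson

/-! ### Linear maps between Hölder spaces -/

section LinearMaps

variable {k : ℕ} {γ α : ℝ}

/-- A linear operation on functions which is bounded into a Hölder space is given by a continuous
linear map. -/
theorem exists_clm_of_pointwise {E : Type*} [NormedAddCommGroup E] [NormedSpace ℝ E]
    (f : E → ℝ → Plane) (C : ℝ)
    (hadd : ∀ u v θ, f (u + v) θ = f u θ + f v θ) (hsmul : ∀ (c : ℝ) u θ, f (c • u) θ = c • f u θ)
    (h : ∀ u, ∃ v : HolderSpace k γ, (∀ θ, v θ = f u θ) ∧ ‖v‖ ≤ C * ‖u‖) :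
    ∃ L : E →L[ℝ] HolderSpace k γ, (∀ u θ, L u θ = f u θ) ∧ ∀ u, ‖L u‖ ≤ C * ‖u‖ := by
  choose g hg hgb using h
  let L : E →ₗ[ℝ] HolderSpace k γ :=
    { toFun := g
      map_add' := fun u v => HolderSpace.ext fun θ => by
        rw [HolderSpace.coe_add, hg, hg, hg, hadd]
      map_smul' := fun c u => HolderSpace.ext fun θ => by
        rw [RingHom.id_apply, HolderSpace.coe_smul, hg, hg, hsmul] }
  exact ⟨L.mkContinuous C hgb, hg, hgb⟩

theorem HolderSpace.norm_one_le {u : HolderSpace 1 γ} {f' : ℝ → Plane} {A B C : ℝ} (hγ : 0 < γ)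
    (hd : ∀ θ, HasDerivAt u (f' θ) θ) (hA : ∀ θ, ‖u θ‖ ≤ A) (hB : ∀ θ, ‖f' θ‖ ≤ B)
    (hC : ∀ θ θ', θ ≠ θ' → |θ - θ'| < 1 → ‖f' θ - f' θ'‖ ≤ C * |θ - θ'| ^ γ) :
    ‖u‖ ≤ A + B + C := by
  obtain ⟨v, hv, hvn⟩ := exists_holder_one hγ u.periodic hd hA hB hC
  rwa [show u = v from HolderSpace.ext fun θ => (hv θ).symm]

theorem norm_sub_le_of_hasDerivAt_le {f f' : ℝ → Plane} {C : ℝ} (hd : ∀ θ, HasDerivAt f (f' θ) θ)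
    (hC : ∀ θ, ‖f' θ‖ ≤ C) (θ θ' : ℝ) : ‖f θ - f θ'‖ ≤ C * |θ - θ'| := by
  have := Convex.norm_image_sub_le_of_norm_hasDerivWithin_le (s := Set.univ)
    (fun x _ => (hd x).hasDerivWithinAt) (fun x _ => hC x) convex_univ (mem_univ θ') (mem_univ θ)
  rwa [Real.norm_eq_abs] at this

theorem abs_le_rpow_of_lt_one {x : ℝ} (hx : |x| < 1) (hγ1 : γ ≤ 1) :
    |x| ≤ |x| ^ γ := by
  rcases eq_or_ne x 0 with rfl | h0
  · rw [abs_zero]; positivity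
  · simpa using Real.rpow_le_rpow_of_exponent_ge (abs_pos.2 h0) hx.le hγ1

/-- The inclusion `C^{1,γ} ⊂ C^{0,α}`. -/
theorem exists_inclusion_one_zero (γ : ℝ) (hα : 0 < α) (hα1 : α ≤ 1) :
    ∃ L : HolderSpace 1 γ →L[ℝ] HolderSpace 0 α, (∀ u θ, L u θ = u θ) ∧ ∀ u, ‖L u‖ ≤ 2 * ‖u‖ := by
  refine exists_clm_of_pointwise (fun u : HolderSpace 1 γ => (u : ℝ → Plane)) 2 (fun _ _ _ => rfl) (fun _ _ _ => rfl) fun u => ?_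
  obtain ⟨v, hv, hvn⟩ := exists_holder_zero (A := ‖u‖) (C := ‖u‖) hα u.periodic u.norm_apply_le
    fun θ θ' _ h1 => (norm_sub_le_of_hasDerivAt_le u.hasDerivAt u.norm_deriv_le θ θ').trans
      (mul_le_mul_of_nonneg_left (abs_le_rpow_of_lt_one h1 hα1) (norm_nonneg u))
  exact ⟨v, hv, by linarith⟩

/-- The inclusion `C^{0,α} ⊂ C^{0,γ}` for `γ ≤ α`. -/
theorem exists_inclusion_zero_zero (hγ : 0 < γ) (hγα : γ ≤ α) :
    ∃ L : HolderSpace 0 α →L[ℝ] HolderSpace 0 γ, (∀ u θ, L u θ = u θ) ∧ ∀ u, ‖L u‖ ≤ 2 * ‖u‖ := by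
  refine exists_clm_of_pointwise (fun u : HolderSpace 0 α => (u : ℝ → Plane)) 2 (fun _ _ _ => rfl) (fun _ _ _ => rfl) fun u => ?_
  obtain ⟨v, hv, hvn⟩ := exists_holder_zero (A := ‖u‖) (C := ‖u‖) hγ u.periodic u.norm_apply_le
    fun θ θ' hne h1 => by
      have := u.norm_iteratedDeriv_sub_le_of_lt hne h1
      rw [iteratedDeriv_zero] at this
      exact this.trans (mul_le_mul_of_nonneg_left (Real.rpow_le_rpow_of_exponent_ge
        (abs_pos.2 (sub_ne_zero.2 hne)) h1.le hγα) (norm_nonneg u))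
  exact ⟨v, hv, by linarith⟩

/-- Evaluation at a point, as a continuous linear map. -/
def evalCLM (k : ℕ) (γ θ : ℝ) : HolderSpace k γ →L[ℝ] Plane :=
  LinearMap.mkContinuous
    { toFun := fun u => u θ, map_add' := fun _ _ => rfl, map_smul' := fun _ _ => rfl } 1
    fun u => by rw [one_mul]; exact u.norm_apply_le θ

@[simp] theorem evalCLM_apply (θ : ℝ) (u : HolderSpace k γ) : evalCLM k γ θ u = u θ := rfl

end LinearMaps

/-! ### Convolution with smooth kernels -/

section SmoothKernel

variable {γ α : ℝ} {k k' k'' l l' l'' : ℝ → ℝ} {u : ℝ → Plane}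

/-- `k` is a periodic `C²` function with derivatives `k'` and `k''`. -/
structure IsSmoothKernel (k k' k'' : ℝ → ℝ) : Prop where
  deriv : ∀ y, HasDerivAt k (k' y) y
  deriv_two : ∀ y, HasDerivAt k' (k'' y) y
  continuous_two : Continuous k''
  periodic : Function.Periodic k (2 * Real.pi)
  periodic_one : Function.Periodic k' (2 * Real.pi)
  periodic_two : Function.Periodic k'' (2 * Real.pi)

theorem IsSmoothKernel.continuous (hk : IsSmoothKernel k k' k'') : Continuous k :=
  continuous_iff_continuousAt.2 fun y => (hk.deriv y).continuousAt

theorem IsSmoothKernel.continuous_one (hk : IsSmoothKernel k k' k'') : Continuous k' :=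
  continuous_iff_continuousAt.2 fun y => (hk.deriv_two y).continuousAt

theorem IsSmoothKernel.sub (hk : IsSmoothKernel k k' k'') (hl : IsSmoothKernel l l' l'') :
    IsSmoothKernel (fun y => k y - l y) (fun y => k' y - l' y) (fun y => k'' y - l'' y) where
  deriv y := (hk.deriv y).sub (hl.deriv y)
  deriv_two y := (hk.deriv_two y).sub (hl.deriv_two y)
  continuous_two := hk.continuous_two.sub hl.continuous_two
  periodic := hk.periodic.sub hl.periodic
  periodic_one := hk.periodic_one.sub hl.periodic_one
  periodic_two := hk.periodic_two.sub hl.periodic_two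

theorem isSmoothKernel_poisson {r : ℝ} (h0 : 0 ≤ r) (h1 : r < 1) :
    IsSmoothKernel (poisson r) (poissonDeriv r) (poissonDerivTwo r) :=
  ⟨hasDerivAt_poisson h0 h1, hasDerivAt_poissonDeriv h0 h1, continuous_poissonDerivTwo h0 h1,
    poisson_periodic r, poissonDeriv_periodic r, poissonDerivTwo_periodic r⟩

theorem IsSmoothKernel.hasDerivAt_conv (hk : IsSmoothKernel k k' k'') (hu : Continuous u)
    (hup : Function.Periodic u (2 * Real.pi)) (θ : ℝ) : HasDerivAt (conv k u) (conv k' u θ) θ :=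
  hasDerivAt_conv_left hk.deriv hk.continuous_one hk.periodic hk.periodic_one hu hup θ

theorem IsSmoothKernel.hasDerivAt_conv_one (hk : IsSmoothKernel k k' k'') (hu : Continuous u)
    (hup : Function.Periodic u (2 * Real.pi)) (θ : ℝ) : HasDerivAt (conv k' u) (conv k'' u θ) θ :=
  hasDerivAt_conv_left hk.deriv_two hk.continuous_two hk.periodic_one hk.periodic_two hu hup θ

/-- The mean of `|k|` over a period. -/
def kernelNorm (k : ℝ → ℝ) : ℝ := 1 / (2 * Real.pi) * ∫ y in (-Real.pi)..Real.pi, |k y|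

theorem kernelNorm_nonneg (k : ℝ → ℝ) : 0 ≤ kernelNorm k :=
  mul_nonneg (by positivity)
    (intervalIntegral.integral_nonneg (by linarith [Real.pi_pos]) fun _ _ => abs_nonneg _)

theorem norm_conv_le_kernelNorm (hk : Continuous k) (v : HolderSpace 0 α) (θ : ℝ) :
    ‖conv k v θ‖ ≤ kernelNorm k * ‖v‖ :=
  norm_conv_le hk v.norm_apply_le θ

/-- Convolution with a `C²` kernel, as a map `C^{0,α} → C^{1,γ}`. -/
theorem IsSmoothKernel.exists_convCLM (hk : IsSmoothKernel k k' k'') (α : ℝ) (hγ : 0 < γ)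
    (hγ1 : γ ≤ 1) :
    ∃ S : HolderSpace 0 α →L[ℝ] HolderSpace 1 γ, (∀ u θ, S u θ = conv k u θ) ∧
      ‖S‖ ≤ kernelNorm k + kernelNorm k' + kernelNorm k'' := by
  obtain ⟨S, hS, hSn⟩ := exists_clm_of_pointwise (k := 1) (γ := γ)
    (fun u : HolderSpace 0 α => conv k u) (kernelNorm k + kernelNorm k' + kernelNorm k'')
    (fun u v θ => conv_add_right hk.continuous u.continuous v.continuous θ)
    (fun c u θ => conv_smul_right c θ) fun u => by
      -- The Hölder seminorm of the derivative is bounded by its Lipschitz constant, hence by the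
      -- mean of `|k''|`.
      obtain ⟨v, hv, hvn⟩ := exists_holder_one hγ (conv_periodic u.periodic)
        (hk.hasDerivAt_conv u.continuous u.periodic) (norm_conv_le_kernelNorm hk.continuous u)
        (norm_conv_le_kernelNorm hk.continuous_one u) (C := kernelNorm k'' * ‖u‖)
        fun θ θ' _ h1 => (norm_sub_le_of_hasDerivAt_le
          (hk.hasDerivAt_conv_one u.continuous u.periodic)
          (norm_conv_le_kernelNorm hk.continuous_two u) θ θ').trans
          (mul_le_mul_of_nonneg_left (abs_le_rpow_of_lt_one h1 hγ1)
            (mul_nonneg (kernelNorm_nonneg _) (norm_nonneg u)))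
      exact ⟨v, hv, hvn.trans_eq (by ring)⟩
  exact ⟨S, hS, S.opNorm_le_bound (add_nonneg (add_nonneg (kernelNorm_nonneg _)
    (kernelNorm_nonneg _)) (kernelNorm_nonneg _)) hSn⟩

end SmoothKernel

/-! ### The semigroup as a family of smoothing maps -/

section SemigroupMap

variable {γ α : ℝ}

/-- The Poisson kernel at time `t`. -/
def heatKernel (t : ℝ) : ℝ → ℝ := poisson (Real.exp (-t / 4))

theorem isSmoothKernel_heatKernel {t : ℝ} (ht : 0 < t) :
    IsSmoothKernel (heatKernel t) (poissonDeriv (Real.exp (-t / 4)))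
      (poissonDerivTwo (Real.exp (-t / 4))) :=
  isSmoothKernel_poisson (Real.exp_pos _).le (exp_neg_div_four_lt_one ht)

theorem semigroup_eq_conv {t : ℝ} (ht : 0 < t) {u : ℝ → Plane}
    (hup : Function.Periodic u (2 * Real.pi)) (θ : ℝ) :
    semigroup t u θ = conv (heatKernel t) u θ := by
  rw [semigroup, if_neg ht.ne', heatKernel, conv_eq (poisson_periodic _) hup]

theorem kernelNorm_heatKernel {t : ℝ} (ht : 0 < t) : kernelNorm (heatKernel t) = 1 := by
  have h0 := Real.exp_pos (-t / 4)
  have h1 := exp_neg_div_four_lt_one ht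
  have : ∀ y, |heatKernel t y| = poisson (Real.exp (-t / 4)) y := fun y =>
    abs_of_nonneg (poisson_nonneg h0.le h1 y)
  simp only [kernelNorm, this, integral_poisson h0 h1]
  have := Real.pi_pos
  field_simp

theorem continuous_integral_abs_sub_of_continuous {f : ℝ → ℝ → ℝ}
    (hf : Continuous (Function.uncurry f)) (t₀ : ℝ) :
    Tendsto (fun t => kernelNorm fun y => f t y - f t₀ y) (𝓝 t₀) (𝓝 0) := by
  have h : Continuous fun t => kernelNorm fun y => f t y - f t₀ y := by
    unfold kernelNorm
    refine continuous_const.mul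
      (intervalIntegral.continuous_parametric_intervalIntegral_of_continuous' ?_ _ _)
    have : Continuous fun p : ℝ × ℝ => f t₀ p.2 :=
      hf.comp (continuous_const.prodMk continuous_snd)
    exact (hf.sub this).abs
  have h2 := h.tendsto t₀
  simpa [kernelNorm] using h2

/-- This sum bounds the operator norm of the difference of the semigroups at times `t` and `t₀`. -/
theorem tendsto_kernelNorm_sub_heatKernel {t₀ : ℝ} (ht₀ : 0 < t₀) :
    Tendsto (fun t => kernelNorm (fun y => heatKernel t y - heatKernel t₀ y)
      + kernelNorm (fun y => poissonDeriv (Real.exp (-t / 4)) y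
        - poissonDeriv (Real.exp (-t₀ / 4)) y)
      + kernelNorm (fun y => poissonDerivTwo (Real.exp (-t / 4)) y
        - poissonDerivTwo (Real.exp (-t₀ / 4)) y)) (𝓝 t₀) (𝓝 0) := by
  -- Stopping time at `t₀ / 2` keeps the radius away from `1`, so the kernels become jointly
  -- continuous for all real `t` without changing them near `t₀`.
  set ρ : ℝ → ℝ := fun t => Real.exp (-(max t (t₀ / 2)) / 4) with hρ
  have hρc : Continuous ρ := by fun_prop
  have hD : ∀ p : ℝ × ℝ, poissonDenom (ρ p.1) p.2 ≠ 0 := fun p =>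
    (poissonDenom_pos (Real.exp_pos _).le
      (exp_neg_div_four_lt_one (lt_max_of_lt_right (by linarith))) p.2).ne'
  have hDc : Continuous fun p : ℝ × ℝ => poissonDenom (ρ p.1) p.2 := by
    unfold poissonDenom; fun_prop
  have e0 : ρ t₀ = Real.exp (-t₀ / 4) := by rw [hρ]; simp only; rw [max_eq_left (by linarith)]
  have c0 : Continuous (Function.uncurry fun t y => poisson (ρ t) y) := by
    refine Continuous.div (f := fun p : ℝ × ℝ => 1 - ρ p.1 ^ 2) ?_ hDc hD
    fun_prop
  have c1 : Continuous (Function.uncurry fun t y => poissonDeriv (ρ t) y) := by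
    refine Continuous.div (f := fun p : ℝ × ℝ => -((1 - ρ p.1 ^ 2) * (2 * ρ p.1 * Real.sin p.2)))
      ?_ (hDc.pow 2) fun p => pow_ne_zero 2 (hD p)
    fun_prop
  have c2 : Continuous (Function.uncurry fun t y => poissonDerivTwo (ρ t) y) := by
    refine Continuous.add (Continuous.div
      (f := fun p : ℝ × ℝ => -((1 - ρ p.1 ^ 2) * (2 * ρ p.1 * Real.cos p.2)))
      ?_ (hDc.pow 2) fun p => pow_ne_zero 2 (hD p)) (Continuous.div
      (f := fun p : ℝ × ℝ => 2 * (1 - ρ p.1 ^ 2) * (2 * ρ p.1 * Real.sin p.2) ^ 2)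
      ?_ (hDc.pow 3) fun p => pow_ne_zero 3 (hD p)) <;> fun_prop
  have key := ((continuous_integral_abs_sub_of_continuous c0 t₀).add
    (continuous_integral_abs_sub_of_continuous c1 t₀)).add
    (continuous_integral_abs_sub_of_continuous c2 t₀)
  rw [add_zero, add_zero] at key
  refine key.congr' ?_
  filter_upwards [lt_mem_nhds (show t₀ / 2 < t₀ by linarith)] with t ht
  have e1 : ρ t = Real.exp (-t / 4) := by rw [hρ]; simp only; rw [max_eq_left ht.le]
  simp only [e0, e1, heatKernel]

/-- The semigroup at positive times, as a family of maps `C^{0,α} → C^{1,γ}` which is continuous in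
the operator norm and has an integrable singularity at time `0`. -/
theorem exists_semigroupMap (hγ : 0 < γ) (hγα : γ < α) (hα : α < 1) :
    ∃ (S : ℝ → HolderSpace 0 α →L[ℝ] HolderSpace 1 γ) (β : ℝ), 0 ≤ β ∧ β < 1 ∧
      (∀ t, 0 < t → ∀ u θ, S t u θ = conv (heatKernel t) u θ) ∧ ContinuousOn S (Ioi 0) ∧
      ∀ T, 0 < T → ∃ C, 0 ≤ C ∧ ∀ t, 0 < t → t ≤ T → ‖S t‖ ≤ C * t ^ (-β) := by
  have hex : ∀ t : ℝ, ∃ S : HolderSpace 0 α →L[ℝ] HolderSpace 1 γ,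
      0 < t → ∀ u θ, S u θ = conv (heatKernel t) u θ := fun t => by
    by_cases ht : 0 < t
    · obtain ⟨S, hS, -⟩ := (isSmoothKernel_heatKernel ht).exists_convCLM α hγ (by linarith)
      exact ⟨S, fun _ => hS⟩
    · exact ⟨0, fun h => absurd h ht⟩
  choose S hS using hex
  -- The midpoint of the admissible interval: `a > 1 - α` makes `|y|^(a - 2 + α)` integrable, and `a
  -- < 1 - γ` makes `β = a + γ` smaller than `1`.
  set a : ℝ := 1 - (α + γ) / 2 with ha
  have ha0 : 0 ≤ a := by rw [ha]; linarith
  refine ⟨S, a + γ, by linarith, by rw [ha]; linarith, hS, ?_, ?_⟩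
  · intro t₀ ht₀
    refine ContinuousAt.continuousWithinAt ?_
    rw [ContinuousAt, tendsto_iff_norm_sub_tendsto_zero]
    refine squeeze_zero' (Eventually.of_forall fun t => norm_nonneg _) ?_
      (tendsto_kernelNorm_sub_heatKernel ht₀)
    filter_upwards [lt_mem_nhds (show 0 < t₀ from ht₀)] with t ht
    obtain ⟨D, hD, hDn⟩ := ((isSmoothKernel_heatKernel ht).sub
      (isSmoothKernel_heatKernel ht₀)).exists_convCLM α hγ (by linarith)
    have : S t - S t₀ = D := by
      ext1 u
      refine HolderSpace.ext fun θ => ?_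
      rw [hD, conv_sub_left (isSmoothKernel_heatKernel ht).continuous
        (isSmoothKernel_heatKernel ht₀).continuous u.continuous, ← hS t ht, ← hS t₀ ht₀]
      rfl
    rw [this]
    exact hDn
  · intro T hT
    obtain ⟨K, hK0, hK⟩ := exists_poisson_bounds T ha0 (by linarith)
    set s : ℝ := a - 2 + α with hs
    have hs1 : -1 < s := by rw [hs, ha]; linarith
    set J : ℝ := ∫ y in (-Real.pi)..Real.pi, |y| ^ s with hJ
    have hJ0 : 0 ≤ J := intervalIntegral.integral_nonneg (by linarith [Real.pi_pos])
      fun _ _ => by positivity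
    have hJi := intervalIntegrable_abs_rpow hs1 (-Real.pi) Real.pi
    refine ⟨T ^ (a + γ) + 2 * K * J * T ^ γ + 4 * K * J, by positivity, fun t ht htT => ?_⟩
    have hk := isSmoothKernel_heatKernel ht
    have hta : t ^ (-a) = t ^ γ * t ^ (-(a + γ)) := by
      rw [← Real.rpow_add ht]; congr 1; ring
    have htb : 1 ≤ T ^ (a + γ) * t ^ (-(a + γ)) := by
      rw [Real.rpow_neg ht.le, ← div_eq_mul_inv, one_le_div (by positivity)]
      exact Real.rpow_le_rpow ht.le htT (by linarith)
    have htγ : t ^ γ ≤ T ^ γ := Real.rpow_le_rpow ht.le htT hγ.le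
    refine (S t).opNorm_le_bound (by positivity) fun u => ?_
    -- Since `q` is the derivative of a periodic function it has mean zero, and the `α`-Hölder
    -- continuity of `u` supplies the factor `|y|^α`.
    have hgen : ∀ (q q' : ℝ → ℝ) (Q : ℝ), Continuous q → (∀ y, HasDerivAt q' (q y) y) →
        Function.Periodic q' (2 * Real.pi) → 0 ≤ Q →
        (∀ y, y ≠ 0 → |y| ≤ Real.pi → |q y| ≤ Q * |y| ^ (a - 2)) → ∀ θ,
        ‖conv q u θ‖ ≤ 2 * Q * J * ‖u‖ := by
      intro q q' Q hq hqd hqp hQ0 hQ θ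
      have h1 := norm_conv_sub_le (k := q) (u := u) (θ := θ)
        (g := fun y => 2 * Q * ‖u‖ * |y| ^ s) hq u.continuous (hJi.const_mul _) fun y hy hyπ => by
          have e1 := hQ y hy hyπ
          have e2 := u.norm_sub_le_rpow (by linarith) (θ - y) θ
          rw [show θ - y - θ = -y by ring, abs_neg] at e2
          refine (mul_le_mul e1 e2 (norm_nonneg _) (by positivity)).trans_eq ?_
          rw [hs, Real.rpow_add (abs_pos.2 hy)]
          ring
      rw [integral_deriv_periodic_eq_zero hqd hq hqp, mul_zero, zero_smul, sub_zero,
        intervalIntegral.integral_const_mul] at h1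
      exact h1.trans_eq (by ring)
    have b1 := hgen _ _ (K * t ^ (-a)) hk.continuous_one hk.deriv hk.periodic (by positivity)
      fun y hy hyπ => (hK t y ht htT hy hyπ).2.1
    have b2 := hgen _ _ (K * (t ^ (-a) / t)) hk.continuous_two hk.deriv_two hk.periodic_one
      (by positivity) fun y hy hyπ => (hK t y ht htT hy hyπ).2.2
    have hu0 := norm_nonneg u
    have hd : ∀ θ, HasDerivAt (S t u) (conv (poissonDeriv (Real.exp (-t / 4))) u θ) θ := by
      have : (S t u : ℝ → Plane) = conv (heatKernel t) u := funext (hS t ht u)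
      rw [this]
      exact hk.hasDerivAt_conv u.continuous u.periodic
    have hfin := HolderSpace.norm_one_le (u := S t u) (A := ‖u‖) (C := 4 * K * J * t ^ (-(a + γ)) * ‖u‖)
      hγ hd (fun θ => by
        rw [hS t ht]
        exact (norm_conv_le_kernelNorm hk.continuous u θ).trans_eq
          (by rw [kernelNorm_heatKernel ht, one_mul])) b1 fun θ θ' hne h1 => by
        have hx : 0 < |θ - θ'| := abs_pos.2 (sub_ne_zero.2 hne)
        set x := |θ - θ'| with hxdef
        -- Distances below `t` are handled by the second derivative, larger ones by two sup bounds
        -- on the first. Both give `t^(-(a + γ)) x^γ`.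
        rcases le_total x t with hxt | hxt
        · refine (norm_sub_le_of_hasDerivAt_le (hk.hasDerivAt_conv_one u.continuous u.periodic)
            b2 θ θ').trans ?_
          rw [← hxdef]
          have e1 : x ≤ x ^ γ * (t * t ^ (-γ)) := by
            calc x = x ^ γ * x ^ (1 - γ) := by rw [← Real.rpow_add hx]; norm_num
              _ ≤ x ^ γ * t ^ (1 - γ) := by
                gcongr
                linarith
              _ = _ := by rw [sub_eq_add_neg, Real.rpow_add ht, Real.rpow_one]
          have e2 : t ^ (-(a + γ)) = t ^ (-a) * t ^ (-γ) := by
            rw [← Real.rpow_add ht]; congr 1; ring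
          calc 2 * (K * (t ^ (-a) / t)) * J * ‖u‖ * x
              ≤ 2 * (K * (t ^ (-a) / t)) * J * ‖u‖ * (x ^ γ * (t * t ^ (-γ))) :=
                mul_le_mul_of_nonneg_left e1 (by positivity)
            _ = 2 * K * J * t ^ (-(a + γ)) * ‖u‖ * x ^ γ := by rw [e2]; field_simp
            _ ≤ 4 * K * J * t ^ (-(a + γ)) * ‖u‖ * x ^ γ := by gcongr; norm_num
        · have e1 : t ^ γ ≤ x ^ γ := Real.rpow_le_rpow ht.le hxt hγ.le
          calc _ ≤ 2 * (K * t ^ (-a)) * J * ‖u‖ + 2 * (K * t ^ (-a)) * J * ‖u‖ :=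
                (norm_sub_le _ _).trans (add_le_add (b1 θ) (b1 θ'))
            _ = 4 * K * J * t ^ (-(a + γ)) * ‖u‖ * t ^ γ := by rw [hta]; ring
            _ ≤ _ := mul_le_mul_of_nonneg_left e1 (by positivity)
    refine hfin.trans ?_
    have c1 : ‖u‖ ≤ T ^ (a + γ) * t ^ (-(a + γ)) * ‖u‖ := le_mul_of_one_le_left hu0 htb
    have c2 : 2 * (K * t ^ (-a)) * J * ‖u‖ ≤ 2 * K * J * T ^ γ * t ^ (-(a + γ)) * ‖u‖ := by
      rw [hta]
      calc _ = 2 * K * J * t ^ (-(a + γ)) * ‖u‖ * t ^ γ := by ring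
        _ ≤ 2 * K * J * t ^ (-(a + γ)) * ‖u‖ * T ^ γ :=
          mul_le_mul_of_nonneg_left htγ (by positivity)
        _ = _ := by ring
    linarith

end SemigroupMap

/-! ### The semigroup on the little Hölder space -/

section InitialData

variable {γ : ℝ}

theorem exists_norm_le_of_periodic {f : ℝ → Plane} (hf : Continuous f)
    (hp : Function.Periodic f (2 * Real.pi)) : ∃ B : ℝ, 0 ≤ B ∧ ∀ θ, ‖f θ‖ ≤ B := by
  obtain ⟨B, hB⟩ := (hp.isBounded_of_continuous (by positivity) hf).exists_norm_le
  exact ⟨B, (norm_nonneg _).trans (hB _ (mem_range_self 0)), fun θ => hB _ (mem_range_self θ)⟩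

/-- The semigroup converges uniformly on differentiable functions. -/
theorem exists_norm_conv_heatKernel_sub_le {v v' : ℝ → Plane} (hd : ∀ θ, HasDerivAt v (v' θ) θ)
    (hv' : Continuous v') (hp : Function.Periodic v' (2 * Real.pi)) :
    ∃ L : ℝ, 0 ≤ L ∧ ∀ t, 0 < t → t ≤ 1 → ∀ θ,
      ‖conv (heatKernel t) v θ - v θ‖ ≤ L * t ^ (1 / 2 : ℝ) := by
  obtain ⟨B, hB0, hB⟩ := exists_norm_le_of_periodic hv' hp
  -- Any `0 < a < 1` would serve: the kernel times `|y|` is then integrable, with a positive power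
  -- of `t` left over.
  obtain ⟨K, hK0, hK⟩ := exists_poisson_bounds 1 (a := 1 / 2) (by norm_num) (by norm_num)
  have hv : Continuous v := continuous_iff_continuousAt.2 fun θ => (hd θ).continuousAt
  have hi := intervalIntegrable_abs_rpow (s := -(1 / 2)) (by norm_num) (-Real.pi) Real.pi
  have hJ0 : 0 ≤ ∫ y in (-Real.pi)..Real.pi, |y| ^ (-(1 / 2) : ℝ) :=
    intervalIntegral.integral_nonneg (by linarith [Real.pi_pos]) fun _ _ => by positivity
  refine ⟨K * B * ∫ y in (-Real.pi)..Real.pi, |y| ^ (-(1 / 2) : ℝ), by positivity,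
    fun t ht ht1 θ => ?_⟩
  have h1 := norm_conv_sub_le (k := heatKernel t) (u := v) (θ := θ)
    (g := fun y => K * B * t ^ (1 / 2 : ℝ) * |y| ^ (-(1 / 2) : ℝ))
    (isSmoothKernel_heatKernel ht).continuous hv (hi.const_mul _) fun y hy hyπ => by
      have e1 := (hK t y ht ht1 hy hyπ).1
      have e2 := norm_sub_le_of_hasDerivAt_le hd hB (θ - y) θ
      rw [show θ - y - θ = -y by ring, abs_neg] at e2
      rw [heatKernel, abs_of_nonneg (poisson_nonneg (Real.exp_pos _).le (exp_neg_div_four_lt_one ht) y)]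
      have ht2 : t * t ^ (-(1 / 2) : ℝ) = t ^ (1 / 2 : ℝ) := by
        rw [show (1 / 2 : ℝ) = 1 + -(1 / 2) by norm_num, Real.rpow_add ht, Real.rpow_one]
        norm_num
      have hy2 : |y| ^ (1 / 2 - 2 : ℝ) * |y| = |y| ^ (-(1 / 2) : ℝ) := by
        rw [show (-(1 / 2) : ℝ) = (1 / 2 - 2) + 1 by norm_num, Real.rpow_add (abs_pos.2 hy),
          Real.rpow_one]
      rw [ht2] at e1
      refine (mul_le_mul e1 e2 (norm_nonneg _) (by positivity)).trans_eq ?_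
      rw [← hy2]
      ring
  have h2 : 1 / (2 * Real.pi) * ∫ y in (-Real.pi)..Real.pi, heatKernel t y = 1 := by
    rw [heatKernel, integral_poisson (Real.exp_pos _) (exp_neg_div_four_lt_one ht)]
    have := Real.pi_pos
    field_simp
  rw [h2, one_smul, intervalIntegral.integral_const_mul] at h1
  exact h1.trans_eq (by ring)

theorem iteratedDeriv_periodic {f : ℝ → Plane} {c : ℝ} (hf : Function.Periodic f c) (n : ℕ) :
    Function.Periodic (iteratedDeriv n f) c := by
  induction n with
  | zero => rwa [iteratedDeriv_zero]
  | succ n ih => rw [iteratedDeriv_succ]; exact deriv_periodic ih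

/-- Convolution with the Poisson kernel is bounded on `C^{1,γ}`, uniformly in time. -/
theorem exists_heatCLM (hγ : 0 < γ) {t : ℝ} (ht : 0 < t) :
    ∃ S : HolderSpace 1 γ →L[ℝ] HolderSpace 1 γ, (∀ u θ, S u θ = conv (heatKernel t) u θ) ∧
      ∀ u, ‖S u‖ ≤ 3 * ‖u‖ := by
  have hk := (isSmoothKernel_heatKernel ht).continuous
  have hle : ∀ (w : ℝ → Plane) (A : ℝ), (∀ θ, ‖w θ‖ ≤ A) → ∀ θ, ‖conv (heatKernel t) w θ‖ ≤ A := by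
    intro w A hw θ
    have := norm_conv_le hk hw θ
    rwa [show (1 / (2 * Real.pi) * ∫ y in (-Real.pi)..Real.pi, |heatKernel t y|) = 1 from
      kernelNorm_heatKernel ht, one_mul] at this
  refine exists_clm_of_pointwise (k := 1) (γ := γ)
    (fun u : HolderSpace 1 γ => conv (heatKernel t) u) 3
    (fun u v θ => conv_add_right hk u.continuous v.continuous θ)
    (fun c u θ => conv_smul_right c θ) fun u => ?_
  obtain ⟨v, hv, hvn⟩ := exists_holder_one (A := ‖u‖) (B := ‖u‖) (C := ‖u‖) hγ
    (conv_periodic u.periodic)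
    (hasDerivAt_conv_right hk u.hasDerivAt u.continuous_deriv) (hle _ _ u.norm_apply_le)
    (hle _ _ u.norm_deriv_le) fun θ θ' hne h1 => by
      -- An increment of the convolution is the convolution of the increment of `deriv u` under a
      -- fixed translation. Averaging against a probability kernel does not enlarge the seminorm.
      have e1 : conv (heatKernel t) (deriv u) θ' =
          conv (heatKernel t) (fun x => deriv u (x + (θ' - θ))) θ := by
        simp only [conv]
        congr 2
        funext y
        rw [show θ - y + (θ' - θ) = θ' - y by ring]
      have hc : Continuous fun x => deriv u (x + (θ' - θ)) :=
        u.continuous_deriv.comp (by fun_prop)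
      rw [e1, ← conv_sub_right hk u.continuous_deriv hc]
      refine hle _ _ (fun x => ?_) θ
      have e2 : |x - (x + (θ' - θ))| = |θ - θ'| := by congr 1; ring
      have e3 := u.norm_iteratedDeriv_sub_le_of_lt (θ := x) (θ' := x + (θ' - θ))
        (fun h => hne (by linarith)) (by rwa [e2])
      rwa [iteratedDeriv_one, e2] at e3
  exact ⟨v, hv, by linarith⟩

/-- The uniform rate is applied to `u`, `u'` and `u''`, the last controlling the Hölder seminorm of
the difference of first derivatives. -/
theorem exists_norm_heat_sub_le (hγ : 0 < γ) (hγ1 : γ ≤ 1) {u : HolderSpace 1 γ}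
    (hu : ContDiff ℝ ∞ u) :
    ∃ L : ℝ, 0 ≤ L ∧ ∀ t, 0 < t → t ≤ 1 → ∀ v : HolderSpace 1 γ,
      (∀ θ, v θ = conv (heatKernel t) u θ) → ‖v - u‖ ≤ L * t ^ (1 / 2 : ℝ) := by
  have hd : ∀ n θ, HasDerivAt (iteratedDeriv n u) (iteratedDeriv (n + 1) u θ) θ := fun n θ => by
    rw [iteratedDeriv_succ]
    exact (hu.differentiable_iteratedDeriv n (by exact_mod_cast WithTop.coe_lt_top _) θ).hasDerivAt
  have hc : ∀ n, Continuous (iteratedDeriv n u) := fun n =>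
    continuous_iff_continuousAt.2 fun θ => (hd n θ).continuousAt
  have hb := fun n => exists_norm_conv_heatKernel_sub_le (hd n) (hc _)
    (iteratedDeriv_periodic u.periodic _)
  choose L hL0 hL using hb
  refine ⟨L 0 + L 1 + L 2, add_nonneg (add_nonneg (hL0 0) (hL0 1)) (hL0 2),
    fun t ht ht1 v hv => ?_⟩
  have hk := (isSmoothKernel_heatKernel ht).continuous
  have hdiff : ∀ n θ, HasDerivAt (fun θ => conv (heatKernel t) (iteratedDeriv n u) θ
      - iteratedDeriv n u θ) (conv (heatKernel t) (iteratedDeriv (n + 1) u) θ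
      - iteratedDeriv (n + 1) u θ) θ := fun n θ =>
    (hasDerivAt_conv_right hk (hd n) (hc _) θ).sub (hd n θ)
  have h0 : ∀ θ, (v - u : HolderSpace 1 γ) θ
      = conv (heatKernel t) (iteratedDeriv 0 u) θ - iteratedDeriv 0 u θ := fun θ => by
    rw [HolderSpace.coe_sub, hv, iteratedDeriv_zero]
  have key := HolderSpace.norm_one_le (u := v - u) hγ
    (fun θ => by rw [funext h0]; exact hdiff 0 θ)
    (fun θ => by rw [h0]; exact hL 0 t ht ht1 θ) (hL 1 t ht ht1)
    (C := L 2 * t ^ (1 / 2 : ℝ)) fun θ θ' _ h1 =>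
      (norm_sub_le_of_hasDerivAt_le (hdiff 1) (hL 2 t ht ht1) θ θ').trans
        (mul_le_mul_of_nonneg_left (abs_le_rpow_of_lt_one h1 hγ1)
          (mul_nonneg (hL0 2) (by positivity)))
  exact key.trans_eq (by ring)

/-- The semigroup on `C^{1,γ}`: it is bounded, and strongly continuous on the little Hölder
space. -/
theorem exists_heatMap (hγ : 0 < γ) (hγ1 : γ < 1) :
    ∃ S : ℝ → HolderSpace 1 γ →L[ℝ] HolderSpace 1 γ,
      (∀ t, 0 ≤ t → ∀ u θ, S t u θ = semigroup t u θ) ∧ (∀ t u, ‖S t u‖ ≤ 3 * ‖u‖) ∧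
      ∀ u ∈ littleHolder γ, ContinuousOn (fun t => S t u) (Ici 0) := by
  have hex : ∀ t : ℝ, ∃ S : HolderSpace 1 γ →L[ℝ] HolderSpace 1 γ,
      (0 ≤ t → ∀ u θ, S u θ = semigroup t u θ) ∧ ∀ u, ‖S u‖ ≤ 3 * ‖u‖ := fun t => by
    by_cases ht : 0 < t
    · obtain ⟨S, hS, hSn⟩ := exists_heatCLM hγ ht
      exact ⟨S, fun _ u θ => by rw [hS, semigroup_eq_conv ht u.periodic], hSn⟩
    · refine ⟨ContinuousLinearMap.id ℝ _, fun h u θ => ?_, fun u => ?_⟩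
      · rw [semigroup, if_pos (le_antisymm (not_lt.1 ht) h)]; rfl
      · change ‖u‖ ≤ 3 * ‖u‖
        linarith [norm_nonneg u]
  choose S hS hSn using hex
  have hSc : ∀ t, 0 < t → ∀ u θ, S t u θ = conv (heatKernel t) u θ := fun t ht u θ => by
    rw [hS t ht.le, semigroup_eq_conv ht u.periodic]
  have hS0 : ∀ u, S 0 u = u := fun u => HolderSpace.ext fun θ => by
    rw [hS 0 le_rfl, semigroup, if_pos rfl]
  refine ⟨S, hS, hSn, fun u hu t₀ ht₀ => ?_⟩
  rcases (show (0 : ℝ) ≤ t₀ from ht₀).eq_or_lt with rfl | ht₀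
  · rw [ContinuousWithinAt, hS0, Metric.tendsto_nhds]
    intro ε hε
    -- Density of smooth functions and uniform boundedness: the approximation costs `3 ε / 8 + ε /
    -- 8`, leaving `ε / 2` for the smooth function. This is the only use of membership in the little
    -- Hölder space.
    obtain ⟨w, hw, hwu⟩ := Metric.mem_closure_iff.1 hu (ε / 8) (by positivity)
    obtain ⟨L, hL0, hL⟩ := exists_norm_heat_sub_le hγ hγ1.le hw
    have hlim : Tendsto (fun t : ℝ => L * t ^ (1 / 2 : ℝ)) (𝓝 0) (𝓝 0) := by
      have := ((Real.continuousAt_rpow_const 0 (1 / 2 : ℝ) (Or.inr (by norm_num))).tendsto).const_mul L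
      rwa [Real.zero_rpow (by norm_num), mul_zero] at this
    filter_upwards [self_mem_nhdsWithin, nhdsWithin_le_nhds (gt_mem_nhds (show (0 : ℝ) < 1 by norm_num)),
      nhdsWithin_le_nhds (hlim.eventually (gt_mem_nhds (show 0 < ε / 2 by positivity)))] with t ht ht1 htL
    have hmain : ‖S t w - w‖ < ε / 2 := by
      rcases (show (0 : ℝ) ≤ t from ht).eq_or_lt with rfl | htpos
      · rw [hS0, sub_self, norm_zero]; positivity
      · exact (hL t htpos ht1.le _ (hSc t htpos w)).trans_lt htL
    rw [dist_eq_norm] at hwu ⊢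
    have e : S t u - u = S t (u - w) + (S t w - w) + (w - u) := by rw [map_sub]; abel
    have e1 := hSn t (u - w)
    have e2 : ‖w - u‖ = ‖u - w‖ := norm_sub_rev _ _
    rw [e]
    refine (norm_add₃_le).trans_lt ?_
    linarith
  -- At positive times the semigroup factors through the inclusion into `C^{0,α}` and the smoothing
  -- family, which is continuous in operator norm.
  · obtain ⟨ι, hι, -⟩ := exists_inclusion_one_zero γ (α := (1 + γ) / 2) (by linarith) (by linarith)
    obtain ⟨A, β, -, -, hA, hAc, -⟩ :=
      exists_semigroupMap (γ := γ) (α := (1 + γ) / 2) hγ (by linarith) (by linarith)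
    have h1 : ContinuousAt (fun t => A t (ι u)) t₀ :=
      ((hAc.continuousAt (Ioi_mem_nhds ht₀)).clm_apply continuousAt_const)
    refine (h1.congr ?_).continuousWithinAt
    filter_upwards [Ioi_mem_nhds ht₀] with t ht
    refine HolderSpace.ext fun θ => ?_
    rw [hA t ht, hSc t ht, show (ι u : ℝ → Plane) = u from funext (hι u)]

end InitialData

/-! ### Duhamel integrals and fixed points -/

section Duhamel

variable {E F : Type*} [NormedAddCommGroup E] [NormedSpace ℝ E] [NormedAddCommGroup F]
  [NormedSpace ℝ F] {S : ℝ → F →L[ℝ] E} {β C T : ℝ} {f g : ℝ → F} {t : ℝ}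

/-- A family of operators with an integrable singularity at time `0`. -/
structure IsSmoothing (S : ℝ → F →L[ℝ] E) (β C T : ℝ) : Prop where
  nonneg : 0 ≤ β
  lt_one : β < 1
  bound_nonneg : 0 ≤ C
  continuousOn : ContinuousOn S (Ioi 0)
  bound : ∀ t, 0 < t → t ≤ T → ‖S t‖ ≤ C * t ^ (-β)

theorem IsSmoothing.mono (hS : IsSmoothing S β C T) {T' : ℝ} (h : T' ≤ T) :
    IsSmoothing S β C T' :=
  { hS with bound := fun t ht htT => hS.bound t ht (htT.trans h) }

/-- The Duhamel integral. -/
def duhamel (S : ℝ → F →L[ℝ] E) (f : ℝ → F) (t : ℝ) : E := ∫ s in (0 : ℝ)..t, S (t - s) (f s)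

theorem duhamel_congr (ht : 0 ≤ t) (h : ∀ s ∈ Icc 0 t, f s = g s) :
    duhamel S f t = duhamel S g t :=
  intervalIntegral.integral_congr fun s hs => by
    rw [uIcc_of_le ht] at hs
    simp only [h s hs]

theorem IsSmoothing.intervalIntegrable (hS : IsSmoothing S β C T) (ht : t ∈ Icc 0 T)
    (hf : ContinuousOn f (Icc 0 t)) : IntervalIntegrable (fun s => S (t - s) (f s)) volume 0 t := by
  obtain ⟨M, hM⟩ := isCompact_Icc.exists_bound_of_continuousOn hf
  have hg := (intervalIntegrable_abs_sub_rpow (s := -β) (by linarith [hS.lt_one]) t 0 t).const_mul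
    (C * M)
  refine hg.mono_fun ?_ ?_
  -- The end point `s = t` is discarded, since the family is continuous only at positive times.
  · rw [uIoc_of_le ht.1, ← restrict_Ioo_eq_restrict_Ioc]
    refine ContinuousOn.aestronglyMeasurable ?_ measurableSet_Ioo
    refine ContinuousOn.clm_apply (hS.continuousOn.comp (by fun_prop) fun s hs => ?_)
      (hf.mono Ioo_subset_Icc_self)
    exact sub_pos.2 hs.2
  · rw [uIoc_of_le ht.1, EventuallyLE, ae_restrict_iff' measurableSet_Ioc]
    have h0 : ∀ᵐ s : ℝ, s ≠ t := by simp [ae_iff, measure_singleton]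
    filter_upwards [h0] with s hst hs
    have hts : 0 < t - s := sub_pos.2 (lt_of_le_of_ne hs.2 hst)
    have h1 := (S (t - s)).le_of_opNorm_le (hS.bound _ hts (by linarith [hs.1, ht.2])) (f s)
    have h2 := hM s ⟨hs.1.le, hs.2⟩
    refine h1.trans (le_trans ?_ (Real.le_norm_self _))
    rw [abs_of_pos hts]
    calc C * (t - s) ^ (-β) * ‖f s‖ ≤ C * (t - s) ^ (-β) * M :=
          mul_le_mul_of_nonneg_left h2 (mul_nonneg hS.bound_nonneg (by positivity))
      _ = _ := by ring

theorem IsSmoothing.duhamel_sub (hS : IsSmoothing S β C T) (ht : t ∈ Icc 0 T)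
    (hf : ContinuousOn f (Icc 0 t)) (hg : ContinuousOn g (Icc 0 t)) :
    duhamel S f t - duhamel S g t = duhamel S (fun s => f s - g s) t := by
  rw [duhamel, duhamel, duhamel, ← intervalIntegral.integral_sub (hS.intervalIntegrable ht hf)
    (hS.intervalIntegrable ht hg)]
  simp only [map_sub]

/-- The integral over the half line is `l^(-(1 - β)) Γ(1 - β)`, which tends to `0` as `l → ∞`, so
the bound is uniform in `t`. -/
theorem exists_weight_integral_le {ε : ℝ} (hβ : β < 1) (hε : 0 < ε) :
    ∃ l : ℝ, 0 < l ∧ ∀ t, 0 ≤ t → IntervalIntegrable (fun τ => |τ| ^ (-β) * Real.exp (-(l * τ)))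
      volume 0 t ∧ ∫ τ in (0 : ℝ)..t, |τ| ^ (-β) * Real.exp (-(l * τ)) ≤ ε := by
  have h1 : Tendsto (fun l : ℝ => l ^ (-(1 - β)) * Real.Gamma (1 - β)) atTop (𝓝 0) := by
    have := (tendsto_rpow_neg_atTop (show 0 < 1 - β by linarith)).mul_const (Real.Gamma (1 - β))
    rwa [zero_mul] at this
  obtain ⟨l, hl, hl0⟩ := ((h1.eventually (gt_mem_nhds hε)).and (eventually_gt_atTop 0)).exists
  refine ⟨l, hl0, fun t ht => ?_⟩
  have key := Real.integral_rpow_mul_exp_neg_mul_Ioi (show 0 < 1 - β by linarith) hl0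
  have hΓ := Real.Gamma_pos_of_pos (show 0 < 1 - β by linarith)
  have hint : IntegrableOn (fun τ : ℝ => τ ^ ((1 - β) - 1) * Real.exp (-(l * τ))) (Ioi 0) :=
    .of_integral_ne_zero (by rw [key]; positivity)
  have heq : EqOn (fun τ : ℝ => τ ^ ((1 - β) - 1) * Real.exp (-(l * τ)))
      (fun τ => |τ| ^ (-β) * Real.exp (-(l * τ))) (Ioi 0) := fun τ hτ => by
    simp only
    rw [abs_of_pos hτ]
    congr 2
    ring
  have hint' := hint.congr_fun heq measurableSet_Ioi
  refine ⟨(intervalIntegrable_iff_integrableOn_Ioc_of_le ht).2 (hint'.mono_set fun x hx => hx.1), ?_⟩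
  rw [intervalIntegral.integral_of_le ht]
  refine (setIntegral_mono_set hint' (Eventually.of_forall fun τ => by
    simp only [Pi.zero_apply]; positivity) (Eventually.of_forall fun x hx => hx.1)).trans ?_
  rw [← setIntegral_congr_fun measurableSet_Ioi heq, key, one_div, Real.inv_rpow hl0.le,
    ← Real.rpow_neg hl0.le]
  exact hl.le

/-- In an exponentially weighted norm the Duhamel integral is as small as desired. -/
theorem IsSmoothing.exists_weight (hS : IsSmoothing S β C T) {ε : ℝ} (hε : 0 < ε) :
    ∃ l : ℝ, 0 < l ∧ ∀ t ∈ Icc 0 T, ∀ (f : ℝ → F) (A : ℝ), 0 ≤ A →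
      (∀ s ∈ Icc 0 t, ‖f s‖ ≤ A * Real.exp (l * s)) →
      ‖duhamel S f t‖ ≤ ε * A * Real.exp (l * t) := by
  have hC := hS.bound_nonneg
  -- Dividing by `C + 1` rather than `C` covers `C = 0`.
  obtain ⟨l, hl, h⟩ := exists_weight_integral_le hS.lt_one (show 0 < ε / (C + 1) by positivity)
  refine ⟨l, hl, fun t ht f A hA hf => ?_⟩
  obtain ⟨hi, hle⟩ := h t ht.1
  have hi2 := ((hi.comp_sub_left t).const_mul (C * A * Real.exp (l * t))).symm
  rw [sub_zero, sub_self] at hi2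
  have h0 : ∀ᵐ s : ℝ, s ≠ t := by simp [ae_iff, measure_singleton]
  refine (intervalIntegral.norm_integral_le_of_norm_le ht.1 ?_ hi2).trans ?_
  · filter_upwards [h0] with s hst hs
    have hts : 0 < t - s := sub_pos.2 (lt_of_le_of_ne hs.2 hst)
    refine ((S (t - s)).le_of_opNorm_le (hS.bound _ hts (by linarith [hs.1, ht.2])) (f s)).trans ?_
    rw [abs_of_pos hts]
    have e : Real.exp (l * s) = Real.exp (l * t) * Real.exp (-(l * (t - s))) := by
      rw [← Real.exp_add]; congr 1; ring
    calc C * (t - s) ^ (-β) * ‖f s‖ ≤ C * (t - s) ^ (-β) * (A * Real.exp (l * s)) :=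
          mul_le_mul_of_nonneg_left (hf s ⟨hs.1.le, hs.2⟩) (mul_nonneg hC (by positivity))
      _ = _ := by rw [e]; ring
  · rw [intervalIntegral.integral_comp_sub_left (fun τ => C * A * Real.exp (l * t) *
      (|τ| ^ (-β) * Real.exp (-(l * τ)))) t, intervalIntegral.integral_const_mul, sub_zero,
      sub_self]
    calc _ ≤ C * A * Real.exp (l * t) * (ε / (C + 1)) :=
          mul_le_mul_of_nonneg_left hle (by positivity)
      _ = C / (C + 1) * (ε * A * Real.exp (l * t)) := by ring
      _ ≤ 1 * (ε * A * Real.exp (l * t)) := by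
        refine mul_le_mul_of_nonneg_right ?_ (by positivity)
        rw [div_le_one (by positivity)]
        linarith
      _ = _ := one_mul _

/-- After the substitution `τ = t - s` the operator no longer depends on `t`. Dominated convergence
applies, with the fixed majorant `C M |τ|^(-β)`. -/
theorem IsSmoothing.continuousOn_duhamel (hS : IsSmoothing S β C T)
    (hf : ContinuousOn f (Icc 0 T)) : ContinuousOn (duhamel S f) (Icc 0 T) := by
  rcases lt_or_ge T 0 with hT | hT
  · rw [Icc_eq_empty (not_le.2 hT)]
    exact continuousOn_empty _
  -- Clamping to `[0,T]` extends `f` continuously, so that `h (t - τ)` makes sense for all `t` and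
  -- `τ`.
  set h : ℝ → F := fun s => f (max 0 (min s T)) with hh
  have hmem : ∀ s : ℝ, max 0 (min s T) ∈ Icc 0 T := fun s =>
    ⟨le_max_left _ _, max_le hT (min_le_right _ _)⟩
  have hc : Continuous h := hf.comp_continuous (by fun_prop) hmem
  obtain ⟨M, hM⟩ := isCompact_Icc.exists_bound_of_continuousOn hf
  have hM' : ∀ s, ‖h s‖ ≤ M := fun s => hM _ (hmem s)
  have hM0 : 0 ≤ M := (norm_nonneg _).trans (hM' 0)
  set G : ℝ → ℝ → E := fun t => indicator {τ | τ ≤ t} fun τ => S τ (h (t - τ)) with hG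
  have heq : ∀ t ∈ Icc 0 T, duhamel S f t = ∫ τ in (0 : ℝ)..T, G t τ := by
    intro t ht
    rw [intervalIntegral.integral_indicator ht]
    have e1 := intervalIntegral.integral_comp_sub_left (a := 0) (b := t)
      (fun τ => S τ (h (t - τ))) t
    rw [sub_zero, sub_self] at e1
    rw [← e1]
    refine intervalIntegral.integral_congr fun s hs => ?_
    rw [uIcc_of_le ht.1] at hs
    simp only [hh, sub_sub_cancel]
    rw [min_eq_left (hs.2.trans ht.2), max_eq_right hs.1]
  have hcG : ∀ t : ℝ, ContinuousOn (fun τ => S τ (h (t - τ))) (Ioc 0 T) := fun t =>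
    (hS.continuousOn.mono fun τ hτ => hτ.1).clm_apply
      (hc.comp (continuous_const.sub continuous_id)).continuousOn
  have hcont : Continuous fun t => ∫ τ in (0 : ℝ)..T, G t τ := by
    refine continuous_iff_continuousAt.2 fun t₀ =>
      intervalIntegral.continuousAt_of_dominated_interval
        (bound := fun τ => C * M * |τ| ^ (-β)) ?_ ?_ ?_ ?_
    · refine Eventually.of_forall fun t => ?_
      rw [uIoc_of_le hT]
      exact ((hcG t).aestronglyMeasurable measurableSet_Ioc).indicator measurableSet_Iic
    · refine Eventually.of_forall fun t => Eventually.of_forall fun τ hτ => ?_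
      rw [uIoc_of_le hT] at hτ
      have hb := (S τ).le_of_opNorm_le (hS.bound τ hτ.1 hτ.2) (h (t - τ))
      refine (norm_indicator_le_norm_self _ _).trans (hb.trans ?_)
      rw [abs_of_pos hτ.1]
      calc C * τ ^ (-β) * ‖h (t - τ)‖ ≤ C * τ ^ (-β) * M :=
            mul_le_mul_of_nonneg_left (hM' _)
              (mul_nonneg hS.bound_nonneg (Real.rpow_nonneg hτ.1.le _))
        _ = _ := by ring
    · exact (intervalIntegrable_abs_rpow (by linarith [hS.lt_one]) 0 T).const_mul _
    -- The indicator makes the integrand jump in `t` at `t₀` only for `τ = t₀`, a null set.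
    · have h0 : ∀ᵐ s : ℝ, s ≠ t₀ := by simp [ae_iff, measure_singleton]
      filter_upwards [h0] with τ hτ _
      rcases lt_or_gt_of_ne hτ with h1 | h1
      · have : ContinuousAt (fun t => S τ (h (t - τ))) t₀ :=
          ((S τ).continuous.comp (hc.comp (continuous_id.sub continuous_const))).continuousAt
        refine this.congr ?_
        filter_upwards [lt_mem_nhds h1] with t ht
        rw [hG]
        simp only
        rw [indicator_of_mem (show τ ∈ {τ | τ ≤ t} from ht.le)]
      · refine (continuousAt_const (y := (0 : E))).congr ?_
        filter_upwards [gt_mem_nhds h1] with t ht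
        rw [hG]
        simp only
        rw [indicator_of_notMem (show τ ∉ {τ | τ ≤ t} from not_le.2 ht)]
  exact hcont.continuousOn.congr heq

/-- The Duhamel term of a Lipschitz nonlinearity is a contraction in a weighted norm. -/
theorem IsSmoothing.exists_contraction_rate (hS : IsSmoothing S β C T) (L : NNReal) :
    ∃ l : ℝ, 0 < l ∧ ∀ T' ≤ T, ∀ (R : E → F) (K : Set E), LipschitzOnWith L R K →
      ∀ Y Y' : ℝ → E, ContinuousOn Y (Icc 0 T') → ContinuousOn Y' (Icc 0 T') →
      MapsTo Y (Icc 0 T') K → MapsTo Y' (Icc 0 T') K → ∀ ρ, 0 ≤ ρ →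
      (∀ s ∈ Icc 0 T', ‖Y s - Y' s‖ ≤ ρ * Real.exp (l * s)) → ∀ t ∈ Icc 0 T',
      ‖duhamel S (fun s => R (Y s)) t - duhamel S (fun s => R (Y' s)) t‖
        ≤ ρ / 2 * Real.exp (l * t) := by
  -- Chosen so that multiplication by the Lipschitz constant leaves a factor at most `1/2`.
  obtain ⟨l, hl, h⟩ := hS.exists_weight (show 0 < 1 / (2 * ((L : ℝ) + 1)) by positivity)
  refine ⟨l, hl, fun T' hT' R K hR Y Y' hY hY' hYK hY'K ρ hρ hd t ht => ?_⟩
  have htT : t ∈ Icc 0 T := ⟨ht.1, ht.2.trans hT'⟩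
  have hsub : Icc 0 t ⊆ Icc 0 T' := Icc_subset_Icc_right ht.2
  rw [hS.duhamel_sub (f := fun s => R (Y s)) (g := fun s => R (Y' s)) htT
    ((hR.continuousOn.comp hY hYK).mono hsub) ((hR.continuousOn.comp hY' hY'K).mono hsub)]
  refine (h t htT _ (L * ρ) (by positivity) fun s hs => ?_).trans ?_
  · have h1 := hR.dist_le_mul _ (hYK (hsub hs)) _ (hY'K (hsub hs))
    rw [dist_eq_norm, dist_eq_norm] at h1
    exact (h1.trans (mul_le_mul_of_nonneg_left (hd s (hsub hs)) L.2)).trans_eq (by ring)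
  · refine mul_le_mul_of_nonneg_right ?_ (Real.exp_pos _).le
    rw [show 1 / (2 * ((L : ℝ) + 1)) * (L * ρ) = (L / (L + 1)) * (ρ / 2) by field_simp]
    refine mul_le_of_le_one_left (by positivity) ?_
    rw [div_le_one (by positivity)]
    linarith

/-- Solutions of the integral equation depend in a Lipschitz way on the inhomogeneity. -/
theorem IsSmoothing.exists_stability (hS : IsSmoothing S β C T) (L : NNReal) :
    ∃ D : ℝ, 0 ≤ D ∧ ∀ (R : E → F) (K : Set E), LipschitzOnWith L R K →
      ∀ Y Y' H H' : ℝ → E, ContinuousOn Y (Icc 0 T) → ContinuousOn Y' (Icc 0 T) →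
      MapsTo Y (Icc 0 T) K → MapsTo Y' (Icc 0 T) K →
      (∀ t ∈ Icc 0 T, Y t = H t + duhamel S (fun s => R (Y s)) t) →
      (∀ t ∈ Icc 0 T, Y' t = H' t + duhamel S (fun s => R (Y' s)) t) → ∀ η,
      (∀ t ∈ Icc 0 T, ‖H t - H' t‖ ≤ η) → ∀ t ∈ Icc 0 T, ‖Y t - Y' t‖ ≤ D * η := by
  obtain ⟨l, hl, h⟩ := hS.exists_contraction_rate L
  refine ⟨2 * Real.exp (l * T), by positivity,
    fun R K hR Y Y' H H' hY hY' hYK hY'K hYe hY'e η hη t ht => ?_⟩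
  have hcont : ContinuousOn (fun s => ‖Y s - Y' s‖ * Real.exp (-(l * s))) (Icc 0 T) :=
    (hY.sub hY').norm.mul (by fun_prop)
  -- `ρ` is the weighted distance of the two solutions, attained at `s₀`.
  obtain ⟨s₀, hs₀, hmax⟩ := isCompact_Icc.exists_isMaxOn ⟨t, ht⟩ hcont
  set ρ := ‖Y s₀ - Y' s₀‖ * Real.exp (-(l * s₀)) with hρ
  have hee : ∀ s : ℝ, Real.exp (-(l * s)) * Real.exp (l * s) = 1 := fun s => by
    rw [← Real.exp_add]; simp
  have hd : ∀ s ∈ Icc 0 T, ‖Y s - Y' s‖ ≤ ρ * Real.exp (l * s) := fun s hs => by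
    have : ‖Y s - Y' s‖ * Real.exp (-(l * s)) * Real.exp (l * s) ≤ ρ * Real.exp (l * s) :=
      mul_le_mul_of_nonneg_right (hmax hs) (Real.exp_pos (l * s)).le
    rwa [mul_assoc, hee, mul_one] at this
  have hη0 : 0 ≤ η := (norm_nonneg _).trans (hη t ht)
  have h1 := h T le_rfl R K hR Y Y' hY hY' hYK hY'K ρ (by positivity) hd s₀ hs₀
  have h2 : ‖Y s₀ - Y' s₀‖ ≤ η + ρ / 2 * Real.exp (l * s₀) := by
    rw [hYe s₀ hs₀, hY'e s₀ hs₀, add_sub_add_comm]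
    exact (norm_add_le _ _).trans (add_le_add (hη s₀ hs₀) h1)
  -- Evaluating the equations at the maximum point lets `ρ / 2` be absorbed, so `ρ ≤ 2η`.
  have h3 : ρ ≤ η + ρ / 2 := by
    have e1 : Real.exp (-(l * s₀)) ≤ 1 :=
      Real.exp_le_one_iff.2 (neg_nonpos.2 (mul_nonneg hl.le hs₀.1))
    calc ρ ≤ (η + ρ / 2 * Real.exp (l * s₀)) * Real.exp (-(l * s₀)) :=
          mul_le_mul_of_nonneg_right h2 (Real.exp_pos _).le
      _ = η * Real.exp (-(l * s₀)) + ρ / 2 * (Real.exp (-(l * s₀)) * Real.exp (l * s₀)) := by ring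
      _ ≤ η + ρ / 2 := by
        rw [hee, mul_one]
        have := mul_le_mul_of_nonneg_left e1 hη0
        linarith
  have h4 : Real.exp (l * t) ≤ Real.exp (l * T) :=
    Real.exp_le_exp.2 (mul_le_mul_of_nonneg_left ht.2 hl.le)
  calc ‖Y t - Y' t‖ ≤ ρ * Real.exp (l * t) := hd t ht
    _ ≤ 2 * η * Real.exp (l * T) := mul_le_mul (by linarith) h4 (by positivity) (by positivity)
    _ = _ := by ring

/-- A path which almost solves the integral equation is close to a solution. -/
theorem IsSmoothing.exists_solution [CompleteSpace E] (hS : IsSmoothing S β C T) (L : NNReal)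
    {δ : ℝ} (hδ : 0 < δ) :
    ∃ ρ : ℝ, 0 < ρ ∧ ∀ T', 0 ≤ T' → T' ≤ T → ∀ (R : E → F) (K : Set E), LipschitzOnWith L R K →
      ∀ Z H : ℝ → E, ContinuousOn Z (Icc 0 T') → ContinuousOn H (Icc 0 T') →
      (∀ t ∈ Icc 0 T', Metric.closedBall (Z t) δ ⊆ K) →
      (∀ t ∈ Icc 0 T', ‖H t + duhamel S (fun s => R (Z s)) t - Z t‖ ≤ ρ) →
      ∃ Y : ℝ → E, ContinuousOn Y (Icc 0 T') ∧ (∀ t ∈ Icc 0 T', ‖Y t - Z t‖ ≤ δ) ∧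
        ∀ t ∈ Icc 0 T', Y t = H t + duhamel S (fun s => R (Y s)) t := by
  obtain ⟨l, hl, h⟩ := hS.exists_contraction_rate L
  -- A weighted ball of radius `r` lies in the unweighted ball of radius `δ`. A residual of at most
  -- `r / 2` together with the contraction factor `1/2` then maps this ball into itself.
  set r := δ * Real.exp (-(l * T)) with hr
  have hr0 : 0 < r := by positivity
  refine ⟨r / 2, by positivity, fun T' hT0 hT' R K hR Z H hZ hH hball hres => ?_⟩
  have hee : ∀ s : ℝ, Real.exp (-(l * s)) * Real.exp (l * s) = 1 := fun s => by
    rw [← Real.exp_add]; simp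
  set B : Set C(Icc 0 T', E) := Metric.closedBall 0 r with hB
  have hBc : CompleteSpace B := Metric.isClosed_closedBall.isComplete.completeSpace_coe
  have hBn : Nonempty B := ⟨⟨0, Metric.mem_closedBall_self hr0.le⟩⟩
  -- The unknown is `Y = Z + e^(lt) W`, so that the ordinary sup norm of `W` is the weighted norm of
  -- `Y - Z`.
  let Yf : C(Icc 0 T', E) → ℝ → E := fun W t =>
    Z t + Real.exp (l * t) • IccExtend hT0 W t
  have hYc : ∀ W, ContinuousOn (Yf W) (Icc 0 T') := fun W =>
    hZ.add (ContinuousOn.smul (by fun_prop) W.continuous.Icc_extend'.continuousOn)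
  have hWle : ∀ W ∈ B, ∀ t, ‖IccExtend hT0 W t‖ ≤ r := fun W hW t => by
    have := (W.norm_coe_le_norm (projIcc 0 T' hT0 t)).trans (mem_closedBall_zero_iff.1 hW)
    exact this
  have hYδ : ∀ W ∈ B, ∀ t ∈ Icc 0 T', ‖Yf W t - Z t‖ ≤ δ := fun W hW t ht => by
    have e1 : Yf W t - Z t = Real.exp (l * t) • IccExtend hT0 W t := add_sub_cancel_left _ _
    rw [e1, norm_smul, Real.norm_eq_abs, abs_of_pos (Real.exp_pos _)]
    have e2 : Real.exp (l * t) ≤ Real.exp (l * T) :=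
      Real.exp_le_exp.2 (mul_le_mul_of_nonneg_left (ht.2.trans hT') hl.le)
    calc _ ≤ Real.exp (l * T) * r :=
          mul_le_mul e2 (hWle W hW t) (norm_nonneg _) (Real.exp_pos _).le
      _ = δ * (Real.exp (-(l * T)) * Real.exp (l * T)) := by rw [hr]; ring
      _ = δ := by rw [hee, mul_one]
  have hYK : ∀ W ∈ B, MapsTo (Yf W) (Icc 0 T') K := fun W hW t ht =>
    hball t ht (by rw [Metric.mem_closedBall, dist_eq_norm]; exact hYδ W hW t ht)
  have hZK : MapsTo Z (Icc 0 T') K := fun t ht => hball t ht (Metric.mem_closedBall_self hδ.le)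
  let Φ : C(Icc 0 T', E) → ℝ → E := fun W t =>
    Real.exp (-(l * t)) • (H t + duhamel S (fun s => R (Yf W s)) t - Z t)
  have hΦc : ∀ W ∈ B, ContinuousOn (Φ W) (Icc 0 T') := fun W hW =>
    ContinuousOn.smul (by fun_prop) ((hH.add ((hS.mono hT').continuousOn_duhamel
      (hR.continuousOn.comp (hYc W) (hYK W hW)))).sub hZ)
  have hΦB : ∀ W ∈ B, ∀ t ∈ Icc 0 T', ‖Φ W t‖ ≤ r := fun W hW t ht => by
    have e1 := h T' hT' R K hR _ _ (hYc W) hZ (hYK W hW) hZK r hr0.le (fun s hs => by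
      have : Yf W s - Z s = Real.exp (l * s) • IccExtend hT0 W s := add_sub_cancel_left _ _
      rw [this, norm_smul, Real.norm_eq_abs, abs_of_pos (Real.exp_pos _), mul_comm]
      exact mul_le_mul_of_nonneg_right (hWle W hW s) (Real.exp_pos _).le) t ht
    have e2 := hres t ht
    rw [norm_smul, Real.norm_eq_abs, abs_of_pos (Real.exp_pos _)]
    have e3 : ‖H t + duhamel S (fun s => R (Yf W s)) t - Z t‖
        ≤ r / 2 + r / 2 * Real.exp (l * t) := by
      rw [show H t + duhamel S (fun s => R (Yf W s)) t - Z t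
        = (H t + duhamel S (fun s => R (Z s)) t - Z t) + (duhamel S (fun s => R (Yf W s)) t
          - duhamel S (fun s => R (Z s)) t) by abel]
      exact (norm_add_le _ _).trans (add_le_add e2 e1)
    have e4 : Real.exp (-(l * t)) ≤ 1 :=
      Real.exp_le_one_iff.2 (neg_nonpos.2 (mul_nonneg hl.le ht.1))
    calc _ ≤ Real.exp (-(l * t)) * (r / 2 + r / 2 * Real.exp (l * t)) :=
          mul_le_mul_of_nonneg_left e3 (Real.exp_pos _).le
      _ = Real.exp (-(l * t)) * (r / 2) + r / 2 * (Real.exp (-(l * t)) * Real.exp (l * t)) := by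
        ring
      _ ≤ 1 * (r / 2) + r / 2 * 1 := by
        rw [hee]
        gcongr
      _ = r := by ring
  let Ψ : B → B := fun W => ⟨⟨(Icc 0 T').domRestrict (Φ W), (hΦc W W.2).domRestrict⟩, by
    refine mem_closedBall_zero_iff.2 ((ContinuousMap.norm_le _ hr0.le).2 ?_)
    exact fun t => hΦB W W.2 t t.2⟩
  have hΨ : ContractingWith (1 / 2) Ψ := by
    refine ⟨by norm_num, LipschitzWith.of_dist_le_mul fun W W' => ?_⟩
    rw [Subtype.dist_eq, Subtype.dist_eq, ContinuousMap.dist_le (by positivity)]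
    intro t
    have e1 := h T' hT' R K hR _ _ (hYc W) (hYc W') (hYK W W.2) (hYK W' W'.2)
      (dist (W : C(Icc 0 T', E)) W') dist_nonneg (fun s hs => by
        have : Yf W s - Yf W' s
            = Real.exp (l * s) • (IccExtend hT0 W.1 s - IccExtend hT0 W'.1 s) := by
          simp only [Yf, smul_sub]; abel
        rw [this, norm_smul, Real.norm_eq_abs, abs_of_pos (Real.exp_pos _), mul_comm,
          ← dist_eq_norm]
        exact mul_le_mul_of_nonneg_right (ContinuousMap.dist_apply_le_dist _)
          (Real.exp_pos _).le) t t.2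
    change dist (Φ W t) (Φ W' t) ≤ _
    have e2 : Φ W t - Φ W' t = Real.exp (-(l * t)) • (duhamel S (fun s => R (Yf W s)) t
        - duhamel S (fun s => R (Yf W' s)) t) := by
      simp only [Φ, ← smul_sub]
      congr 1
      abel
    rw [dist_eq_norm, e2, norm_smul, Real.norm_eq_abs, abs_of_pos (Real.exp_pos _)]
    calc _ ≤ Real.exp (-(l * t)) * (dist (W : C(Icc 0 T', E)) W' / 2 * Real.exp (l * t)) :=
          mul_le_mul_of_nonneg_left e1 (Real.exp_pos _).le
      _ = dist (W : C(Icc 0 T', E)) W' / 2 * (Real.exp (-(l * t)) * Real.exp (l * t)) := by ring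
      _ = _ := by rw [hee]; push_cast; ring
  set W := ContractingWith.fixedPoint Ψ hΨ
  have hW : Ψ W = W := hΨ.fixedPoint_isFixedPt
  refine ⟨Yf W, hYc W, hYδ W W.2, fun t ht => ?_⟩
  have e1 : Φ W t = W.1 ⟨t, ht⟩ := congrArg (fun V : B => V.1 ⟨t, ht⟩) hW
  have e2 : Yf W t = Z t + Real.exp (l * t) • Φ W t := by
    rw [e1]
    simp only [Yf, IccExtend_of_mem _ _ ht]
  rw [e2]
  simp only [Φ]
  rw [smul_smul, mul_comm, hee, one_smul]
  abel

end Duhamel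

/-! ### Mild solutions -/

section Mild

variable {γ T : ℝ} {X₀ : HolderSpace 1 γ} {X Y : ℝ → HolderSpace 1 γ}

/-- The operators which make up the mild formulation, between Hölder spaces: the remainder as a
locally Lipschitz map, and the semigroup on rough and on regular functions. -/
structure Evolution (γ : ℝ) where
  /-- The exponent of the space in which the remainder takes its values. -/
  α : ℝ
  /-- The remainder. -/
  R : HolderSpace 1 γ → HolderSpace 0 α
  /-- The semigroup at positive times, as a smoothing operator. -/
  S : ℝ → HolderSpace 0 α →L[ℝ] HolderSpace 1 γ
  /-- The semigroup on `C^{1,γ}`. -/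
  heat : ℝ → HolderSpace 1 γ →L[ℝ] HolderSpace 1 γ
  /-- The strength of the singularity of the smoothing operator. -/
  β : ℝ
  pos : 0 < γ
  lt : γ < α
  lt_one : α < 1
  R_apply : ∀ X : HolderSpace 1 γ, 0 < arcChord X → ∀ θ, R X θ = remainder X θ
  R_lipschitz : ∀ M m : ℝ, 0 < m →
    ∃ L : NNReal, LipschitzOnWith L R {X | ‖X‖ ≤ M ∧ m ≤ arcChord X}
  S_apply : ∀ t, 0 < t → ∀ u θ, S t u θ = semigroup t u θ
  S_smoothing : ∀ T, 0 < T → ∃ C, IsSmoothing S β C T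
  heat_apply : ∀ t, 0 ≤ t → ∀ u θ, heat t u θ = semigroup t u θ
  heat_bound : ∀ t u, ‖heat t u‖ ≤ 3 * ‖u‖
  heat_continuousOn : ∀ u ∈ littleHolder γ, ContinuousOn (fun t => heat t u) (Ici 0)

theorem exists_evolution (hγ : 0 < γ) (hγ1 : γ < 1) : Nonempty (Evolution γ) := by
  -- The loss from `C^{0,α}` to `C^{1,γ}` is integrable in time because `α > γ`; the remainder gains
  -- this regularity as `α < 2γ`.
  obtain ⟨α, h1, h2, h3⟩ : ∃ α, γ < α ∧ α < 1 ∧ α < 2 * γ := by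
    obtain ⟨α, h1, h2⟩ := exists_between (show γ < min 1 (2 * γ) from
      lt_min hγ1 (by linarith))
    exact ⟨α, h1, lt_min_iff.1 h2⟩
  obtain ⟨R, hR, hRL⟩ := exists_remainderMap hγ h1 h2 h3
  obtain ⟨S, β, hβ0, hβ1, hS, hSc, hSb⟩ := exists_semigroupMap hγ h1 h2
  obtain ⟨W, hW, hWb, hWc⟩ := exists_heatMap hγ hγ1
  refine ⟨⟨α, R, S, W, β, hγ, h1, h2, hR, hRL, fun t ht u θ => ?_, fun T hT => ?_, hW, hWb, hWc⟩⟩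
  · rw [hS t ht, semigroup_eq_conv ht u.periodic]
  · obtain ⟨C, hC0, hC⟩ := hSb T hT
    exact ⟨C, hβ0, hβ1, hC0, hSc, hC⟩

/-- Compactness of the time interval places the whole path in one of the sets on which the remainder
is Lipschitz. On an empty interval any `m` is admissible. -/
theorem exists_bounds_of_path (hX : ContinuousOn X (Icc 0 T))
    (hpos : ∀ t ∈ Icc 0 T, 0 < arcChord (X t)) :
    ∃ M m : ℝ, 0 < m ∧ ∀ t ∈ Icc 0 T, ‖X t‖ ≤ M ∧ m ≤ arcChord (X t) := by
  obtain ⟨M, hM⟩ := isCompact_Icc.exists_bound_of_continuousOn hX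
  rcases (Icc (0 : ℝ) T).eq_empty_or_nonempty with he | hne
  · exact ⟨M, 1, one_pos, fun t ht => by simp [he] at ht⟩
  · obtain ⟨t₀, ht₀, hmin⟩ := isCompact_Icc.exists_isMinOn hne
      (continuous_arcChord.comp_continuousOn hX)
    exact ⟨M, arcChord (X t₀), hpos t₀ ht₀, fun t ht => ⟨hM t ht, hmin ht⟩⟩

/-! ### Existence, uniqueness and dependence on the initial value. -/

namespace Evolution

variable (V : Evolution γ)

theorem continuousOn_R (hX : ContinuousOn X (Icc 0 T))
    (hpos : ∀ t ∈ Icc 0 T, 0 < arcChord (X t)) :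
    ContinuousOn (fun s => V.R (X s)) (Icc 0 T) := by
  obtain ⟨M, m, hm, h⟩ := exists_bounds_of_path hX hpos
  obtain ⟨L, hL⟩ := V.R_lipschitz M m hm
  exact hL.continuousOn.comp hX h

theorem heat_zero (u : HolderSpace 1 γ) : V.heat 0 u = u :=
  HolderSpace.ext fun θ => by rw [V.heat_apply 0 le_rfl, semigroup, if_pos rfl]

/-- `S` is prescribed only at positive times, so `s = t` has to be excluded. -/
theorem ae_S_apply (hpos : ∀ t ∈ Icc 0 T, 0 < arcChord (X t)) {t : ℝ} (ht : t ∈ Icc 0 T) (θ : ℝ) :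
    ∀ᵐ s : ℝ, s ∈ uIoc 0 t → evalCLM 1 γ θ (V.S (t - s) (V.R (X s)))
      = semigroup (t - s) (remainder (X s)) θ := by
  have h0 : ∀ᵐ s : ℝ, s ≠ t := by simp [ae_iff, measure_singleton]
  filter_upwards [h0] with s hst hs
  rw [uIoc_of_le ht.1] at hs
  have hR : (V.R (X s) : ℝ → Plane) = remainder (X s) :=
    funext (V.R_apply _ (hpos s ⟨hs.1.le, hs.2.trans ht.2⟩))
  rw [evalCLM_apply, V.S_apply _ (sub_pos.2 (lt_of_le_of_ne hs.2 hst)), hR]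

/-- The mild formulation as an equation in `C^{1,γ}`. -/
theorem isMildSolution_iff (V : Evolution γ) (hT : 0 < T) : IsMildSolution T X₀ X ↔
    ContinuousOn X (Icc 0 T) ∧ (∀ t ∈ Icc 0 T, 0 < arcChord (X t)) ∧
      ∀ t ∈ Icc 0 T, X t = V.heat t X₀ + duhamel V.S (fun s => V.R (X s)) t := by
  have := completeSpace_holder_one V.pos
  obtain ⟨C, hS⟩ := V.S_smoothing T hT
  have hint : ContinuousOn X (Icc 0 T) → (∀ t ∈ Icc 0 T, 0 < arcChord (X t)) → ∀ t ∈ Icc 0 T,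
      IntervalIntegrable (fun s => V.S (t - s) (V.R (X s))) volume 0 t := fun hX hpos t ht =>
    hS.intervalIntegrable ht ((V.continuousOn_R hX hpos).mono (Icc_subset_Icc_right ht.2))
  -- Evaluation at `θ` is a continuous linear functional and commutes with the Bochner integral.
  -- This links the vector-valued equation with the pointwise one.
  have heval : ContinuousOn X (Icc 0 T) → (∀ t ∈ Icc 0 T, 0 < arcChord (X t)) → ∀ t ∈ Icc 0 T,
      ∀ θ, (V.heat t X₀ + duhamel V.S (fun s => V.R (X s)) t) θ = semigroup t X₀ θ
        + ∫ s in (0 : ℝ)..t, semigroup (t - s) (remainder (X s)) θ := fun hX hpos t ht θ => by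
    rw [HolderSpace.coe_add, V.heat_apply t ht.1, duhamel, ← evalCLM_apply,
      ← (evalCLM 1 γ θ).intervalIntegral_comp_comm (hint hX hpos t ht),
      intervalIntegral.integral_congr_ae (V.ae_S_apply hpos ht θ)]
  constructor
  · intro h
    refine ⟨h.continuousOn, h.arcChord_pos, fun t ht => ?_⟩
    rcases ht.1.eq_or_lt with rfl | ht0
    · rw [h.initial, V.heat_zero, duhamel, intervalIntegral.integral_same, add_zero]
    · exact HolderSpace.ext fun θ => by
        rw [h.eqn t ⟨ht0, ht.2⟩, heval h.continuousOn h.arcChord_pos t ht]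
  · rintro ⟨hX, hpos, heq⟩
    have h0 : X 0 = X₀ := by
      rw [heq 0 ⟨le_rfl, hT.le⟩, V.heat_zero, duhamel, intervalIntegral.integral_same, add_zero]
    refine ⟨hX, hpos, h0, ?_, fun t ht θ => ?_, fun t ht θ => ?_⟩
    · have h1 := hX 0 ⟨le_rfl, hT.le⟩
      rw [ContinuousWithinAt, h0] at h1
      refine h1.mono_left ?_
      rw [← nhdsWithin_Ioc_eq_nhdsGT hT]
      exact nhdsWithin_mono _ Ioc_subset_Icc_self
    · have ht' : t ∈ Icc 0 T := ⟨ht.1.le, ht.2⟩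
      have h1 : IntervalIntegrable (fun s => evalCLM 1 γ θ (V.S (t - s) (V.R (X s)))) volume 0 t :=
        ⟨(evalCLM 1 γ θ).integrable_comp (hint hX hpos t ht').1,
          (evalCLM 1 γ θ).integrable_comp (hint hX hpos t ht').2⟩
      refine h1.congr_ae ?_
      rw [EventuallyEq, ae_restrict_iff' measurableSet_uIoc]
      exact V.ae_S_apply hpos ht' θ
    · have ht' : t ∈ Icc 0 T := ⟨ht.1.le, ht.2⟩
      rw [← heval hX hpos t ht' θ, ← heq t ht']

/-- With radius half the arc-chord bound, half of that bound survives on the ball. -/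
theorem closedBall_subset {Z : HolderSpace 1 γ} {M m : ℝ} (hZ : ‖Z‖ ≤ M ∧ m ≤ arcChord Z) :
    Metric.closedBall Z (m / 2) ⊆ {Y | ‖Y‖ ≤ M + m / 2 ∧ m / 2 ≤ arcChord Y} := fun Y hY => by
  rw [Metric.mem_closedBall, dist_eq_norm] at hY
  have h1 := arcChord_sub_norm_le Z Y
  rw [norm_sub_rev] at h1
  have h2 : ‖Y‖ ≤ ‖Y - Z‖ + ‖Z‖ := by simpa using norm_add_le (Y - Z) Z
  exact ⟨by linarith [hZ.1], by linarith [hZ.2]⟩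

/-- Local existence of mild solutions. -/
theorem exists_isMildSolution (V : Evolution γ) (hX₀ : X₀ ∈ littleHolder γ)
    (hpos : 0 < arcChord X₀) :
    ∃ T : ℝ, 0 < T ∧ ∃ X : ℝ → HolderSpace 1 γ, IsMildSolution T X₀ X := by
  have := completeSpace_holder_one V.pos
  set m := arcChord X₀ with hm
  obtain ⟨L, hL⟩ := V.R_lipschitz (‖X₀‖ + m / 2) (m / 2) (by positivity)
  -- A reference interval: the admissible residual `ρ` must be fixed before the time of existence is
  -- chosen.
  obtain ⟨C, hS⟩ := V.S_smoothing 1 one_pos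
  obtain ⟨ρ, hρ, hsol⟩ := hS.exists_solution L (show 0 < m / 2 by positivity)
  have hball := closedBall_subset (Z := X₀) ⟨le_rfl, hm.le⟩
  have hH : ContinuousOn (fun t => V.heat t X₀) (Ici 0) := V.heat_continuousOn X₀ hX₀
  -- The residual of the constant path `X₀` is continuous and vanishes at time `0`, so it stays
  -- below `ρ` for a short time.
  have hcont : ContinuousOn (fun t => V.heat t X₀ + duhamel V.S (fun _ => V.R X₀) t)
      (Icc 0 1) := (hH.mono Icc_subset_Ici_self).add (hS.continuousOn_duhamel continuousOn_const)
  obtain ⟨η, hη, hη'⟩ := Metric.continuousOn_iff.1 hcont 0 ⟨le_rfl, zero_le_one⟩ ρ hρ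
  set T := min 1 (η / 2) with hTdef
  have hT : 0 < T := lt_min one_pos (by positivity)
  have hT1 : T ≤ 1 := min_le_left _ _
  refine ⟨T, hT, ?_⟩
  obtain ⟨Y, hY, hYZ, hYe⟩ := hsol T hT.le hT1 V.R _ hL (fun _ => X₀) (fun t => V.heat t X₀)
    continuousOn_const (hH.mono Icc_subset_Ici_self) (fun _ _ => hball) fun t ht => by
      have h1 := hη' t ⟨ht.1, ht.2.trans hT1⟩ (by
        rw [dist_zero_right, Real.norm_eq_abs, abs_of_nonneg ht.1]
        have := ht.2.trans (min_le_right _ _)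
        linarith)
      rw [V.heat_zero, duhamel, duhamel, intervalIntegral.integral_same, add_zero,
        dist_eq_norm] at h1
      exact h1.le
  refine ⟨Y, (V.isMildSolution_iff hT).2 ⟨hY, fun t ht => ?_, hYe⟩⟩
  have h1 := (hball (by rw [Metric.mem_closedBall, dist_eq_norm]; exact hYZ t ht)).2
  exact lt_of_lt_of_le (by positivity) h1

theorem exists_common_bounds (hX : ContinuousOn X (Icc 0 T))
    (hXp : ∀ t ∈ Icc 0 T, 0 < arcChord (X t)) (hY : ContinuousOn Y (Icc 0 T))
    (hYp : ∀ t ∈ Icc 0 T, 0 < arcChord (Y t)) :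
    ∃ M m : ℝ, 0 < m ∧ MapsTo X (Icc 0 T) {Z | ‖Z‖ ≤ M ∧ m ≤ arcChord Z} ∧
      MapsTo Y (Icc 0 T) {Z | ‖Z‖ ≤ M ∧ m ≤ arcChord Z} := by
  obtain ⟨M, m, hm, h⟩ := exists_bounds_of_path hX hXp
  obtain ⟨M', m', hm', h'⟩ := exists_bounds_of_path hY hYp
  exact ⟨max M M', min m m', lt_min hm hm',
    fun t ht => ⟨(h t ht).1.trans (le_max_left _ _), (min_le_left _ _).trans (h t ht).2⟩,
    fun t ht => ⟨(h' t ht).1.trans (le_max_right _ _), (min_le_right _ _).trans (h' t ht).2⟩⟩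

/-- Uniqueness of mild solutions. -/
theorem eqOn_of_isMildSolution (V : Evolution γ) (hT : 0 < T) (hX : IsMildSolution T X₀ X)
    (hY : IsMildSolution T X₀ Y) : EqOn X Y (Icc 0 T) := fun t ht => by
  obtain ⟨M, m, hm, hXm, hYm⟩ :=
    exists_common_bounds hX.continuousOn hX.arcChord_pos hY.continuousOn hY.arcChord_pos
  obtain ⟨L, hL⟩ := V.R_lipschitz M m hm
  obtain ⟨C, hS⟩ := V.S_smoothing T hT
  obtain ⟨D, -, hD⟩ := hS.exists_stability L
  -- Equal initial values make the inhomogeneities coincide, so stability applies with `η = 0`.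
  have h := hD V.R _ hL X Y (fun t => V.heat t X₀) (fun t => V.heat t X₀) hX.continuousOn
    hY.continuousOn hXm hYm ((V.isMildSolution_iff hT).1 hX).2.2
    ((V.isMildSolution_iff hT).1 hY).2.2 0 (fun t _ => by rw [sub_self, norm_zero]) t ht
  rw [mul_zero] at h
  exact sub_eq_zero.1 (norm_le_zero_iff.1 h)

/-- Stability of mild solutions: the interval of existence is lower semicontinuous and the
solution depends continuously on the initial value. -/
theorem exists_continuous_dependence (V : Evolution γ) (hT : 0 < T)
    (hX : IsMildSolution T X₀ X) :
    ∃ ε : ℝ, 0 < ε ∧ ∃ Φ : HolderSpace 1 γ → C(Icc 0 T, HolderSpace 1 γ),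
      (∀ Y₀ ∈ littleHolder γ, ‖X₀ - Y₀‖ ≤ ε → IsMildSolution T Y₀ (IccExtend hT.le (Φ Y₀))) ∧
      ContinuousOn Φ {Y₀ | Y₀ ∈ littleHolder γ ∧ ‖X₀ - Y₀‖ ≤ ε} := by
  have := completeSpace_holder_one V.pos
  obtain ⟨M, m, hm, hXm⟩ := exists_bounds_of_path hX.continuousOn hX.arcChord_pos
  obtain ⟨L, hL⟩ := V.R_lipschitz (M + m / 2) (m / 2) (by positivity)
  obtain ⟨C, hS⟩ := V.S_smoothing T hT
  obtain ⟨ρ, hρ, hsol⟩ := hS.exists_solution L (show 0 < m / 2 by positivity)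
  obtain ⟨D, hD0, hD⟩ := hS.exists_stability L
  have hball : ∀ t ∈ Icc 0 T, Metric.closedBall (X t) (m / 2)
      ⊆ {Y | ‖Y‖ ≤ M + m / 2 ∧ m / 2 ≤ arcChord Y} := fun t ht => closedBall_subset (hXm t ht)
  have hXe := ((V.isMildSolution_iff hT).1 hX).2.2
  have hH : ∀ Y₀ ∈ littleHolder γ, ContinuousOn (fun t => V.heat t Y₀) (Icc 0 T) :=
    fun Y₀ hY₀ => (V.heat_continuousOn Y₀ hY₀).mono Icc_subset_Ici_self
  -- Outside the admissible set the value is irrelevant and `0` is taken. The arc-chord bound is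
  -- recorded because stability needs all solutions in the same set.
  have hex : ∀ Y₀, ∃ F : C(Icc 0 T, HolderSpace 1 γ), Y₀ ∈ littleHolder γ ∧ ‖X₀ - Y₀‖ ≤ ρ / 3 →
      MapsTo (IccExtend hT.le F) (Icc 0 T) {Y | ‖Y‖ ≤ M + m / 2 ∧ m / 2 ≤ arcChord Y} ∧
      ∀ t ∈ Icc 0 T, IccExtend hT.le F t
        = V.heat t Y₀ + duhamel V.S (fun s => V.R (IccExtend hT.le F s)) t := by
    intro Y₀
    by_cases hY₀ : Y₀ ∈ littleHolder γ ∧ ‖X₀ - Y₀‖ ≤ ρ / 3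
    · obtain ⟨Y, hY, hYX, hYe⟩ := hsol T hT.le le_rfl V.R _ hL X (fun t => V.heat t Y₀)
        hX.continuousOn (hH Y₀ hY₀.1) hball fun t ht => by
          -- Since `X` solves its equation exactly, its residual for the data `Y₀` is the semigroup
          -- applied to `Y₀ - X₀`. Its norm is at most `3 ‖X₀ - Y₀‖`, which explains `ρ / 3`.
          have e : V.heat t Y₀ + duhamel V.S (fun s => V.R (X s)) t - X t
              = -(V.heat t (X₀ - Y₀)) := by
            conv_lhs => rw [hXe t ht]
            rw [map_sub]
            abel
          rw [e, norm_neg]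
          linarith [V.heat_bound t (X₀ - Y₀), hY₀.2]
      have hFe : ∀ t ∈ Icc 0 T, IccExtend hT.le ((Icc 0 T).domRestrict Y) t = Y t := fun t ht => by
        rw [IccExtend_of_mem _ _ ht]
        rfl
      refine ⟨⟨(Icc 0 T).domRestrict Y, hY.domRestrict⟩, fun _ => ⟨fun t ht => ?_, fun t ht => ?_⟩⟩
      · rw [ContinuousMap.coe_mk, hFe t ht]
        exact hball t ht (by rw [Metric.mem_closedBall, dist_eq_norm]; exact hYX t ht)
      · rw [ContinuousMap.coe_mk, hFe t ht, hYe t ht]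
        congr 1
        exact duhamel_congr ht.1 fun s hs => by rw [hFe s ⟨hs.1, hs.2.trans ht.2⟩]
    · exact ⟨0, fun h => absurd h hY₀⟩
  choose Φ hΦ using hex
  have hΦc : ∀ Y₀, ContinuousOn (IccExtend hT.le (Φ Y₀)) (Icc 0 T) := fun Y₀ =>
    (Φ Y₀).continuous.Icc_extend'.continuousOn
  refine ⟨ρ / 3, by positivity, Φ, fun Y₀ hY₀ hYε => ?_, ?_⟩
  · obtain ⟨h1, h2⟩ := hΦ Y₀ ⟨hY₀, hYε⟩
    exact (V.isMildSolution_iff hT).2 ⟨hΦc Y₀,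
      fun t ht => lt_of_lt_of_le (by positivity) (h1 ht).2, h2⟩
  · have hLip : LipschitzOnWith (D * 3).toNNReal Φ
        {Y₀ | Y₀ ∈ littleHolder γ ∧ ‖X₀ - Y₀‖ ≤ ρ / 3} := by
      refine LipschitzOnWith.of_dist_le_mul fun Y₀ hY₀ Y₁ hY₁ => ?_
      rw [Real.coe_toNNReal _ (by positivity), ContinuousMap.dist_le (by positivity)]
      intro t
      obtain ⟨a1, a2⟩ := hΦ Y₀ hY₀
      obtain ⟨b1, b2⟩ := hΦ Y₁ hY₁
      have h := hD V.R _ hL _ _ _ _ (hΦc Y₀) (hΦc Y₁) a1 b1 a2 b2 (3 * ‖Y₀ - Y₁‖)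
        (fun s _ => by rw [← map_sub]; exact V.heat_bound s _) t t.2
      rw [IccExtend_of_mem _ _ t.2, IccExtend_of_mem _ _ t.2] at h
      rw [dist_eq_norm, dist_eq_norm]
      exact h.trans_eq (by ring)
    exact hLip.continuousOn

end Evolution

end Mild

/-! ### The operator `Λ` -/

section CotKernel

variable {γ A : ℝ} {f g : ℝ → Plane}

/-- The kernel of the Hilbert transform. -/
def cotKernel (y : ℝ) : ℝ := 1 / 2 * Real.cot (y / 2)

theorem cotKernel_eq (y : ℝ) : cotKernel y = Real.cos (y / 2) / (2 * Real.sin (y / 2)) := by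
  rw [cotKernel, Real.cot_eq_cos_div_sin]
  ring

theorem cotKernel_neg (y : ℝ) : cotKernel (-y) = -cotKernel y := by
  rw [cotKernel_eq, cotKernel_eq, neg_div, Real.cos_neg, Real.sin_neg]
  ring

theorem cotKernel_periodic : Function.Periodic cotKernel (2 * Real.pi) := fun y => by
  rw [cotKernel, cotKernel, show (y + 2 * Real.pi) / 2 = y / 2 + Real.pi by ring, cot_add_pi]

theorem measurable_cotKernel : Measurable cotKernel := by
  rw [funext cotKernel_eq]
  fun_prop

theorem continuousAt_cotKernel {y : ℝ} (h0 : y ≠ 0) (h : |y| ≤ Real.pi + 1) :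
    ContinuousAt cotKernel y := by
  rw [funext cotKernel_eq]
  exact ContinuousAt.div (by fun_prop) (by fun_prop)
    (mul_ne_zero two_ne_zero (sin_half_ne_zero h0 h))

theorem abs_cotKernel_le {y : ℝ} (h0 : y ≠ 0) (h : |y| ≤ Real.pi + 1) :
    |cotKernel y| ≤ 4 * |y|⁻¹ := by
  have hy : 0 < |y| := abs_pos.2 h0
  have hs := abs_div_eight_le_abs_sin h
  have hs0 := abs_pos.2 (sin_half_ne_zero h0 h)
  rw [cotKernel_eq, abs_div, abs_mul, abs_two, div_le_iff₀ (by positivity)]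
  calc |Real.cos (y / 2)| ≤ 1 := Real.abs_cos_le_one _
    _ = 4 * |y|⁻¹ * (2 * (|y| / 8)) := by field_simp; norm_num
    _ ≤ _ := by gcongr

/-- The subtraction formula writes the difference as `sin (h/2)` over twice a product of two sines,
each bounded below linearly. -/
theorem abs_cotKernel_sub_le {y h : ℝ} (hh : 0 < h) (hh1 : h < 1) (hy : 2 * h ≤ |y|)
    (hyπ : |y| ≤ Real.pi) : |cotKernel y - cotKernel (y + h)| ≤ 32 * h * (|y| ^ 2)⁻¹ := by
  have hy0 : 0 < |y| := by linarith
  have h1 : |y| / 2 ≤ |y + h| := by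
    have := abs_sub_abs_le_abs_sub y (-h)
    rw [abs_neg, abs_of_pos hh, sub_neg_eq_add] at this
    linarith
  have h2 : |y + h| ≤ Real.pi + 1 := by
    have := abs_add_le y h
    rw [abs_of_pos hh] at this
    linarith
  have h2' : |y| ≤ Real.pi + 1 := by linarith
  have hs1 := abs_div_eight_le_abs_sin h2'
  have hs2 := abs_div_eight_le_abs_sin h2
  have n1 := sin_half_ne_zero (abs_pos.1 hy0) h2'
  have n2 := sin_half_ne_zero (abs_pos.1 (by linarith)) h2
  have e : cotKernel y - cotKernel (y + h)
      = Real.sin (h / 2) / (2 * (Real.sin (y / 2) * Real.sin ((y + h) / 2))) := by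
    have e1 : Real.sin (h / 2) = Real.sin ((y + h) / 2) * Real.cos (y / 2)
        - Real.cos ((y + h) / 2) * Real.sin (y / 2) := by
      rw [← Real.sin_sub]; congr 1; ring
    rw [cotKernel_eq, cotKernel_eq, e1]
    field_simp
  have e2 : |Real.sin (h / 2)| ≤ h / 2 := by
    have := Real.abs_sin_le_abs (x := h / 2)
    rwa [abs_of_pos (show 0 < h / 2 by positivity)] at this
  rw [e, abs_div, abs_mul, abs_two, abs_mul, div_le_iff₀ (by positivity)]
  calc |Real.sin (h / 2)| ≤ h / 2 := e2
    _ = 32 * h * (|y| ^ 2)⁻¹ * (2 * (|y| / 8 * (|y| / 2 / 8))) := by field_simp; norm_num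
    _ ≤ 32 * h * (|y| ^ 2)⁻¹ * (2 * (|Real.sin (y / 2)| * |Real.sin ((y + h) / 2)|)) := by
      have : |y| / 2 / 8 ≤ |Real.sin ((y + h) / 2)| := by linarith
      gcongr

theorem integral_abs_rpow_symm (hγ : 0 < γ) {c : ℝ} (hc : 0 ≤ c) :
    ∫ y in (-c)..c, |y| ^ (γ - 1) = 2 * c ^ γ / γ := by
  have hi := fun a b => intervalIntegrable_abs_rpow (s := γ - 1) (by linarith) a b
  have h1 : ∫ y in (0 : ℝ)..c, |y| ^ (γ - 1) = c ^ γ / γ := by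
    rw [intervalIntegral.integral_congr (g := fun y => y ^ (γ - 1)) fun y hy => by
      rw [uIcc_of_le hc] at hy
      simp only [abs_of_nonneg hy.1], integral_rpow (Or.inl (by linarith)), sub_add_cancel,
      Real.zero_rpow hγ.ne', sub_zero]
  have h2 : ∫ y in (-c)..0, |y| ^ (γ - 1) = c ^ γ / γ := by
    have := intervalIntegral.integral_comp_neg (a := 0) (b := c) (fun y => |y| ^ (γ - 1))
    rw [neg_zero] at this
    rw [← this, ← h1]
    simp only [abs_neg]
  rw [← intervalIntegral.integral_add_adjacent_intervals (hi _ 0) (hi 0 _), h1, h2]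
  ring

theorem integral_rpow_far_le (hγ1 : γ < 1) {c : ℝ} (hc : 0 < c) (hcπ : c ≤ Real.pi) :
    ∫ y in c..Real.pi, |y| ^ (γ - 2) ≤ c ^ (γ - 1) / (1 - γ) := by
  have h1 : ∫ y in c..Real.pi, |y| ^ (γ - 2) = (Real.pi ^ (γ - 1) - c ^ (γ - 1)) / (γ - 1) := by
    rw [intervalIntegral.integral_congr (g := fun y => y ^ (γ - 2)) fun y hy => by
      rw [uIcc_of_le hcπ] at hy
      simp only [abs_of_pos (hc.trans_le hy.1)], integral_rpow (Or.inr ⟨by linarith, fun h => by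
        rw [uIcc_of_le hcπ] at h
        exact absurd h.1 (not_le.2 hc)⟩), show γ - 2 + 1 = γ - 1 by ring]
  have h2 : 0 < 1 - γ := by linarith
  have h3 : 0 ≤ Real.pi ^ (γ - 1) := by positivity
  rw [h1, ← neg_sub (c ^ (γ - 1)), ← neg_sub 1 γ, neg_div_neg_eq, neg_sub]
  gcongr
  linarith

/-- The integrand of the singular integral defining the Hilbert transform. -/
def cotIntegrand (f : ℝ → Plane) (θ y : ℝ) : Plane := cotKernel y • (f (θ - y) - f θ)

/-- The Hilbert transform, up to a constant factor. -/
def cotConv (f : ℝ → Plane) (θ : ℝ) : Plane := ∫ y in (-Real.pi)..Real.pi, cotIntegrand f θ y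

theorem norm_cotIntegrand_le (hf : ∀ θ θ', ‖f θ - f θ'‖ ≤ A * |θ - θ'| ^ γ) (θ : ℝ) {y : ℝ}
    (h0 : y ≠ 0) (h : |y| ≤ Real.pi + 1) : ‖cotIntegrand f θ y‖ ≤ 4 * A * |y| ^ (γ - 1) := by
  have h1 := hf (θ - y) θ
  rw [show θ - y - θ = -y by ring, abs_neg] at h1
  rw [cotIntegrand, norm_smul, Real.norm_eq_abs]
  calc _ ≤ 4 * |y|⁻¹ * (A * |y| ^ γ) :=
        mul_le_mul (abs_cotKernel_le h0 h) h1 (norm_nonneg _) (by positivity)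
    _ = _ := by rw [Real.rpow_sub_one (abs_pos.2 h0).ne']; ring

theorem measurable_cotIntegrand (hfc : Continuous f) (θ : ℝ) : Measurable (cotIntegrand f θ) :=
  measurable_cotKernel.smul (by fun_prop)

theorem intervalIntegrable_cotIntegrand (hγ : 0 < γ) (hfc : Continuous f)
    (hf : ∀ θ θ', ‖f θ - f θ'‖ ≤ A * |θ - θ'| ^ γ) (θ : ℝ) {a b : ℝ}
    (ha : |a| ≤ Real.pi + 1) (hb : |b| ≤ Real.pi + 1) :
    IntervalIntegrable (cotIntegrand f θ) volume a b := by
  refine ((intervalIntegrable_abs_rpow (s := γ - 1) (by linarith) a b).const_mul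
    (4 * A)).mono_fun' (measurable_cotIntegrand hfc θ).aestronglyMeasurable ?_
  rw [EventuallyLE, ae_restrict_iff' measurableSet_uIoc]
  have h0 : ∀ᵐ s : ℝ, s ≠ 0 := by simp [ae_iff, measure_singleton]
  filter_upwards [h0] with y hy0 hy
  refine norm_cotIntegrand_le hf θ hy0 (abs_le.2 ?_)
  rw [abs_le] at ha hb
  rcases le_total a b with h | h
  · rw [uIoc_of_le h] at hy
    exact ⟨by linarith [hy.1], by linarith [hy.2]⟩
  · rw [uIoc_of_ge h] at hy
    exact ⟨by linarith [hy.1], by linarith [hy.2]⟩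

/-- The majorant is integrated over the symmetric window `[-c, c]`, so one bound also covers the
asymmetric near part left by a shift. -/
theorem norm_integral_cotIntegrand_le (hγ : 0 < γ) (hA : 0 ≤ A)
    (hf : ∀ θ θ', ‖f θ - f θ'‖ ≤ A * |θ - θ'| ^ γ) (θ : ℝ) {a b c : ℝ} (hab : a ≤ b)
    (ha : -c ≤ a) (hb : b ≤ c) (hc : c ≤ Real.pi + 1) :
    ‖∫ y in a..b, cotIntegrand f θ y‖ ≤ 8 * A * c ^ γ / γ := by
  have hi := fun a b => (intervalIntegrable_abs_rpow (s := γ - 1) (by linarith) a b).const_mul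
    (4 * A)
  have h0 : ∀ᵐ s : ℝ, s ≠ 0 := by simp [ae_iff, measure_singleton]
  have h1 := intervalIntegral.norm_integral_le_of_norm_le (f := cotIntegrand f θ) hab (by
    filter_upwards [h0] with y hy0 hy
    exact norm_cotIntegrand_le hf θ hy0 (abs_le.2 ⟨by linarith [hy.1], by linarith [hy.2]⟩))
    (hi a b)
  refine h1.trans ((intervalIntegral.integral_mono_interval ha hab hb
    (Eventually.of_forall fun y => ?_) (hi (-c) c)).trans_eq ?_)
  · simp only [Pi.zero_apply]; positivity
  · rw [intervalIntegral.integral_const_mul, integral_abs_rpow_symm hγ (by linarith)]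
    ring

theorem norm_cotConv_le (hγ : 0 < γ) (hA : 0 ≤ A)
    (hf : ∀ θ θ', ‖f θ - f θ'‖ ≤ A * |θ - θ'| ^ γ) (θ : ℝ) :
    ‖cotConv f θ‖ ≤ 8 * A * Real.pi ^ γ / γ :=
  norm_integral_cotIntegrand_le hγ hA hf θ (by linarith [Real.pi_pos]) le_rfl le_rfl (by linarith)

theorem intervalIntegrable_cotKernel {a b : ℝ} (h : ∀ y ∈ uIcc a b, y ≠ 0 ∧ |y| ≤ Real.pi + 1) :
    IntervalIntegrable cotKernel volume a b :=
  ContinuousOn.intervalIntegrable fun y hy =>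
    (continuousAt_cotKernel (h y hy).1 (h y hy).2).continuousWithinAt

/-- Part of the integral away from the singularity. -/
theorem integral_cotIntegrand_sub (hγ : 0 < γ) (hγ1 : γ ≤ 1) (hfc : Continuous f)
    (hf : ∀ θ θ', ‖f θ - f θ'‖ ≤ A * |θ - θ'| ^ γ) (θ : ℝ) {h : ℝ} (hh : 0 < h) (hh1 : h < 1)
    {a b : ℝ} (hab : a ≤ b) (hy : ∀ y ∈ Icc a b, 2 * h ≤ |y| ∧ |y| ≤ Real.pi) :
    ‖(∫ y in a..b, cotIntegrand f θ y) - (∫ y in a..b, cotIntegrand f (θ + h) (y + h))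
        - (∫ y in a..b, cotKernel y) • (f (θ + h) - f θ)‖
      ≤ 64 * A * h * ∫ y in a..b, |y| ^ (γ - 2) := by
  have hab' : ∀ y ∈ Icc a b, y ≠ 0 ∧ |y| ≤ Real.pi + 1 := fun y hyI =>
    ⟨abs_pos.1 (by linarith [(hy y hyI).1]), by linarith [(hy y hyI).2]⟩
  have hA : 0 ≤ A := by
    have := (norm_nonneg _).trans (hf 1 0)
    simpa using this
  have i1 := intervalIntegrable_cotIntegrand hγ hfc hf θ (hab' a ⟨le_rfl, hab⟩).2
    (hab' b ⟨hab, le_rfl⟩).2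
  have i2 : IntervalIntegrable (fun y => cotIntegrand f (θ + h) (y + h)) volume a b := by
    have ha := (hy a ⟨le_rfl, hab⟩).2
    have hb := (hy b ⟨hab, le_rfl⟩).2
    rw [abs_le] at ha hb
    have := (intervalIntegrable_cotIntegrand hγ hfc hf (θ + h) (a := a + h) (b := b + h)
      (abs_le.2 ⟨by linarith, by linarith⟩) (abs_le.2 ⟨by linarith, by linarith⟩)).comp_add_right h
    simpa using this
  have i3 := intervalIntegrable_cotKernel (a := a) (b := b) (by rwa [uIcc_of_le hab])
  have i3' : IntervalIntegrable (fun y => cotKernel y • (f (θ + h) - f θ)) volume a b :=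
    ⟨i3.1.smul_const _, i3.2.smul_const _⟩
  rw [← intervalIntegral.integral_smul_const, ← intervalIntegral.integral_sub i1 i2,
    ← intervalIntegral.integral_sub (i1.sub i2) i3', ← intervalIntegral.integral_const_mul]
  refine intervalIntegral.norm_integral_le_of_norm_le hab (Eventually.of_forall fun y hyI => ?_) ?_
  · have hyI' : y ∈ Icc a b := ⟨hyI.1.le, hyI.2⟩
    obtain ⟨h1, h2⟩ := hy y hyI'
    have hy0 : 0 < |y| := by linarith
    -- Shifting `θ` and `y` together keeps the argument `θ - y` of `f`, so the increment falls on
    -- the kernel.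
    have e : cotIntegrand f θ y - cotIntegrand f (θ + h) (y + h) - cotKernel y • (f (θ + h) - f θ)
        = (cotKernel y - cotKernel (y + h)) • (f (θ - y) - f (θ + h)) := by
      rw [cotIntegrand, cotIntegrand, show θ + h - (y + h) = θ - y by ring]
      module
    have h3 := hf (θ - y) (θ + h)
    have h4 : |θ - y - (θ + h)| ≤ 2 * |y| := by
      rw [show θ - y - (θ + h) = -(y + h) by ring, abs_neg]
      have := abs_add_le y h
      rw [abs_of_pos hh] at this
      linarith
    have h5 : |θ - y - (θ + h)| ^ γ ≤ 2 * |y| ^ γ :=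
      (Real.rpow_le_rpow (abs_nonneg _) h4 hγ.le).trans
        (mul_rpow_le_mul_rpow one_le_two hy0.le hγ1)
    have h6 : |y| ^ (γ - 2) = |y| ^ γ * (|y| ^ 2)⁻¹ := by
      rw [Real.rpow_sub hy0, Real.rpow_two, div_eq_mul_inv]
    rw [e, norm_smul, Real.norm_eq_abs, h6]
    calc _ ≤ 32 * h * (|y| ^ 2)⁻¹ * (A * (2 * |y| ^ γ)) :=
          mul_le_mul (abs_cotKernel_sub_le hh hh1 h1 h2)
            (h3.trans (mul_le_mul_of_nonneg_left h5 hA)) (norm_nonneg _) (by positivity)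
      _ = _ := by ring
  · refine (ContinuousOn.intervalIntegrable fun y hyI => ?_).const_mul _
    rw [uIcc_of_le hab] at hyI
    exact (continuous_abs.continuousAt.rpow_const
      (Or.inl (abs_pos.2 (hab' y hyI).1).ne')).continuousWithinAt

theorem cotIntegrand_periodic (hp : Function.Periodic f (2 * Real.pi)) (θ : ℝ) :
    Function.Periodic (cotIntegrand f θ) (2 * Real.pi) := fun y => by
  rw [cotIntegrand, cotIntegrand, cotKernel_periodic, ← hp (θ - (y + 2 * Real.pi))]
  congr 3
  ring

theorem cotConv_periodic (hp : Function.Periodic f (2 * Real.pi)) :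
    Function.Periodic (cotConv f) (2 * Real.pi) := fun θ => by
  simp only [cotConv, cotIntegrand]
  congr 1
  funext y
  rw [hp θ, ← hp (θ - y)]
  congr 3
  ring

/-- The Hilbert transform preserves Hölder continuity. -/
theorem norm_cotConv_sub_le (hγ : 0 < γ) (hγ1 : γ < 1) (hfc : Continuous f)
    (hp : Function.Periodic f (2 * Real.pi)) (hA : 0 ≤ A)
    (hf : ∀ θ θ', ‖f θ - f θ'‖ ≤ A * |θ - θ'| ^ γ) (θ : ℝ) {h : ℝ} (hh : 0 < h) (hh1 : h < 1) :
    ‖cotConv f θ - cotConv f (θ + h)‖ ≤ (48 / γ + 128 / (1 - γ)) * A * h ^ γ := by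
  have hπ := Real.pi_gt_three
  have ii := fun (θ : ℝ) {a b : ℝ} => intervalIntegrable_cotIntegrand hγ hfc hf θ (a := a) (b := b)
  have hle : ∀ x : ℝ, -Real.pi ≤ x → x ≤ Real.pi + 1 → |x| ≤ Real.pi + 1 := fun x h1 h2 =>
    abs_le.2 ⟨by linarith, h2⟩
  have jj : ∀ {a b : ℝ}, -Real.pi ≤ a → a ≤ Real.pi → -Real.pi ≤ b → b ≤ Real.pi →
      IntervalIntegrable (fun y => cotIntegrand f (θ + h) (y + h)) volume a b := fun {a b} a1 a2 b1 b2 => by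
    have := (ii (θ + h) (hle (a + h) (by linarith) (by linarith))
      (hle (b + h) (by linarith) (by linarith))).comp_add_right h
    simpa only [add_sub_cancel_right] using this
  -- Periodicity allows the integration variable to be shifted together with the base point.
  have hshift : cotConv f (θ + h) = ∫ y in (-Real.pi)..Real.pi, cotIntegrand f (θ + h) (y + h) := by
    rw [intervalIntegral.integral_comp_add_right (fun y => cotIntegrand f (θ + h) y), cotConv]
    have := (cotIntegrand_periodic hp (θ + h)).intervalIntegral_add_eq (-Real.pi) (-Real.pi + h)
    rw [show -Real.pi + 2 * Real.pi = Real.pi by ring,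
      show -Real.pi + h + 2 * Real.pi = Real.pi + h by ring] at this
    exact this
  have hneg : ∀ g : ℝ → ℝ, ∫ y in (-Real.pi)..(-(2 * h)), g y = ∫ y in (2 * h)..Real.pi, g (-y) :=
    fun g => (intervalIntegral.integral_comp_neg g).symm
  -- By oddness the leftover multiples of `f (θ + h) - f θ` from the two far regions cancel;
  -- otherwise a logarithm of `h` would remain.
  have hk : ∫ y in (-Real.pi)..(-(2 * h)), cotKernel y = -∫ y in (2 * h)..Real.pi, cotKernel y := by
    rw [hneg]
    simp only [cotKernel_neg, intervalIntegral.integral_neg]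
  have hr : ∫ y in (-Real.pi)..(-(2 * h)), |y| ^ (γ - 2) = ∫ y in (2 * h)..Real.pi, |y| ^ (γ - 2) := by
    rw [hneg]
    simp only [abs_neg]
  have hfar : ∫ y in (2 * h)..Real.pi, |y| ^ (γ - 2) ≤ h ^ (γ - 1) / (1 - γ) := by
    refine (integral_rpow_far_le hγ1 (by linarith) (by linarith)).trans ?_
    have : 0 < 1 - γ := by linarith
    refine div_le_div_of_nonneg_right ?_ this.le
    exact Real.rpow_le_rpow_of_nonpos hh (by linarith) (by linarith)
  have b1 := integral_cotIntegrand_sub hγ hγ1.le hfc hf θ hh hh1 (a := -Real.pi) (b := -(2 * h))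
    (by linarith) fun y hy => by
      rw [abs_of_nonpos (by linarith [hy.2])]
      exact ⟨by linarith [hy.2], by linarith [hy.1]⟩
  have b2 := integral_cotIntegrand_sub hγ hγ1.le hfc hf θ hh hh1 (a := 2 * h) (b := Real.pi)
    (by linarith) fun y hy => by
      rw [abs_of_nonneg (by linarith [hy.1])]
      exact ⟨by linarith [hy.1], by linarith [hy.2]⟩
  have b3 := norm_integral_cotIntegrand_le hγ hA hf θ (a := -(2 * h)) (b := 2 * h) (c := 3 * h)
    (by linarith) (by linarith) (by linarith) (by linarith)
  have b4 := norm_integral_cotIntegrand_le hγ hA hf (θ + h) (a := -h) (b := 3 * h) (c := 3 * h)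
    (by linarith) (by linarith) (by linarith) (by linarith)
  have b4' : ∫ y in (-h)..(3 * h), cotIntegrand f (θ + h) y
      = ∫ y in (-(2 * h))..(2 * h), cotIntegrand f (θ + h) (y + h) := by
    rw [intervalIntegral.integral_comp_add_right (fun y => cotIntegrand f (θ + h) y)]
    congr 1 <;> ring
  have h3 : (3 * h) ^ γ ≤ 3 * h ^ γ := mul_rpow_le_mul_rpow (by norm_num) hh.le hγ1.le
  have hnear : 8 * A * (3 * h) ^ γ / γ ≤ 24 / γ * A * h ^ γ := by
    calc _ ≤ 8 * A * (3 * h ^ γ) / γ := by gcongr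
      _ = _ := by ring
  have hfar' : 64 * A * h * ∫ y in (2 * h)..Real.pi, |y| ^ (γ - 2) ≤ 64 / (1 - γ) * A * h ^ γ := by
    calc _ ≤ 64 * A * h * (h ^ (γ - 1) / (1 - γ)) := mul_le_mul_of_nonneg_left hfar (by positivity)
      _ = _ := by rw [Real.rpow_sub_one hh.ne']; field_simp
  rw [hk] at b1
  rw [hr] at b1
  rw [b4'] at b4
  rw [hshift, cotConv, ← intervalIntegral.integral_add_adjacent_intervals (b := -(2 * h))
    (ii θ (hle _ le_rfl (by linarith)) (hle _ (by linarith) (by linarith)))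
    (ii θ (hle _ (by linarith) (by linarith)) (hle _ (by linarith) (by linarith))),
    ← intervalIntegral.integral_add_adjacent_intervals (a := -(2 * h)) (b := 2 * h)
    (ii θ (hle _ (by linarith) (by linarith)) (hle _ (by linarith) (by linarith)))
    (ii θ (hle _ (by linarith) (by linarith)) (hle _ (by linarith) (by linarith))),
    ← intervalIntegral.integral_add_adjacent_intervals (a := -Real.pi) (b := -(2 * h))
    (f := fun y => cotIntegrand f (θ + h) (y + h)) (jj (by linarith) (by linarith) (by linarith) (by linarith))
      (jj (by linarith) (by linarith) (by linarith) (by linarith)),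
    ← intervalIntegral.integral_add_adjacent_intervals (a := -(2 * h)) (b := 2 * h)
    (f := fun y => cotIntegrand f (θ + h) (y + h)) (jj (by linarith) (by linarith) (by linarith) (by linarith))
      (jj (by linarith) (by linarith) (by linarith) (by linarith))]
  generalize (∫ y in (2 * h)..Real.pi, cotKernel y) = κ at b1 b2
  generalize (∫ y in (-Real.pi)..(-(2 * h)), cotIntegrand f θ y) = p1 at *
  generalize (∫ y in (-(2 * h))..(2 * h), cotIntegrand f θ y) = p2 at *
  generalize (∫ y in (2 * h)..Real.pi, cotIntegrand f θ y) = p3 at *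
  generalize (∫ y in (-Real.pi)..(-(2 * h)), cotIntegrand f (θ + h) (y + h)) = q1 at *
  generalize (∫ y in (-(2 * h))..(2 * h), cotIntegrand f (θ + h) (y + h)) = q2 at *
  generalize (∫ y in (2 * h)..Real.pi, cotIntegrand f (θ + h) (y + h)) = q3 at *
  have e : p1 + (p2 + p3) - (q1 + (q2 + q3)) = (p1 - q1 - (-κ) • (f (θ + h) - f θ))
      + (p3 - q3 - κ • (f (θ + h) - f θ)) + (p2 - q2) := by module
  rw [e]
  refine (norm_add₃_le).trans ((add_le_add (add_le_add b1 b2) (norm_sub_le _ _)).trans ?_)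
  have e2 : (48 / γ + 128 / (1 - γ)) * A * h ^ γ = 64 / (1 - γ) * A * h ^ γ
      + 64 / (1 - γ) * A * h ^ γ + (24 / γ * A * h ^ γ + 24 / γ * A * h ^ γ) := by ring
  rw [e2]
  exact add_le_add (add_le_add hfar' hfar') (add_le_add (b3.trans hnear) (b4.trans hnear))

theorem cotConv_add (hγ : 0 < γ) {B : ℝ} (hfc : Continuous f) (hgc : Continuous g)
    (hf : ∀ θ θ', ‖f θ - f θ'‖ ≤ A * |θ - θ'| ^ γ)
    (hg : ∀ θ θ', ‖g θ - g θ'‖ ≤ B * |θ - θ'| ^ γ) (θ : ℝ) :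
    cotConv (fun θ => f θ + g θ) θ = cotConv f θ + cotConv g θ := by
  have hπ : |Real.pi| ≤ Real.pi + 1 := by rw [abs_of_pos Real.pi_pos]; linarith
  have hπ' : |-Real.pi| ≤ Real.pi + 1 := by rwa [abs_neg]
  rw [cotConv, cotConv, cotConv, ← intervalIntegral.integral_add
    (intervalIntegrable_cotIntegrand hγ hfc hf θ hπ' hπ)
    (intervalIntegrable_cotIntegrand hγ hgc hg θ hπ' hπ)]
  congr 1
  funext y
  simp only [cotIntegrand]
  module

theorem cotConv_smul (c : ℝ) (θ : ℝ) : cotConv (fun θ => c • f θ) θ = c • cotConv f θ := by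
  rw [cotConv, cotConv, ← intervalIntegral.integral_smul]
  congr 1
  funext y
  simp only [cotIntegrand]
  module

/-- The operator `Λ = -(1/4) H ∂_θ` as a continuous linear map. -/
theorem exists_lambdaCLM (hγ : 0 < γ) (hγ1 : γ < 1) :
    ∃ L : HolderSpace 1 γ →L[ℝ] HolderSpace 0 γ,
      ∀ u θ, L u θ = -(1 / (4 * Real.pi)) • cotConv (deriv u) θ := by
  have hf := fun u : HolderSpace 1 γ => u.norm_deriv_sub_le hγ
  set a := 8 * 2 * Real.pi ^ γ / γ with ha
  set b := (48 / γ + 128 / (1 - γ)) * 2 with hb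
  obtain ⟨L, hL, -⟩ := exists_clm_of_pointwise (k := 0) (γ := γ)
    (fun (u : HolderSpace 1 γ) θ => -(1 / (4 * Real.pi)) • cotConv (deriv u) θ)
    (1 / (4 * Real.pi) * (a + b)) (fun u v θ => by
      rw [← smul_add, ← cotConv_add hγ u.continuous_deriv v.continuous_deriv (hf u) (hf v)]
      congr 2
      exact funext (HolderSpace.deriv_add u v)) (fun c u θ =>
      (congrArg (fun w => -(1 / (4 * Real.pi)) • cotConv w θ)
        (funext (HolderSpace.deriv_smul c u))).trans (by rw [cotConv_smul, smul_comm])) fun u => by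
    have hsc : ∀ v : Plane, ‖-(1 / (4 * Real.pi)) • v‖ = 1 / (4 * Real.pi) * ‖v‖ := fun v => by
      rw [norm_smul, norm_neg, Real.norm_eq_abs, abs_of_nonneg (by positivity)]
    -- The increment estimate is for positive shifts; the two orders of `θ` and `θ'` are reduced to
    -- it below.
    have hpos : ∀ θ {h : ℝ}, 0 < h → h < 1 → ‖cotConv (deriv u) θ - cotConv (deriv u) (θ + h)‖
        ≤ b * ‖u‖ * h ^ γ := fun θ h hh hh1 =>
      (norm_cotConv_sub_le hγ hγ1 u.continuous_deriv u.periodic_deriv (by positivity) (hf u) θ hh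
        hh1).trans_eq (by rw [hb]; ring)
    obtain ⟨v, hv, hvn⟩ := exists_holder_zero
      (f := fun θ => -(1 / (4 * Real.pi)) • cotConv (deriv u) θ)
      (A := 1 / (4 * Real.pi) * (a * ‖u‖)) (C := 1 / (4 * Real.pi) * (b * ‖u‖)) hγ
      ((cotConv_periodic u.periodic_deriv).smul (-(1 / (4 * Real.pi)))) (fun θ => by
        rw [hsc]
        refine mul_le_mul_of_nonneg_left ?_ (by positivity)
        exact (norm_cotConv_le hγ (by positivity) (hf u) θ).trans_eq (by rw [ha]; ring))
      fun θ θ' hne h1 => by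
        rw [← smul_sub, hsc, mul_assoc]
        refine mul_le_mul_of_nonneg_left ?_ (by positivity)
        rcases lt_or_gt_of_ne hne with hlt | hlt
        · have h2 : |θ - θ'| = θ' - θ := by rw [abs_sub_comm, abs_of_pos (sub_pos.2 hlt)]
          rw [h2] at h1 ⊢
          have := hpos θ (sub_pos.2 hlt) h1
          rwa [add_sub_cancel] at this
        · have h2 : |θ - θ'| = θ - θ' := abs_of_pos (sub_pos.2 hlt)
          rw [h2] at h1 ⊢
          have := hpos θ' (sub_pos.2 hlt) h1
          rwa [add_sub_cancel, norm_sub_rev] at this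
    exact ⟨v, hv, hvn.trans_eq (by ring)⟩
  exact ⟨L, hL⟩

end CotKernel

/-! ### The boundary integral as `Λ X + R(X)` -/

section BoundaryIntegral

variable {γ : ℝ}

/-- Passing to `log ‖x‖ = (1/2) log ‖x‖²` reduces the derivative to that of the squared norm. -/
theorem hasDerivAt_log_norm_sub {X : ℝ → Plane} {p : Plane} {θ θ' : ℝ} (hX : HasDerivAt X p θ')
    (hne : X θ ≠ X θ') : HasDerivAt (fun s => Real.log ‖X θ - X s‖)
      (-(inner ℝ (X θ - X θ') p / ‖X θ - X θ'‖ ^ 2)) θ' := by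
  have hx : HasDerivAt (fun s => X θ - X s) (-p) θ' := hX.const_sub (X θ)
  have hn : ‖X θ - X θ'‖ ^ 2 ≠ 0 := pow_ne_zero 2 (norm_ne_zero_iff.2 (sub_ne_zero.2 hne))
  have h1 := (hx.norm_sq.log hn).const_mul (1 / 2)
  have e : (fun s => Real.log ‖X θ - X s‖) = fun s => 1 / 2 * Real.log (‖X θ - X s‖ ^ 2) := by
    funext s
    rw [Real.log_pow]
    push_cast
    ring
  rw [e]
  refine h1.congr_deriv ?_
  rw [inner_neg_right]
  ring

theorem biIntegrand_eq {X : ℝ → Plane} {θ θ' : ℝ} (hX : HasDerivAt X (deriv X θ') θ')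
    (hne : X θ ≠ X θ') :
    biIntegrand X θ θ' = -(1 / (4 * Real.pi)) •
      (remainderIntegrand X θ θ' + cotKernel (θ - θ') • deriv X θ') := by
  obtain ⟨D, hD, -⟩ := hasDerivAt_tensor_sub hX hne
  have h1 := (((hasDerivAt_log_norm_sub hX hne).neg.smul_const
    (ContinuousLinearMap.id ℝ Plane)).add hD).const_smul (1 / (4 * Real.pi))
  have h2 : HasDerivAt (fun s => stokeslet (X θ - X s)) _ θ' := h1
  rw [biIntegrand, h2.deriv, remainderIntegrand, hD.deriv, cotKernel]
  change -((1 / (4 * Real.pi)) • ((- -(inner ℝ (X θ - X θ') (deriv X θ') / ‖X θ - X θ'‖ ^ 2)) •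
    deriv X θ' + D (deriv X θ'))) = _
  module

/-- Freezing `deriv X` at `θ` in the cotangent term leaves an absolutely integrable integrand `g`.
The frozen term integrates to zero over symmetric truncations, so the principal value exists and is
the integral of `g`. -/
theorem isBoundaryIntegral_iff (hγ : 0 < γ) (hγ1 : γ < 1) (X : HolderSpace 1 γ)
    (hX : 0 < arcChord X) (θ : ℝ) (v : Plane) : IsBoundaryIntegral X θ v ↔
      v = -(1 / (4 * Real.pi)) • cotConv (deriv X) θ + remainder X θ := by
  have hπ := Real.pi_pos
  set c := -(1 / (4 * Real.pi)) with hc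
  set g : ℝ → Plane := fun θ' => remainderIntegrand X θ θ' + cotIntegrand (deriv X) θ (θ - θ')
    with hg
  have i1 := intervalIntegrable_remainderIntegrand hγ hγ1 X hX (θ := θ) (θ₀ := θ) (by simp)
  have i2 : IntervalIntegrable (fun θ' => cotIntegrand (deriv X) θ (θ - θ')) volume
      (θ - Real.pi) (θ + Real.pi) := by
    have := (intervalIntegrable_cotIntegrand hγ X.continuous_deriv (X.norm_deriv_sub_le hγ) θ
      (a := -Real.pi) (b := Real.pi) (by rw [abs_neg, abs_of_pos hπ]; linarith)
      (by rw [abs_of_pos hπ]; linarith)).comp_sub_left θ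
    rw [sub_neg_eq_add] at this
    exact this.symm
  have ig : IntervalIntegrable g volume (θ - Real.pi) (θ + Real.pi) := i1.add i2
  have hle : θ - Real.pi ≤ θ + Real.pi := by linarith
  have igI : IntegrableOn g (uIcc (θ - Real.pi) (θ + Real.pi)) := by
    rwa [intervalIntegrable_iff'] at ig
  have htot : ∫ θ' in (θ - Real.pi)..(θ + Real.pi), g θ'
      = (∫ θ' in (θ - Real.pi)..(θ + Real.pi), remainderIntegrand X θ θ')
        + cotConv (deriv X) θ := by
    rw [hg, intervalIntegral.integral_add i1 i2,
      intervalIntegral.integral_comp_sub_left (cotIntegrand (deriv X) θ), cotConv]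
    congr 2 <;> ring
  have hmem : ∀ x : ℝ, θ - Real.pi ≤ x → x ≤ θ + Real.pi → x ∈ uIcc (θ - Real.pi) (θ + Real.pi) :=
    fun x h1 h2 => by rw [uIcc_of_le hle]; exact ⟨h1, h2⟩
  have isub : ∀ a b : ℝ, θ - Real.pi ≤ a → a ≤ θ + Real.pi → θ - Real.pi ≤ b → b ≤ θ + Real.pi →
      IntervalIntegrable g volume a b := fun a b a1 a2 b1 b2 =>
    ig.mono_set (uIcc_subset_uIcc (hmem a a1 a2) (hmem b b1 b2))
  have htrunc : ∀ ε, 0 < ε → ε < Real.pi →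
      (∫ θ' in (θ - Real.pi)..(θ - ε), biIntegrand X θ θ')
        + ∫ θ' in (θ + ε)..(θ + Real.pi), biIntegrand X θ θ'
      = c • ((∫ θ' in (θ - Real.pi)..(θ - ε), g θ') + ∫ θ' in (θ + ε)..(θ + Real.pi), g θ') := by
    intro ε hε hεπ
    have hbi : ∀ θ', θ' ≠ θ → |θ - θ'| ≤ Real.pi → biIntegrand X θ θ'
        = c • (g θ' + cotKernel (θ - θ') • deriv X θ) := fun θ' hne hle' => by
      rw [biIntegrand_eq (X.hasDerivAt θ')
        (ne_of_abs_sub_lt_two_pi X hX hne.symm (by linarith)), hg]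
      simp only [cotIntegrand, sub_sub_cancel]
      congr 1
      module
    have hk : ∀ a b : ℝ, (∀ y ∈ uIcc a b, y ≠ 0 ∧ |y| ≤ Real.pi + 1) →
        IntervalIntegrable (fun θ' => cotKernel (θ - θ') • deriv X θ) volume (θ - a) (θ - b) :=
      fun a b hab => by
        have := (intervalIntegrable_cotKernel hab).comp_sub_left θ
        exact ⟨this.1.smul_const _, this.2.smul_const _⟩
    have hk1 := hk Real.pi ε fun y hy => by
      rw [uIcc_of_ge hεπ.le] at hy
      exact ⟨(hε.trans_le hy.1).ne', by rw [abs_of_pos (hε.trans_le hy.1)]; linarith [hy.2]⟩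
    have hk2 := hk (-ε) (-Real.pi) fun y hy => by
      rw [uIcc_of_ge (by linarith)] at hy
      have h0 : y < 0 := lt_of_le_of_lt hy.2 (by linarith)
      exact ⟨h0.ne, by rw [abs_of_neg h0]; linarith [hy.1]⟩
    rw [sub_neg_eq_add, sub_neg_eq_add] at hk2
    have e1 : ∫ θ' in (θ - Real.pi)..(θ - ε), biIntegrand X θ θ'
        = ∫ θ' in (θ - Real.pi)..(θ - ε), c • (g θ' + cotKernel (θ - θ') • deriv X θ) :=
      intervalIntegral.integral_congr fun θ' h => by
        rw [uIcc_of_le (by linarith)] at h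
        refine hbi θ' (by linarith [h.2] : θ' < θ).ne ?_
        rw [abs_of_nonneg (by linarith [h.2])]
        linarith [h.1]
    have e2 : ∫ θ' in (θ + ε)..(θ + Real.pi), biIntegrand X θ θ'
        = ∫ θ' in (θ + ε)..(θ + Real.pi), c • (g θ' + cotKernel (θ - θ') • deriv X θ) :=
      intervalIntegral.integral_congr fun θ' h => by
        rw [uIcc_of_le (by linarith)] at h
        refine hbi θ' (by linarith [h.1] : θ < θ').ne' ?_
        rw [abs_of_nonpos (by linarith [h.1])]
        linarith [h.2]
    -- Oddness of the kernel: here the symmetry of the truncation is used.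
    have e3 : ∫ θ' in (θ - Real.pi)..(θ - ε), cotKernel (θ - θ')
        = -∫ θ' in (θ + ε)..(θ + Real.pi), cotKernel (θ - θ') := by
      rw [intervalIntegral.integral_comp_sub_left cotKernel,
        intervalIntegral.integral_comp_sub_left cotKernel, sub_sub_cancel, sub_sub_cancel,
        sub_add_cancel_left, sub_add_cancel_left,
        ← intervalIntegral.integral_comp_neg (a := ε) (b := Real.pi)]
      simp only [cotKernel_neg, intervalIntegral.integral_neg, neg_neg]
    rw [e1, e2, intervalIntegral.integral_smul, intervalIntegral.integral_smul, ← smul_add,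
      intervalIntegral.integral_add (isub _ _ le_rfl (by linarith) (by linarith) (by linarith)) hk1,
      intervalIntegral.integral_add (isub _ _ (by linarith) (by linarith) (by linarith) le_rfl) hk2,
      intervalIntegral.integral_smul_const, intervalIntegral.integral_smul_const, e3]
    congr 1
    module
  have hlim : Tendsto (fun ε : ℝ => (∫ θ' in (θ - Real.pi)..(θ - ε), biIntegrand X θ θ')
      + ∫ θ' in (θ + ε)..(θ + Real.pi), biIntegrand X θ θ') (𝓝[>] 0)
      (𝓝 (c • cotConv (deriv X) θ + remainder X θ)) := by
    have hw : Ioo (0 : ℝ) Real.pi ∈ 𝓝[>] (0 : ℝ) := Ioo_mem_nhdsGT hπ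
    have hU : uIcc (θ - Real.pi) (θ + Real.pi) ∈ 𝓝 θ := by
      rw [uIcc_of_le hle]
      exact Icc_mem_nhds (by linarith) (by linarith)
    have c1 := (intervalIntegral.continuousOn_primitive_interval igI).continuousAt hU
    have c2 := (intervalIntegral.continuousOn_primitive_interval_left igI).continuousAt hU
    have t1 : Tendsto (fun ε : ℝ => θ - ε) (𝓝[>] 0) (𝓝 θ) := by
      have : Continuous fun ε : ℝ => θ - ε := by fun_prop
      simpa using (this.tendsto 0).mono_left nhdsWithin_le_nhds
    have t2 : Tendsto (fun ε : ℝ => θ + ε) (𝓝[>] 0) (𝓝 θ) := by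
      have : Continuous fun ε : ℝ => θ + ε := by fun_prop
      simpa using (this.tendsto 0).mono_left nhdsWithin_le_nhds
    have h1 := ((c1.tendsto.comp t1).add (c2.tendsto.comp t2)).const_smul c
    rw [intervalIntegral.integral_add_adjacent_intervals
      (isub _ _ le_rfl (by linarith) (by linarith) (by linarith))
      (isub _ _ (by linarith) (by linarith) (by linarith) le_rfl), htot, smul_add, ← remainder_eq,
      add_comm (remainder X θ)] at h1
    refine h1.congr' ?_
    filter_upwards [hw] with ε hε
    exact (htrunc ε hε.1 hε.2).symm
  exact ⟨fun h => tendsto_nhds_unique h hlim, fun h => by rw [h]; exact hlim⟩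

end BoundaryIntegral

/-! ### Fourier coefficients -/

section Pairing

variable {γ A : ℝ} {f u v : ℝ → Plane} {n : ℕ} {c : ℝ}

/-- The integral of a function against `cos (nθ + c)` over a period. -/
def pairing (n : ℕ) (c : ℝ) (u : ℝ → Plane) : Plane :=
  ∫ θ in (-Real.pi)..Real.pi, Real.cos (n * θ + c) • u θ

theorem intervalIntegrable_cos_smul (n : ℕ) (c : ℝ) (hu : Continuous u) (a b : ℝ) :
    IntervalIntegrable (fun θ => Real.cos (n * θ + c) • u θ) volume a b :=
  Continuous.intervalIntegrable (by fun_prop) _ _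

theorem norm_pairing_le {B : ℝ} (hB : ∀ θ, ‖u θ‖ ≤ B) : ‖pairing n c u‖ ≤ 2 * Real.pi * B := by
  have hπ := Real.pi_pos
  have hB0 : 0 ≤ B := (norm_nonneg _).trans (hB 0)
  refine (intervalIntegral.norm_integral_le_of_norm_le_const (C := B) fun θ _ => ?_).trans_eq ?_
  · rw [norm_smul]
    exact (mul_le_mul (Real.abs_cos_le_one _) (hB θ) (norm_nonneg _) zero_le_one).trans_eq
      (one_mul B)
  · rw [sub_neg_eq_add, abs_of_pos (by positivity)]
    ring

/-- Fourier coefficients as continuous linear maps on Hölder spaces. -/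
def pairingCLM (k : ℕ) (γ : ℝ) (n : ℕ) (c : ℝ) : HolderSpace k γ →L[ℝ] Plane :=
  LinearMap.mkContinuous
    { toFun := fun u => pairing n c u
      map_add' := fun u v => by
        rw [pairing, pairing, pairing, ← intervalIntegral.integral_add
          (intervalIntegrable_cos_smul n c u.continuous _ _)
          (intervalIntegrable_cos_smul n c v.continuous _ _)]
        exact intervalIntegral.integral_congr fun θ _ => smul_add _ _ _
      map_smul' := fun a u => by
        rw [RingHom.id_apply, pairing, pairing, ← intervalIntegral.integral_smul]
        exact intervalIntegral.integral_congr fun θ _ =>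
          smul_comm (Real.cos (n * θ + c)) a (u θ : Plane) } (2 * Real.pi)
    fun u => norm_pairing_le u.norm_apply_le

@[simp] theorem pairingCLM_apply {k : ℕ} (u : HolderSpace k γ) :
    pairingCLM k γ n c u = pairing n c u := rfl

theorem cos_nat_mul_add_periodic (n : ℕ) (c : ℝ) :
    Function.Periodic (fun θ : ℝ => Real.cos (n * θ + c)) (2 * Real.pi) := fun θ => by
  simp only
  rw [show (n : ℝ) * (θ + 2 * Real.pi) + c = n * θ + c + n * (2 * Real.pi) by ring,
    Real.cos_add_nat_mul_two_pi]

theorem integral_translate_of_periodic {g : ℝ → Plane} (hg : Function.Periodic g (2 * Real.pi))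
    (y : ℝ) : ∫ θ in (-Real.pi)..Real.pi, g (θ - y) = ∫ θ in (-Real.pi)..Real.pi, g θ := by
  rw [intervalIntegral.integral_comp_sub_right g]
  have := hg.intervalIntegral_add_eq (-Real.pi - y) (-Real.pi)
  rwa [show -Real.pi - y + 2 * Real.pi = Real.pi - y by ring,
    show -Real.pi + 2 * Real.pi = Real.pi by ring] at this

/-- Translate the variable over a period and expand the cosine. The phase `c + π/2` stands for minus
the sine, so the functionals `pairing n ·` are closed under translation. -/
theorem pairing_translate (hu : Continuous u) (hp : Function.Periodic u (2 * Real.pi)) (y : ℝ) :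
    ∫ θ in (-Real.pi)..Real.pi, Real.cos (n * θ + c) • u (θ - y)
      = Real.cos (n * y) • pairing n c u + Real.sin (n * y) • pairing n (c + Real.pi / 2) u := by
  have h1 : Function.Periodic (fun θ => Real.cos (n * θ + (n * y + c)) • u θ) (2 * Real.pi) :=
    fun θ => by
      have := cos_nat_mul_add_periodic n (n * y + c) θ
      simp only at this ⊢
      rw [this, hp]
  have h2 := integral_translate_of_periodic h1 y
  rw [pairing, pairing, ← intervalIntegral.integral_smul, ← intervalIntegral.integral_smul,
    ← intervalIntegral.integral_add (Continuous.intervalIntegrable (by fun_prop) _ _)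
      (Continuous.intervalIntegrable (by fun_prop) _ _)]
  refine Eq.trans (intervalIntegral.integral_congr fun θ _ => ?_)
    (h2.trans (intervalIntegral.integral_congr fun θ _ => ?_))
  · congr 2
    ring
  · rw [smul_smul, smul_smul, ← add_smul, ← add_assoc _ c, Real.cos_add_pi_div_two,
      show (n : ℝ) * θ + (n * y + c) = (n * θ + c) + n * y by ring, Real.cos_add]
    congr 1
    ring

/-- Exchange of the order of integration over a period. -/
theorem integral_swap_of_norm_le {F : ℝ → ℝ → Plane} (hF : Measurable (Function.uncurry F))
    {g : ℝ → ℝ} (hg : IntervalIntegrable g volume (-Real.pi) Real.pi)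
    (h : ∀ θ y, y ≠ 0 → |y| ≤ Real.pi → ‖F θ y‖ ≤ g y) :
    ∫ θ in (-Real.pi)..Real.pi, ∫ y in (-Real.pi)..Real.pi, F θ y
      = ∫ y in (-Real.pi)..Real.pi, ∫ θ in (-Real.pi)..Real.pi, F θ y := by
  have hle : -Real.pi ≤ Real.pi := by linarith [Real.pi_pos]
  simp only [intervalIntegral.integral_of_le hle]
  refine integral_integral_swap ?_
  have hg' : Integrable g (volume.restrict (Ioc (-Real.pi) Real.pi)) :=
    (intervalIntegrable_iff_integrableOn_Ioc_of_le hle).1 hg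
  refine (hg'.comp_snd (volume.restrict (Ioc (-Real.pi) Real.pi))).mono'
    hF.aestronglyMeasurable ?_
  have h0 : ∀ᵐ y ∂(volume.restrict (Ioc (-Real.pi) Real.pi)), y ≠ 0 ∧ |y| ≤ Real.pi := by
    rw [ae_restrict_iff' measurableSet_Ioc]
    have h0 : ∀ᵐ s : ℝ, s ≠ 0 := by simp [ae_iff, measure_singleton]
    filter_upwards [h0] with y hy0 hy
    exact ⟨hy0, abs_le.2 ⟨hy.1.le, hy.2⟩⟩
  have h1 := Measure.quasiMeasurePreserving_snd
    (μ := volume.restrict (Ioc (-Real.pi) Real.pi))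
    (ν := volume.restrict (Ioc (-Real.pi) Real.pi)) |>.ae h0
  filter_upwards [h1] with p hp
  exact h p.1 p.2 hp.1 hp.2

theorem integral_eq_zero_of_odd {g : ℝ → ℝ} (hg : ∀ y, g (-y) = -g y) (a : ℝ) :
    ∫ y in (-a)..a, g y = 0 := by
  have h := intervalIntegral.integral_comp_neg (a := -a) (b := a) g
  simp only [hg, intervalIntegral.integral_neg, neg_neg] at h
  linarith

/-- Convolution with an even kernel multiplies the Fourier coefficients. -/
theorem pairing_conv {k : ℝ → ℝ} (hk : Continuous k) (hk' : ∀ y, k (-y) = k y)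
    (hu : Continuous u) (hp : Function.Periodic u (2 * Real.pi)) :
    pairing n c (conv k u)
      = (1 / (2 * Real.pi) * ∫ y in (-Real.pi)..Real.pi, k y * Real.cos (n * y)) •
        pairing n c u := by
  obtain ⟨B, hB0, hB⟩ := exists_norm_le_of_periodic hu hp
  have h1 : pairing n c (conv k u) = (1 / (2 * Real.pi)) •
      ∫ θ in (-Real.pi)..Real.pi, ∫ y in (-Real.pi)..Real.pi,
        Real.cos (n * θ + c) • k y • u (θ - y) := by
    rw [pairing, ← intervalIntegral.integral_smul]
    refine intervalIntegral.integral_congr fun θ _ => ?_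
    simp only [conv]
    rw [intervalIntegral.integral_smul, smul_comm]
  have h2 : ∀ y, ∫ θ in (-Real.pi)..Real.pi, Real.cos (n * θ + c) • k y • u (θ - y)
      = (k y * Real.cos (n * y)) • pairing n c u
        + (k y * Real.sin (n * y)) • pairing n (c + Real.pi / 2) u := fun y => by
    rw [← smul_smul, ← smul_smul, ← smul_add, ← pairing_translate hu hp,
      ← intervalIntegral.integral_smul]
    exact intervalIntegral.integral_congr fun θ _ => smul_comm _ _ _
  have i1 : IntervalIntegrable (fun y => k y * Real.cos (n * y)) volume (-Real.pi) Real.pi :=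
    Continuous.intervalIntegrable (by fun_prop) _ _
  have i2 : IntervalIntegrable (fun y => k y * Real.sin (n * y)) volume (-Real.pi) Real.pi :=
    Continuous.intervalIntegrable (by fun_prop) _ _
  rw [h1, integral_swap_of_norm_le (g := fun y => |k y| * B) (Continuous.measurable (by
      unfold Function.uncurry; fun_prop))
    (Continuous.intervalIntegrable (by fun_prop) _ _) fun θ y _ _ => by
      rw [norm_smul, norm_smul, Real.norm_eq_abs, Real.norm_eq_abs]
      exact (mul_le_of_le_one_left (by positivity) (Real.abs_cos_le_one _)).trans
        (mul_le_mul_of_nonneg_left (hB _) (abs_nonneg _))]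
  simp only [h2]
  rw [intervalIntegral.integral_add ⟨i1.1.smul_const _, i1.2.smul_const _⟩
    ⟨i2.1.smul_const _, i2.2.smul_const _⟩, intervalIntegral.integral_smul_const,
    intervalIntegral.integral_smul_const, integral_eq_zero_of_odd (g := fun y => k y * Real.sin (n * y)) (fun y => by
      rw [hk', mul_neg, Real.sin_neg, mul_neg]), zero_smul, add_zero, smul_smul]

theorem pairing_semigroup {t : ℝ} (ht : 0 ≤ t) (hu : Continuous u)
    (hp : Function.Periodic u (2 * Real.pi)) :
    pairing n c (semigroup t u) = Real.exp (-(n / 4 * t)) • pairing n c u := by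
  rcases ht.eq_or_lt with rfl | ht
  · have : semigroup 0 u = u := funext fun θ => by rw [semigroup, if_pos rfl]
    rw [this, mul_zero, neg_zero, Real.exp_zero, one_smul]
  · have : semigroup t u = conv (heatKernel t) u := funext (semigroup_eq_conv ht hp)
    have hπ := Real.pi_pos
    rw [this, pairing_conv (isSmoothKernel_heatKernel ht).continuous (poisson_neg _) hu hp,
      heatKernel, integral_poisson_mul_cos (Real.exp_pos _) (exp_neg_div_four_lt_one ht),
      ← Real.exp_nat_mul]
    congr 1
    rw [show (n : ℝ) * (-t / 4) = -(n / 4 * t) by ring]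
    field_simp

theorem abs_cotKernel_mul_le {y x : ℝ} (hy : y ≠ 0) (hyπ : |y| ≤ Real.pi) (hx : |x| ≤ n * |y|) :
    |cotKernel y * x| ≤ 4 * n := by
  rw [abs_mul]
  calc _ ≤ 4 * |y|⁻¹ * (n * |y|) :=
        mul_le_mul (abs_cotKernel_le hy (by linarith)) hx (abs_nonneg _) (by positivity)
    _ = 4 * n := by field_simp [abs_ne_zero.2 hy]

theorem intervalIntegrable_cotKernel_mul {g : ℝ → ℝ} (hg : Continuous g)
    (h : ∀ y, |g y| ≤ n * |y|) :
    IntervalIntegrable (fun y => cotKernel y * g y) volume (-Real.pi) Real.pi := by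
  refine (intervalIntegrable_const (c := (4 * n : ℝ))).mono_fun'
    (measurable_cotKernel.mul hg.measurable).aestronglyMeasurable ?_
  rw [uIoc_of_le (by linarith [Real.pi_pos]), EventuallyLE, ae_restrict_iff' measurableSet_Ioc]
  have h0 : ∀ᵐ s : ℝ, s ≠ 0 := by simp [ae_iff, measure_singleton]
  filter_upwards [h0] with y hy0 hy
  exact abs_cotKernel_mul_le hy0 (abs_le.2 ⟨hy.1.le, hy.2⟩) (h y)

theorem abs_sin_nat_mul_le (n : ℕ) (y : ℝ) : |Real.sin (n * y)| ≤ n * |y| := by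
  refine Real.abs_sin_le_abs.trans_eq ?_
  rw [abs_mul, Nat.abs_cast]

theorem abs_cos_nat_mul_sub_one_le (n : ℕ) (y : ℝ) : |Real.cos (n * y) - 1| ≤ n * |y| := by
  have := Real.abs_cos_sub_cos_le (n * y) 0
  rwa [Real.cos_zero, sub_zero, abs_mul, Nat.abs_cast] at this

/-- Consecutive values differ by the integral of `(cos ((m+1) y) + cos (m y)) / 2`, the half-angle
sine cancelling. Only the constant term at `m = 0` contributes, giving `π`. -/
theorem integral_cotKernel_mul_sin (hn : n ≠ 0) :
    ∫ y in (-Real.pi)..Real.pi, cotKernel y * Real.sin (n * y) = Real.pi := by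
  have hi := fun m : ℕ => intervalIntegrable_cotKernel_mul (n := m)
    (g := fun y => Real.sin (m * y)) (by fun_prop) (abs_sin_nat_mul_le m)
  have hci := fun m : ℕ => (Continuous.intervalIntegrable (μ := volume)
    (by fun_prop : Continuous fun y => Real.cos (m * y)) (-Real.pi) Real.pi)
  have hstep : ∀ m : ℕ, (∫ y in (-Real.pi)..Real.pi, cotKernel y * Real.sin ((m + 1 : ℕ) * y))
      - ∫ y in (-Real.pi)..Real.pi, cotKernel y * Real.sin (m * y)
      = 1 / 2 * ((∫ y in (-Real.pi)..Real.pi, Real.cos ((m + 1 : ℕ) * y))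
        + ∫ y in (-Real.pi)..Real.pi, Real.cos (m * y)) := fun m => by
    rw [← intervalIntegral.integral_sub (hi _) (hi _),
      ← intervalIntegral.integral_add (hci _) (hci _), ← intervalIntegral.integral_const_mul]
    refine intervalIntegral.integral_congr_ae ?_
    have h0 : ∀ᵐ s : ℝ, s ≠ 0 := by simp [ae_iff, measure_singleton]
    filter_upwards [h0] with y hy0 hy
    rw [uIoc_of_le (by linarith [Real.pi_pos])] at hy
    have hs := sin_half_ne_zero hy0 (by
      have := abs_le.2 ⟨hy.1.le, hy.2⟩
      linarith)
    have e1 : Real.sin ((m + 1 : ℕ) * y) - Real.sin (m * y)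
        = 2 * Real.sin (y / 2) * Real.cos ((m + 1 / 2) * y) := by
      rw [Real.sin_sub_sin]
      push_cast
      congr 2 <;> [congr 1; skip] <;> ring
    have e2 : Real.cos ((m + 1 : ℕ) * y) + Real.cos (m * y)
        = 2 * Real.cos ((m + 1 / 2) * y) * Real.cos (y / 2) := by
      rw [Real.cos_add_cos]
      push_cast
      congr 2 <;> [congr 1; skip] <;> ring
    rw [← mul_sub, e1, e2, cotKernel_eq]
    field_simp
  obtain ⟨m, rfl⟩ := Nat.exists_eq_succ_of_ne_zero hn
  clear hn
  induction m with
  | zero =>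
    have := hstep 0
    rw [integral_cos_nat_mul (Nat.succ_ne_zero 0)] at this
    simp only [Nat.cast_zero, zero_mul, Real.sin_zero, mul_zero, Real.cos_zero,
      intervalIntegral.integral_zero, sub_zero, intervalIntegral.integral_const, smul_eq_mul] at this
    rw [Nat.succ_eq_add_one, this]
    ring
  | succ m ih =>
    have := hstep (m + 1)
    rw [integral_cos_nat_mul (Nat.succ_ne_zero _), integral_cos_nat_mul (Nat.succ_ne_zero _)] at this
    rw [Nat.succ_eq_add_one] at ih ⊢
    linarith

/-- Subtracting `f θ` makes the double integral absolutely convergent, so the order may be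
exchanged. The part with `cos (n y) - 1` is odd in `y` and drops out. -/
theorem pairing_cotConv (hγ : 0 < γ) (hf : Continuous f) (hp : Function.Periodic f (2 * Real.pi))
    (hA : ∀ θ θ', ‖f θ - f θ'‖ ≤ A * |θ - θ'| ^ γ) :
    pairing n c (cotConv f)
      = (∫ y in (-Real.pi)..Real.pi, cotKernel y * Real.sin (n * y)) •
        pairing n (c + Real.pi / 2) f := by
  have h1 : pairing n c (cotConv f) =
      ∫ θ in (-Real.pi)..Real.pi, ∫ y in (-Real.pi)..Real.pi,
        Real.cos (n * θ + c) • cotIntegrand f θ y := by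
    rw [pairing]
    refine intervalIntegral.integral_congr fun θ _ => ?_
    simp only [cotConv]
    rw [intervalIntegral.integral_smul]
  have h2 : ∀ y, ∫ θ in (-Real.pi)..Real.pi, Real.cos (n * θ + c) • cotIntegrand f θ y
      = (cotKernel y * (Real.cos (n * y) - 1)) • pairing n c f
        + (cotKernel y * Real.sin (n * y)) • pairing n (c + Real.pi / 2) f := fun y => by
    have e : (cotKernel y * (Real.cos (n * y) - 1)) • pairing n c f
        + (cotKernel y * Real.sin (n * y)) • pairing n (c + Real.pi / 2) f
        = cotKernel y • ((Real.cos (n * y) • pairing n c f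
          + Real.sin (n * y) • pairing n (c + Real.pi / 2) f) - pairing n c f) := by module
    rw [e, ← pairing_translate hf hp, pairing, ← intervalIntegral.integral_sub
      (Continuous.intervalIntegrable (by fun_prop) _ _)
      (intervalIntegrable_cos_smul n c hf _ _), ← intervalIntegral.integral_smul]
    refine intervalIntegral.integral_congr fun θ _ => ?_
    simp only [cotIntegrand]
    module
  have i1 := intervalIntegrable_cotKernel_mul (n := n) (g := fun y => Real.cos (n * y) - 1)
    (by fun_prop) (abs_cos_nat_mul_sub_one_le n)
  have i2 := intervalIntegrable_cotKernel_mul (n := n) (g := fun y => Real.sin (n * y))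
    (by fun_prop) (abs_sin_nat_mul_le n)
  rw [h1, integral_swap_of_norm_le (g := fun y => 4 * A * |y| ^ (γ - 1)) ?_
    ((intervalIntegrable_abs_rpow (by linarith) _ _).const_mul _) fun θ y hy hyπ => by
      rw [norm_smul, Real.norm_eq_abs]
      exact (mul_le_of_le_one_left (norm_nonneg _) (Real.abs_cos_le_one _)).trans
        (norm_cotIntegrand_le hA θ hy (by linarith))]
  · simp only [h2]
    rw [intervalIntegral.integral_add ⟨i1.1.smul_const _, i1.2.smul_const _⟩
      ⟨i2.1.smul_const _, i2.2.smul_const _⟩, intervalIntegral.integral_smul_const,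
      intervalIntegral.integral_smul_const,
      integral_eq_zero_of_odd (g := fun y => cotKernel y * (Real.cos (n * y) - 1)) (fun y => by
        rw [cotKernel_neg, mul_neg, Real.cos_neg, neg_mul]), zero_smul, zero_add]
  · have m1 : Measurable fun p : ℝ × ℝ => cotKernel p.2 := measurable_cotKernel.comp measurable_snd
    have m2 : Measurable fun p : ℝ × ℝ => f (p.1 - p.2) - f p.1 :=
      Continuous.measurable (by fun_prop)
    have m3 : Measurable fun p : ℝ × ℝ => Real.cos (n * p.1 + c) :=
      Continuous.measurable (by fun_prop)
    exact m3.smul (m1.smul m2)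

/-- Integration by parts without boundary terms; the phase shift `π/2` turns the derivative of the
cosine back into a cosine. -/
theorem pairing_deriv (hd : ∀ θ, HasDerivAt u (f θ) θ) (hf : Continuous f)
    (hp : Function.Periodic u (2 * Real.pi)) :
    pairing n (c + Real.pi / 2) f = (n : ℝ) • pairing n c u := by
  have hu : Continuous u := continuous_iff_continuousAt.2 fun θ => (hd θ).continuousAt
  have hd2 : ∀ θ, HasDerivAt (fun θ => Real.cos (n * θ + (c + Real.pi / 2)) • u θ)
      (Real.cos (n * θ + (c + Real.pi / 2)) • f θ - (n * Real.cos (n * θ + c)) • u θ) θ :=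
    fun θ => by
      have h1 := ((((hasDerivAt_id θ).const_mul (n : ℝ)).add_const (c + Real.pi / 2)).cos).smul
        (hd θ)
      refine h1.congr_deriv ?_
      simp only [id, ← add_assoc, Real.sin_add_pi_div_two]
      module
  have h2 := intervalIntegral.integral_eq_sub_of_hasDerivAt (a := -Real.pi) (b := Real.pi)
    (fun θ _ => hd2 θ) (Continuous.intervalIntegrable (by fun_prop) _ _)
  have h3 := (cos_nat_mul_add_periodic n (c + Real.pi / 2)) (-Real.pi)
  have h4 := hp (-Real.pi)
  rw [show -Real.pi + 2 * Real.pi = Real.pi by ring] at h3 h4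
  simp only at h3
  rw [h3, h4, sub_self, intervalIntegral.integral_sub (intervalIntegrable_cos_smul n _ hf _ _)
    (Continuous.intervalIntegrable (by fun_prop) _ _), sub_eq_zero] at h2
  rw [pairing, h2, pairing, ← intervalIntegral.integral_smul]
  simp only [smul_smul]

/-- The Fourier symbol of `Λ`. -/
theorem pairing_lambda (hγ : 0 < γ) (u : HolderSpace 1 γ) :
    pairing n c (fun θ => -(1 / (4 * Real.pi)) • cotConv (deriv u) θ)
      = -(n / 4 : ℝ) • pairing n c u := by
  have h1 : pairing n c (fun θ => -(1 / (4 * Real.pi)) • cotConv (deriv u) θ)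
      = -(1 / (4 * Real.pi)) • pairing n c (cotConv (deriv u)) := by
    rw [pairing, pairing, ← intervalIntegral.integral_smul]
    exact intervalIntegral.integral_congr fun θ _ => smul_comm _ _ _
  rw [h1, pairing_cotConv hγ u.continuous_deriv u.periodic_deriv (u.norm_deriv_sub_le hγ),
    pairing_deriv u.hasDerivAt u.continuous_deriv u.periodic]
  rcases eq_or_ne n 0 with rfl | hn
  · simp
  · rw [integral_cotKernel_mul_sin hn, smul_smul, smul_smul]
    congr 1
    have := Real.pi_pos
    field_simp

/-- All complex Fourier coefficients of `w` on `AddCircle` vanish. They are then trivially summable,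
so the Fourier series converges to `w`, and its sum is zero. -/
theorem eq_zero_of_integral_cos_eq_zero {w : ℝ → ℝ} (hw : Continuous w)
    (hp : Function.Periodic w (2 * Real.pi))
    (h : ∀ (n : ℕ) (c : ℝ), ∫ θ in (-Real.pi)..Real.pi, Real.cos (n * θ + c) * w θ = 0) (θ : ℝ) :
    w θ = 0 := by
  have hT : Fact (0 < 2 * Real.pi) := ⟨by positivity⟩
  have hz : ∀ (n : ℤ) (c : ℝ), ∫ θ in (-Real.pi)..Real.pi, Real.cos (n * θ + c) * w θ = 0 := by
    intro n c
    rcases Int.natAbs_eq n with hn | hn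
    · rw [hn, Int.cast_natCast]
      exact h n.natAbs c
    · have e : ∀ θ : ℝ, Real.cos (n * θ + c) = Real.cos (n.natAbs * θ + -c) := fun θ => by
        have : (n : ℝ) = -(n.natAbs : ℝ) := by
          conv_lhs => rw [hn]
          rw [Int.cast_neg, Int.cast_natCast]
        rw [this, ← Real.cos_neg]
        congr 1
        ring
      simp only [e, h]
  have hp' : Function.Periodic (fun θ => (w θ : ℂ)) (2 * Real.pi) := fun θ => by
    simp only [hp θ]
  let W : C(AddCircle (2 * Real.pi), ℂ) := ⟨hp'.lift, by
    refine (QuotientAddGroup.isOpenQuotientMap_mk).isQuotientMap.continuous_iff.2 ?_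
    exact Complex.continuous_ofReal.comp hw⟩
  have hW : ∀ θ : ℝ, W θ = w θ := fun θ => hp'.lift_coe θ
  have hcoef : ∀ n : ℤ, fourierCoeff W n = 0 := by
    intro n
    rw [fourierCoeff_eq_intervalIntegral W n (-Real.pi),
      show -Real.pi + 2 * Real.pi = Real.pi by ring]
    have e : ∀ x : ℝ, (fourier (-n)) (x : AddCircle (2 * Real.pi)) • W x
        = ((Real.cos (n * x + 0) * w x : ℝ) : ℂ)
          + Complex.I * ((Real.cos (n * x + Real.pi / 2) * w x : ℝ) : ℂ) := by
      intro x
      have hπ : (Real.pi : ℂ) ≠ 0 := by exact_mod_cast Real.pi_ne_zero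
      rw [hW, fourier_coe_apply, smul_eq_mul, Real.cos_add_pi_div_two, add_zero,
        show 2 * (Real.pi : ℂ) * Complex.I * ((-n : ℤ) : ℂ) * x / ((2 * Real.pi : ℝ) : ℂ)
          = ((-(n * x) : ℝ) : ℂ) * Complex.I by push_cast; field_simp,
        Complex.exp_mul_I, ← Complex.ofReal_cos, ← Complex.ofReal_sin, Real.cos_neg, Real.sin_neg]
      push_cast
      ring
    have hci := fun c : ℝ => (Continuous.intervalIntegrable (μ := volume)
      (by fun_prop : Continuous fun x : ℝ => ((Real.cos (n * x + c) * w x : ℝ) : ℂ))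
      (-Real.pi) Real.pi)
    simp only [e]
    rw [intervalIntegral.integral_add (hci _) ((hci _).const_mul _),
      intervalIntegral.integral_const_mul, intervalIntegral.integral_ofReal,
      intervalIntegral.integral_ofReal, hz, hz]
    simp
  have h0 : fourierCoeff W = fun _ => 0 := funext hcoef
  have h1 := hasSum_fourier_series_of_summable (f := W) (by rw [h0]; exact summable_zero)
  simp only [hcoef, zero_smul] at h1
  have h2 : W = 0 := h1.unique hasSum_zero
  have h3 := hW θ
  rw [h2, ContinuousMap.zero_apply] at h3
  exact_mod_cast h3.symm

/-- A continuous periodic function is determined by its Fourier coefficients. -/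
theorem eq_of_pairing_eq (hu : Continuous u) (hv : Continuous v)
    (hup : Function.Periodic u (2 * Real.pi)) (hvp : Function.Periodic v (2 * Real.pi))
    (h : ∀ n c, pairing n c u = pairing n c v) : u = v := by
  funext θ
  ext i
  refine sub_eq_zero.1 (eq_zero_of_integral_cos_eq_zero (w := fun θ => u θ i - v θ i)
    (by fun_prop) (fun θ => by simp only [hup θ, hvp θ]) (fun n c => ?_) θ)
  have h1 := congrArg (fun p : Plane => p i) (h n c)
  simp only [pairing] at h1
  rw [intervalIntegral_apply (intervalIntegrable_cos_smul n c hu _ _),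
    intervalIntegral_apply (intervalIntegrable_cos_smul n c hv _ _), ← sub_eq_zero,
    ← intervalIntegral.integral_sub (Continuous.intervalIntegrable (by fun_prop) _ _)
      (Continuous.intervalIntegrable (by fun_prop) _ _)] at h1
  rw [← h1]
  refine intervalIntegral.integral_congr fun θ _ => ?_
  simp only [PiLp.smul_apply, smul_eq_mul]
  ring

end Pairing

/-! ### Mild and strong solutions -/

section Strong

/-- Variation of constants for one Fourier mode, yielding the integrated equation. Working mode by
mode avoids differentiating the Duhamel integral in a Hölder space. -/
theorem eq_integral_of_duhamel {a r : ℝ → Plane} {κ T : ℝ} {a₀ : Plane}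
    (hr : ContinuousOn r (Icc 0 T))
    (h : ∀ t ∈ Icc 0 T, a t = Real.exp (-(κ * t)) • a₀
      + ∫ s in (0 : ℝ)..t, Real.exp (-(κ * (t - s))) • r s) {t : ℝ} (ht : t ∈ Icc 0 T) :
    a t = a₀ + ∫ s in (0 : ℝ)..t, (-κ • a s + r s) := by
  -- A continuous extension of `r` to the line, so that `d` is differentiable everywhere and end
  -- points need no special care.
  set q : ℝ → Plane := fun s => r (max 0 (min s T)) with hq
  have hT : 0 ≤ T := ht.1.trans ht.2
  have hqc : Continuous q := hr.comp_continuous (by fun_prop) fun s =>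
    ⟨le_max_left _ _, max_le hT (min_le_right _ _)⟩
  have hqr : ∀ s ∈ Icc 0 T, q s = r s := fun s hs => by
    simp only [hq]
    rw [min_eq_left hs.2, max_eq_right hs.1]
  set d : ℝ → Plane := fun t => Real.exp (-(κ * t)) •
    (a₀ + ∫ s in (0 : ℝ)..t, Real.exp (κ * s) • q s) with hd
  have had : ∀ t ∈ Icc 0 T, a t = d t := fun t ht => by
    rw [h t ht, hd]
    simp only
    rw [smul_add, ← intervalIntegral.integral_smul]
    congr 1
    refine intervalIntegral.integral_congr fun s hs => ?_
    rw [uIcc_of_le ht.1] at hs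
    rw [hqr s ⟨hs.1, hs.2.trans ht.2⟩, smul_smul, ← Real.exp_add]
    congr 2
    ring
  have hcont : Continuous fun s => Real.exp (κ * s) • q s := by fun_prop
  have hderiv : ∀ t, HasDerivAt d (-κ • d t + q t) t := fun t => by
    have h1 := intervalIntegral.integral_hasDerivAt_right (hcont.intervalIntegrable 0 t)
      (hcont.stronglyMeasurableAtFilter _ _) hcont.continuousAt
    have h2 := (((hasDerivAt_id t).const_mul κ).neg.exp).smul (h1.const_add a₀)
    refine h2.congr_deriv ?_
    have e : Real.exp (-(κ * t)) * Real.exp (κ * t) = 1 := by rw [← Real.exp_add]; simp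
    simp only [hd, id, smul_smul, Pi.neg_apply, e, mul_one, one_smul]
    module
  have hdc : Continuous d := continuous_iff_continuousAt.2 fun t => (hderiv t).continuousAt
  have h3 := intervalIntegral.integral_eq_sub_of_hasDerivAt (a := 0) (b := t)
    (fun s _ => hderiv s) (Continuous.intervalIntegrable (by fun_prop) _ _)
  have h4 : d 0 = a₀ := by simp [hd]
  rw [had t ht, ← sub_eq_iff_eq_add', ← h4, ← h3]
  refine intervalIntegral.integral_congr fun s hs => ?_
  rw [uIcc_of_le ht.1] at hs
  have hs' : s ∈ Icc 0 T := ⟨hs.1, hs.2.trans ht.2⟩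
  simp only [had s hs', hqr s hs']

/-- Integrating factor: the derivative of `e^(-κ(t-s)) a s` in `s` is `e^(-κ(t-s)) r s`.
Differentiability is only needed in the interior. -/
theorem eq_duhamel_of_hasDerivAt {a r : ℝ → Plane} {κ T : ℝ} (ha : ContinuousOn a (Icc 0 T))
    (hr : ContinuousOn r (Icc 0 T)) (hd : ∀ t ∈ Ioo 0 T, HasDerivAt a (-κ • a t + r t) t)
    {t : ℝ} (ht : t ∈ Icc 0 T) :
    a t = Real.exp (-(κ * t)) • a 0 + ∫ s in (0 : ℝ)..t, Real.exp (-(κ * (t - s))) • r s := by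
  have hsub : Icc 0 t ⊆ Icc 0 T := Icc_subset_Icc_right ht.2
  have hc : Continuous fun s => Real.exp (-(κ * (t - s))) := by fun_prop
  have h := intervalIntegral.integral_eq_sub_of_hasDerivAt_of_le ht.1
    (f := fun s => Real.exp (-(κ * (t - s))) • a s)
    (f' := fun s => Real.exp (-(κ * (t - s))) • r s)
    (hc.continuousOn.smul (ha.mono hsub)) (fun s hs => by
      have h1 := ((((hasDerivAt_id s).const_sub t).const_mul κ).neg.exp).smul
        (hd s ⟨hs.1, hs.2.trans_le ht.2⟩)
      refine h1.congr_deriv ?_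
      simp only [id, Pi.neg_apply]
      module)
    (ContinuousOn.intervalIntegrable (by
      rw [uIcc_of_le ht.1]
      exact hc.continuousOn.smul (hr.mono hsub)))
  simp only [sub_self, mul_zero, neg_zero, Real.exp_zero, one_smul, sub_zero] at h
  rw [h]
  abel

namespace Evolution

variable {γ T : ℝ} {X₀ : HolderSpace 1 γ} {X : ℝ → HolderSpace 1 γ} {n : ℕ} {c : ℝ}

theorem pairing_duhamel (V : Evolution γ) (hT : 0 < T) {f : ℝ → HolderSpace 0 V.α}
    (hf : ContinuousOn f (Icc 0 T)) {t : ℝ} (ht : t ∈ Icc 0 T) :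
    pairing n c (duhamel V.S f t : HolderSpace 1 γ)
      = ∫ s in (0 : ℝ)..t, Real.exp (-(n / 4 * (t - s))) • pairing n c (f s) := by
  have := completeSpace_holder_one V.pos
  obtain ⟨C, hS⟩ := V.S_smoothing T hT
  rw [← pairingCLM_apply, duhamel, ← (pairingCLM 1 γ n c).intervalIntegral_comp_comm
    (hS.intervalIntegrable ht (hf.mono (Icc_subset_Icc_right ht.2)))]
  refine intervalIntegral.integral_congr_ae ?_
  have h0 : ∀ᵐ s : ℝ, s ≠ t := by simp [ae_iff, measure_singleton]
  filter_upwards [h0] with s hst hs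
  rw [uIoc_of_le ht.1] at hs
  have hts : 0 < t - s := sub_pos.2 (lt_of_le_of_ne hs.2 hst)
  have hfun : (V.S (t - s) (f s) : ℝ → Plane) = semigroup (t - s) (f s) :=
    funext (V.S_apply _ hts _)
  rw [pairingCLM_apply, hfun, pairing_semigroup hts.le (f s).continuous (f s).periodic]

theorem pairing_mild (V : Evolution γ) (hT : 0 < T) {f : ℝ → HolderSpace 0 V.α}
    (hf : ContinuousOn f (Icc 0 T)) {t : ℝ} (ht : t ∈ Icc 0 T) :
    pairing n c (V.heat t X₀ + duhamel V.S f t : HolderSpace 1 γ)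
      = Real.exp (-(n / 4 * t)) • pairing n c X₀
        + ∫ s in (0 : ℝ)..t, Real.exp (-(n / 4 * (t - s))) • pairing n c (f s) := by
  have hfun : (V.heat t X₀ : ℝ → Plane) = semigroup t X₀ := funext (V.heat_apply t ht.1 X₀)
  rw [← V.pairing_duhamel hT hf ht, ← pairing_semigroup ht.1 X₀.continuous X₀.periodic, ← hfun]
  exact (pairingCLM 1 γ n c).map_add _ _

/-- The velocity `Λ X + R(X)`, as a map into `C^{0,γ}`. -/
theorem exists_velocity (V : Evolution γ) : ∃ W : HolderSpace 1 γ → HolderSpace 0 γ,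
    (∀ X : HolderSpace 1 γ, 0 < arcChord X → ∀ θ v, IsBoundaryIntegral X θ v ↔ v = W X θ) ∧
    (∀ X : ℝ → HolderSpace 1 γ, ∀ T, ContinuousOn X (Icc 0 T) →
      (∀ t ∈ Icc 0 T, 0 < arcChord (X t)) → ContinuousOn (fun t => W (X t)) (Icc 0 T)) ∧
    ∀ X n c, pairing n c (W X) = -(n / 4 : ℝ) • pairing n c X + pairing n c (V.R X) := by
  have hγ1 : γ < 1 := V.lt.trans V.lt_one
  obtain ⟨L, hL⟩ := exists_lambdaCLM V.pos hγ1
  obtain ⟨J, hJ, -⟩ := exists_inclusion_zero_zero V.pos V.lt.le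
  refine ⟨fun X => L X + J (V.R X), fun X hX θ v => ?_, fun X T hX hpos => ?_, fun X n c => ?_⟩
  · rw [isBoundaryIntegral_iff V.pos hγ1 X hX, HolderSpace.coe_add, hL, hJ, V.R_apply X hX]
  · exact (L.continuous.comp_continuousOn hX).add
      (J.continuous.comp_continuousOn (V.continuousOn_R hX hpos))
  · have e1 : (L X : ℝ → Plane) = fun θ => -(1 / (4 * Real.pi)) • cotConv (deriv X) θ :=
      funext (hL X)
    have e2 : (J (V.R X) : ℝ → Plane) = V.R X := funext (hJ _)
    rw [← pairing_lambda V.pos, ← e1, ← e2]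
    exact (pairingCLM 0 γ n c).map_add _ _

/-- The candidate for `X` in `C^{0,γ}` is `X₀` plus the time integral of the velocity, continuously
differentiable by construction. It equals `X` because each Fourier mode of `X` satisfies the same
integrated equation. -/
theorem isStrongSolution_of_isMildSolution (V : Evolution γ) (hT : 0 < T)
    (h : IsMildSolution T X₀ X) : IsStrongSolution T X₀ X := by
  have := completeSpace_holder_zero V.pos
  obtain ⟨W, hW, hWc, hWp⟩ := V.exists_velocity
  obtain ⟨ι, hι, -⟩ := exists_inclusion_one_zero γ V.pos (V.lt.trans V.lt_one).le
  obtain ⟨hX, hpos, heq⟩ := (V.isMildSolution_iff hT).1 h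
  set Q : ℝ → HolderSpace 0 γ := fun t => W (X (max 0 (min t T))) with hQ
  have hQc : Continuous Q := (hWc X T hX hpos).comp_continuous (f := fun t => max 0 (min t T))
    (by fun_prop) fun s => ⟨le_max_left _ _, max_le hT.le (min_le_right _ _)⟩
  have hQW : ∀ s ∈ Icc 0 T, Q s = W (X s) := fun s hs => by
    simp only [hQ]
    rw [min_eq_left hs.2, max_eq_right hs.1]
  refine ⟨hX, hpos, h.initial, h.tendsto_initial, fun t => ι X₀ + ∫ s in (0 : ℝ)..t, Q s, Q,
    fun t ht θ => ?_, fun t _ => ?_, hQc.continuousOn, fun t ht θ => ?_⟩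
  · refine congrFun (eq_of_pairing_eq (HolderSpace.continuous _) (HolderSpace.continuous _)
      (HolderSpace.periodic _) (HolderSpace.periodic _) fun n c => ?_) θ
    have hιf : (ι X₀ : ℝ → Plane) = X₀ := funext (hι X₀)
    have hR := V.continuousOn_R hX hpos
    have e1 := eq_integral_of_duhamel (a := fun t => pairing n c (X t))
      (r := fun t => pairing n c (V.R (X t))) (κ := n / 4) (a₀ := pairing n c X₀)
      ((pairingCLM 0 V.α n c).continuous.comp_continuousOn hR)
      (fun t ht =>
        (congrArg (fun Z : HolderSpace 1 γ => pairing n c Z) (heq t ht)).trans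
          (V.pairing_mild hT hR ht)) ht
    refine Eq.trans ?_ e1.symm
    rw [← pairingCLM_apply, map_add, pairingCLM_apply, hιf,
      ← (pairingCLM 0 γ n c).intervalIntegral_comp_comm (hQc.intervalIntegrable 0 t)]
    congr 1
    refine intervalIntegral.integral_congr fun s hs => ?_
    rw [uIcc_of_le ht.1] at hs
    simp only [hQW s ⟨hs.1, hs.2.trans ht.2⟩, pairingCLM_apply, hWp]
  · exact ((intervalIntegral.integral_hasDerivAt_right (hQc.intervalIntegrable 0 t)
      (hQc.stronglyMeasurableAtFilter _ _) hQc.continuousAt).const_add _).hasDerivWithinAt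
  · have ht' : t ∈ Icc 0 T := ⟨ht.1.le, ht.2⟩
    rw [hW _ (hpos t ht'), hQW t ht']

/-- Each Fourier mode solves a linear differential equation with decay rate `n/4` and forcing by the
mode of the remainder. Its solution formula is the corresponding mode of the mild equation. -/
theorem isMildSolution_of_isStrongSolution (V : Evolution γ) (hT : 0 < T)
    (h : IsStrongSolution T X₀ X) : IsMildSolution T X₀ X := by
  obtain ⟨W, hW, hWc, hWp⟩ := V.exists_velocity
  obtain ⟨Y, Q, hYX, hYd, -, hQ⟩ := h.eqn
  have hX := h.continuousOn
  have hpos := h.arcChord_pos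
  have hR := V.continuousOn_R hX hpos
  refine (V.isMildSolution_iff hT).2 ⟨hX, hpos, fun t ht => HolderSpace.ext fun θ => ?_⟩
  refine congrFun (eq_of_pairing_eq (HolderSpace.continuous _) (HolderSpace.continuous _)
    (HolderSpace.periodic _) (HolderSpace.periodic _) fun n c => ?_) θ
  rw [V.pairing_mild hT hR ht]
  have hYf : ∀ t ∈ Icc 0 T, (Y t : ℝ → Plane) = X t := fun t ht => funext (hYX t ht)
  have hXc : ContinuousOn (fun t => pairing n c (X t)) (Icc 0 T) :=
    (pairingCLM 1 γ n c).continuous.comp_continuousOn hX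
  have e1 := eq_duhamel_of_hasDerivAt (a := fun t => pairing n c (X t))
    (r := fun t => pairing n c (V.R (X t))) (κ := n / 4) hXc
    ((pairingCLM 0 V.α n c).continuous.comp_continuousOn hR) (fun t ht => by
      have ht' : t ∈ Icc 0 T := Ioo_subset_Icc_self ht
      have hnhds := Icc_mem_nhds ht.1 ht.2
      have h1 := (pairingCLM 0 γ n c).hasFDerivAt.comp_hasDerivAt t ((hYd t ht').hasDerivAt hnhds)
      have h2 : Q t = W (X t) := HolderSpace.ext fun θ =>
        (hW _ (hpos t ht') θ _).1 (hQ t ⟨ht.1, ht.2.le⟩ θ)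
      rw [h2, pairingCLM_apply, hWp] at h1
      refine h1.congr_of_eventuallyEq ?_
      filter_upwards [hnhds] with s hs
      simp only [Function.comp_apply, pairingCLM_apply, hYf s hs]) ht
  rw [h.initial] at e1
  exact e1

end Evolution

end Strong

end Peskin

end

/-! ### Assembly of the four assertions. -/

theorem theorem1p1 (γ : ℝ) (hγ₀ : 0 < γ) (hγ₁ : γ < 1) (X₀ : Peskin.HolderSpace 1 γ)
    (hX₀ : X₀ ∈ Peskin.littleHolder γ) (hX₀' : 0 < Peskin.arcChord X₀) :
    (∃ T : ℝ, 0 < T ∧ ∃ X : ℝ → Peskin.HolderSpace 1 γ, Peskin.IsMildSolution T X₀ X) ∧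
    (∀ T : ℝ, 0 < T → ∀ X Y : ℝ → Peskin.HolderSpace 1 γ,
      Peskin.IsMildSolution T X₀ X → Peskin.IsMildSolution T X₀ Y → EqOn X Y (Icc 0 T)) ∧
    (∀ (T : ℝ) (hT : 0 < T) (X : ℝ → Peskin.HolderSpace 1 γ), Peskin.IsMildSolution T X₀ X →
      ∃ ε : ℝ, 0 < ε ∧ ∃ Φ : Peskin.HolderSpace 1 γ → C(Icc 0 T, Peskin.HolderSpace 1 γ),
        (∀ Y₀ ∈ Peskin.littleHolder γ, ‖X₀ - Y₀‖ ≤ ε →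
          Peskin.IsMildSolution T Y₀ (IccExtend hT.le (Φ Y₀))) ∧
        ContinuousOn Φ {Y₀ | Y₀ ∈ Peskin.littleHolder γ ∧ ‖X₀ - Y₀‖ ≤ ε}) ∧
    (∀ T : ℝ, 0 < T → ∀ X : ℝ → Peskin.HolderSpace 1 γ,
      Peskin.IsMildSolution T X₀ X ↔ Peskin.IsStrongSolution T X₀ X) := by
  obtain ⟨V⟩ := Peskin.exists_evolution hγ₀ hγ₁
  exact ⟨V.exists_isMildSolution hX₀ hX₀',
    fun T hT X Y hX hY => V.eqOn_of_isMildSolution hT hX hY,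
    fun T hT X hX => V.exists_continuous_dependence hT hX,
    fun T hT X => ⟨V.isStrongSolution_of_isMildSolution hT, V.isMildSolution_of_isStrongSolution hT⟩⟩
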